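/- Let $N\ge 2$, $1<p<+\infty$, $p'=\frac{p}{p-1}$, and let $F:\mathbb R^N\to[0,+\infty[$ be convex, with $F(t\xi)=|t|F(\xi)$ for $t\in\mathbb R$ and $F(\xi)\ge a_0|\xi|$ for some $a_0>0$, of class $C^{3,\alpha}$ on $\mathbb R^N\setminus\{0\}$, and with the Hessian of $F^p$ positive definite on $\mathbb R^N\setminus\{0\}$. Let $F^o(v)=\sup_{\xi\neq0}\frac{\langle \xi,v\rangle}{F(\xi)}$. For a domain (nonempty connected open set) $\Omega$ of class $C^2$ with outer unit normal $\nu_\Omega$ let $$\lambda_1(\beta,\Omega)=\inf_{\psi\in W^{1,p}(\Omega)\setminus\{0\}}\frac{\int_\Omega F(\nabla\psi)^p\,dx+\beta\int_{\partial\Omega}|\psi|^pF(\nu_\Omega)\,d\mathcal H^{N-1}}{\int_\Omega|\psi|^p\,dx},$$ $$d_F(x)=\inf_{y\in\partial\Omega}F^o(x-y),\qquad R_F(\Omega)=\sup_{x\in\overline\Omega}d_F(x)$$ (the anisotropic inradius), and let the anisotropic mean curvature $\mathcal H_F(y)$ at $y\in\partial\Omega$ be the sum of the eigenvalues of the anisotropic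 Weingarten map $d(\nabla F\circ\nu_\Omega):T_y\partial\Omega\to T_y\partial\Omega$. Let $\cosh_p:[0,+\infty[\to[1,+\infty[$ be the inverse function of $\operatorname{arccosh}_p(x)=\int_1^x (t^p-1)^{-1/p}\,dt$, $x\ge1$. **Theorem.** Let $\beta<0$. (i) Let $\Omega\subset\mathbb R^N$ be a bounded $C^2$ domain with $\mathcal H_F\ge0$ on $\partial\Omega$. Then the equation $$-\frac{\mu}{p-1}=\frac{|\beta|^{p'}}{1-\cosh_p^{-p}\left(\left(\frac{-\mu}{p-1}\right)^{1/p}R_F(\Omega)\right)}$$ has a unique negative solution $\mu=\mu_1(\beta,R_F(\Omega))$, and $$\lambda_1(\beta,\Omega)\le\mu_1(\beta,R_F(\Omega)).$$ (ii) The estimate is sharp on slabs: for every unit vector $e$ and every $a>0$, the infinite slab $S=\{x\in\mathbb R^N:|\langle x,e\rangle|<\frac a2\}$ satisfies $\lambda_1(\beta,S)=\mu_1(\beta,R_F(S))$, where $\mu_1(\beta,R_F(S))$ is the unique negative solution of the same equation with $R_F(S)$ in place of $R_F(\Omega)$. -/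

import Mathlib

open MeasureTheory Filter Topology Set
open scoped ContDiff NNReal ENNReal

noncomputable section

namespace RobinFinsler

/-! ## Finsler norms -/

/-- The standing assumptions on the anisotropy `F`: convex, absolutely `1`-homogeneous, bounded below
by a multiple of the Euclidean norm, of class `C^{3,α}` away from the origin for some `α ∈ (0,1]`
(third derivative Hölder continuous on compact subsets), and with positive definite Hessian of
`F ^ p` away from the origin. -/
structure IsFinslerNorm {N : ℕ} (p : ℝ) (F : EuclideanSpace ℝ (Fin N) → ℝ) : Prop where
  convex : ConvexOn ℝ univ F
  homogeneous : ∀ (t : ℝ) (ξ : EuclideanSpace ℝ (Fin N)), F (t • ξ) = |t| * F ξ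
  coercive : ∃ a : ℝ, 0 < a ∧ ∀ ξ, a * ‖ξ‖ ≤ F ξ
  contDiffOn : ContDiffOn ℝ 3 F {0}ᶜ
  holder : ∃ α : ℝ≥0, 0 < α ∧ α ≤ 1 ∧
    ∀ K : Set (EuclideanSpace ℝ (Fin N)), IsCompact K → K ⊆ {0}ᶜ →
      ∃ C : ℝ≥0, HolderOnWith C α (iteratedFDeriv ℝ 3 F) K
  hessian_pos : ∀ ξ η : EuclideanSpace ℝ (Fin N), ξ ≠ 0 → η ≠ 0 →
    0 < fderiv ℝ (fderiv ℝ (fun x => F x ^ p)) ξ η η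

/-- The polar function `Fᵒ(v) = sup_{ξ ≠ 0} ⟨ξ, v⟩ / F(ξ)`. -/
def polar {N : ℕ} (F : EuclideanSpace ℝ (Fin N) → ℝ) (v : EuclideanSpace ℝ (Fin N)) : ℝ :=
  ⨆ ξ : {ξ : EuclideanSpace ℝ (Fin N) // ξ ≠ 0}, inner ℝ ξ.1 v / F ξ.1

/-- The anisotropic distance to the boundary, `d_F(x) = inf_{y ∈ ∂Ω} Fᵒ(x - y)`. -/
def distBoundary {N : ℕ} (F : EuclideanSpace ℝ (Fin N) → ℝ) (Ω : Set (EuclideanSpace ℝ (Fin N)))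
    (x : EuclideanSpace ℝ (Fin N)) : ℝ :=
  ⨅ y : frontier Ω, polar F (x - y.1)

/-- The anisotropic inradius: the supremum of `d_F` over the closure of `Ω`. -/
def inradius {N : ℕ} (F : EuclideanSpace ℝ (Fin N) → ℝ)
    (Ω : Set (EuclideanSpace ℝ (Fin N))) : ℝ :=
  sSup (distBoundary F Ω '' closure Ω)

/-! ## `C²` domains, normals and anisotropic mean curvature -/

/-- `ρ` is a `C²` defining function of `Ω` on the open neighbourhood `U` of `y`: its gradient does
not vanish on `U`, and inside `U` the set `Ω` is `{ρ < 0}` and its boundary is `{ρ = 0}`. -/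
structure IsC2DefiningFunction {N : ℕ} (Ω : Set (EuclideanSpace ℝ (Fin N)))
    (y : EuclideanSpace ℝ (Fin N)) (U : Set (EuclideanSpace ℝ (Fin N)))
    (ρ : EuclideanSpace ℝ (Fin N) → ℝ) : Prop where
  isOpen : IsOpen U
  mem : y ∈ U
  contDiffOn : ContDiffOn ℝ 2 ρ U
  gradient_ne_zero : ∀ x ∈ U, gradient ρ x ≠ 0
  mem_iff : ∀ x ∈ U, x ∈ Ω ↔ ρ x < 0
  mem_frontier_iff : ∀ x ∈ U, x ∈ frontier Ω ↔ ρ x = 0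

/-- A domain (nonempty connected open set) of class `C²`. -/
structure IsC2Domain {N : ℕ} (Ω : Set (EuclideanSpace ℝ (Fin N))) : Prop where
  isOpen : IsOpen Ω
  isConnected : IsConnected Ω
  boundary : ∀ y ∈ frontier Ω, ∃ U ρ, IsC2DefiningFunction Ω y U ρ

open Classical in
/-- The Euclidean outer unit normal `ν_Ω(y)`: the normalized gradient at `y` of a local defining
function (whose choice does not matter), and `0` where there is no such function. -/
def outerNormal {N : ℕ} (Ω : Set (EuclideanSpace ℝ (Fin N))) (y : EuclideanSpace ℝ (Fin N)) :
    EuclideanSpace ℝ (Fin N) :=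
  if h : ∃ ρ : EuclideanSpace ℝ (Fin N) → ℝ, ∃ U, y ∈ frontier Ω ∧ IsC2DefiningFunction Ω y U ρ
  then ‖gradient h.choose y‖⁻¹ • gradient h.choose y
  else 0

/-- The anisotropic outer normal `n_Ω^F(y) = F_ξ(ν_Ω(y))`. -/
def anisotropicNormal {N : ℕ} (F : EuclideanSpace ℝ (Fin N) → ℝ)
    (Ω : Set (EuclideanSpace ℝ (Fin N))) (y : EuclideanSpace ℝ (Fin N)) :
    EuclideanSpace ℝ (Fin N) :=
  gradient F (outerNormal Ω y)

/-- The tangent space `T_y ∂Ω`, the orthogonal complement of the normal. -/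
abbrev tangentSpace {N : ℕ} (Ω : Set (EuclideanSpace ℝ (Fin N)))
    (y : EuclideanSpace ℝ (Fin N)) : Submodule ℝ (EuclideanSpace ℝ (Fin N)) :=
  (Submodule.span ℝ {outerNormal Ω y})ᗮ

/-- The anisotropic Weingarten map `d n_Ω^F : T_y ∂Ω → T_y ∂Ω`. The derivative of the map
`n_Ω^F` along `∂Ω` is taken with `fderivWithin`; on tangent vectors it is determined by the
values of `n_Ω^F` on `∂Ω`. It maps tangent vectors to tangent vectors, so that the orthogonal
projection only adjusts the codomain. -/
def weingarten {N : ℕ} (F : EuclideanSpace ℝ (Fin N) → ℝ)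
    (Ω : Set (EuclideanSpace ℝ (Fin N))) (y : EuclideanSpace ℝ (Fin N)) :
    tangentSpace Ω y →L[ℝ] tangentSpace Ω y :=
  (tangentSpace Ω y).orthogonalProjectionOnto ∘L
    fderivWithin ℝ (anisotropicNormal F Ω) (frontier Ω) y ∘L (tangentSpace Ω y).subtypeL

/-- The anisotropic mean curvature `H_F(y)`: the sum of the anisotropic principal curvatures, that
is, of the eigenvalues of the anisotropic Weingarten map. -/
def anisotropicMeanCurvature {N : ℕ} (F : EuclideanSpace ℝ (Fin N) → ℝ)
    (Ω : Set (EuclideanSpace ℝ (Fin N))) (y : EuclideanSpace ℝ (Fin N)) : ℝ :=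
  LinearMap.trace ℝ (tangentSpace Ω y) (weingarten F Ω y).toLinearMap

/-! ## Sobolev functions, traces and the first Robin eigenvalue -/

/-- Surface measure on `∂Ω`: the `(N-1)`-dimensional Hausdorff measure, in its Euclidean
normalization, restricted to `∂Ω`. -/
def surfaceMeasure {N : ℕ} (Ω : Set (EuclideanSpace ℝ (Fin N))) :
    Measure (EuclideanSpace ℝ (Fin N)) :=
  (Measure.euclideanHausdorffMeasure (N - 1)).restrict (frontier Ω)

/-- `u ∈ W^{1,p}(Ω)` with weak gradient `G`. -/
structure IsSobolev {N : ℕ} (Ω : Set (EuclideanSpace ℝ (Fin N))) (p : ℝ)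
    (u : EuclideanSpace ℝ (Fin N) → ℝ)
    (G : EuclideanSpace ℝ (Fin N) → EuclideanSpace ℝ (Fin N)) : Prop where
  memLp : MemLp u (ENNReal.ofReal p) (volume.restrict Ω)
  memLp_grad : MemLp G (ENNReal.ofReal p) (volume.restrict Ω)
  weak : ∀ φ : EuclideanSpace ℝ (Fin N) → ℝ, ContDiff ℝ ∞ φ → HasCompactSupport φ →
    tsupport φ ⊆ Ω → ∫ x in Ω, u x • gradient φ x = - ∫ x in Ω, φ x • G x

/-- `g ∈ L^p(∂Ω)` is the boundary trace of `u ∈ W^{1,p}(Ω)` (with weak gradient `G`): there are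
test functions `φ n ∈ C_c^∞(ℝ^N)` with `φ n → u` in `W^{1,p}(Ω)` and `φ n → g` in `L^p(∂Ω)`. -/
def IsTrace {N : ℕ} (Ω : Set (EuclideanSpace ℝ (Fin N))) (p : ℝ)
    (u : EuclideanSpace ℝ (Fin N) → ℝ)
    (G : EuclideanSpace ℝ (Fin N) → EuclideanSpace ℝ (Fin N))
    (g : EuclideanSpace ℝ (Fin N) → ℝ) : Prop :=
  MemLp g (ENNReal.ofReal p) (surfaceMeasure Ω) ∧
  ∃ φ : ℕ → EuclideanSpace ℝ (Fin N) → ℝ,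
    (∀ n, ContDiff ℝ ∞ (φ n)) ∧ (∀ n, HasCompactSupport (φ n)) ∧
    Tendsto (fun n => eLpNorm (fun x => φ n x - u x) (ENNReal.ofReal p) (volume.restrict Ω))
      atTop (𝓝 0) ∧
    Tendsto (fun n => eLpNorm (fun x => gradient (φ n) x - G x) (ENNReal.ofReal p)
      (volume.restrict Ω)) atTop (𝓝 0) ∧
    Tendsto (fun n => eLpNorm (fun x => φ n x - g x) (ENNReal.ofReal p) (surfaceMeasure Ω))
      atTop (𝓝 0)

/-- The Rayleigh quotient
`(∫_Ω F(∇u)^p + β ∫_{∂Ω} |u|^p F(ν_Ω) dH^{N-1}) / ∫_Ω |u|^p` of a function `u` with weak gradient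
`G` and boundary trace `g`. -/
def rayleigh {N : ℕ} (p : ℝ) (F : EuclideanSpace ℝ (Fin N) → ℝ) (β : ℝ)
    (Ω : Set (EuclideanSpace ℝ (Fin N)))
    (u : EuclideanSpace ℝ (Fin N) → ℝ)
    (G : EuclideanSpace ℝ (Fin N) → EuclideanSpace ℝ (Fin N))
    (g : EuclideanSpace ℝ (Fin N) → ℝ) : ℝ :=
  ((∫ x in Ω, F (G x) ^ p) + β * ∫ y, |g y| ^ p * F (outerNormal Ω y) ∂(surfaceMeasure Ω)) /
    ∫ x in Ω, |u x| ^ p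

/-- The first Robin eigenvalue: the infimum of the Rayleigh quotient over `W^{1,p}(Ω) \ {0}`, taken
in the extended reals. -/
def robinEigenvalue {N : ℕ} (p : ℝ) (F : EuclideanSpace ℝ (Fin N) → ℝ) (β : ℝ)
    (Ω : Set (EuclideanSpace ℝ (Fin N))) : EReal :=
  sInf {q : EReal | ∃ u G g, IsSobolev Ω p u G ∧ IsTrace Ω p u G g ∧
    ¬ (u =ᵐ[volume.restrict Ω] 0) ∧ q = ((rayleigh p F β Ω u G g : ℝ) : EReal)}

/-! ## The generalized hyperbolic cosine and the one-dimensional problem -/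

/-- `arccosh_p(x) = ∫_1^x (t^p - 1)^{-1/p} dt` for `x ≥ 1`. -/
def arccoshP (p x : ℝ) : ℝ :=
  ∫ t in (1 : ℝ)..x, 1 / (t ^ p - 1) ^ (1 / p)

/-- `cosh_p`: on `[0, ∞)` the inverse function of `arccosh_p : [1, ∞) → [0, ∞)`, extended evenly. -/
def coshP (p t : ℝ) : ℝ :=
  Function.invFunOn (arccoshP p) (Ici 1) |t|

/-- `μ` is a negative solution of
`-μ/(p-1) = |β|^{p'} / (1 - cosh_p^{-p}((-μ/(p-1))^{1/p} s))`, where `p' = p/(p-1)`. -/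
def IsNegativeRoot (p β s μ : ℝ) : Prop :=
  μ < 0 ∧
    -μ / (p - 1) =
      |β| ^ (p / (p - 1)) / (1 - coshP p ((-μ / (p - 1)) ^ (1 / p) * s) ^ (-p))

/-- The infinite slab of width `a` orthogonal to the unit vector `e`. -/
def slab {N : ℕ} (e : EuclideanSpace ℝ (Fin N)) (a : ℝ) : Set (EuclideanSpace ℝ (Fin N)) :=
  {x | |inner ℝ x e| < a / 2}

end RobinFinsler

end

/-!
The equation becomes one for `κ = (-μ / (p - 1)) ^ (1 / p)`. Let
`sinhP = (coshP ^ p - 1) ^ (1 / p)`, the derivative of `coshP` on the half line, and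
`riccatiP = (sinhP / coshP) ^ (p - 1)`. The equation says that `κ ^ (p - 1) * riccatiP (κ R) = |β|`,
the Robin condition at distance `R` from the centre for the one-dimensional ground state
`s ↦ coshP (κ s)`. Monotonicity and the intermediate value theorem give its unique solution
(`exists_isNegativeRoot`).

Upper bound on a bounded mean convex domain. The test function is `u = coshP (κ (R - d))`, where `d`
is the anisotropic distance to the boundary and `R` the inradius. Since `F (∇d) ≤ 1`, the Rayleigh
quotient of `u` is at most the root `μ` as soon as `∫_Ω f(d) ≤ ∫_0^R f * ∫_{∂Ω} F(ν)` for the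
nonnegative function `f(s) = p * coshP (κ (R - s)) ^ p - 1`, whose integral is `fluxP (κ R) / κ`.
This volume comparison (`lintegral_distBoundary_le`) holds because every `x ∈ Ω` is
`y - d(x) ∇F(ν(y))` for a foot point `y` on the boundary (`IsFinslerNorm.eq_sub_of_foot`): the normal
parametrization covers `Ω`, even if its parameters `(y, s)` are restricted to those whose image has
distance exactly `s` to the boundary. At these parameters the Jacobian is at most `F(ν)`. Indeed the
inner Wulff ball that touches the boundary at `y` bounds the eigenvalues of the Weingarten map, times
`s`, by one (`hessian_le_of_touching`), and then the inequality between the arithmetic and the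
geometric mean bounds the determinant of the identity minus this map by one when its trace is
nonnegative (`abs_det_one_sub_mul_le_one`). Neither injectivity of the parametrization nor regularity
of `d` beyond the Lipschitz property is needed, since an inequality for images suffices.

The slab. In the coordinates `ι z + s ∇F(e)`, where `ι` parametrizes `e^⊥`, the slab is a product
with an interval of half length equal to the inradius, and both its volume and its surface measure
are `F(e)` times those of the product, the latter weighted by `F(ν)`. As `F°(∇F(e)) = 1`, the
integrand `F(∇ψ)` dominates the derivative along the lines in the direction `∇F(e)`; on these lines
`s ↦ κ ^ (p - 1) * riccatiP (κ s)` solves a Riccati equation which with Young's inequality gives the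
Robin inequality (`robin_interval_le`), and the lower bound passes from test functions to Sobolev
functions by density (`le_rayleigh_slab`). Conversely the ground state, cut off transversally at
scale `1 / ε`, has a Rayleigh quotient that tends to the root (`robinEigenvalue_slab_le`).

Test functions are compactly supported and Lipschitz; mollification shows that they are Sobolev
functions which are their own trace (`isTrace_of_lipschitz`).
-/

noncomputable section

namespace RobinFinsler

/-! ### Finsler norms and their polars -/

section Finsler

variable {N : ℕ} {p : ℝ} {F : EuclideanSpace ℝ (Fin N) → ℝ}

theorem inner_gradient_eq_fderiv {H : Type*} [NormedAddCommGroup H] [InnerProductSpace ℝ H]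
    [CompleteSpace H] (f : H → ℝ) (x h : H) : inner ℝ (gradient f x) h = fderiv ℝ f x h := by
  simp [gradient]

theorem contDiffOn_gradient {H : Type*} [NormedAddCommGroup H] [InnerProductSpace ℝ H]
    [CompleteSpace H] {f : H → ℝ} {U : Set H} (hU : IsOpen U) {m n : WithTop ℕ∞}
    (hf : ContDiffOn ℝ n f U) (hmn : m + 1 ≤ n) : ContDiffOn ℝ m (gradient f) U :=
  (InnerProductSpace.toDual ℝ H).symm.contDiff.comp_contDiffOn
    (hf.fderiv_of_isOpen hU hmn)

namespace IsFinslerNorm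

theorem map_zero (hF : IsFinslerNorm p F) : F 0 = 0 := by
  simpa using hF.homogeneous 0 0

theorem map_neg (hF : IsFinslerNorm p F) (ξ : EuclideanSpace ℝ (Fin N)) : F (-ξ) = F ξ := by
  simpa using hF.homogeneous (-1) ξ

theorem map_smul_of_nonneg (hF : IsFinslerNorm p F) {t : ℝ} (ht : 0 ≤ t)
    (ξ : EuclideanSpace ℝ (Fin N)) : F (t • ξ) = t * F ξ := by
  rw [hF.homogeneous, abs_of_nonneg ht]

theorem pos (hF : IsFinslerNorm p F) {ξ : EuclideanSpace ℝ (Fin N)} (hξ : ξ ≠ 0) : 0 < F ξ := by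
  obtain ⟨a, ha, h⟩ := hF.coercive
  exact (mul_pos ha (norm_pos_iff.2 hξ)).trans_le (h ξ)

theorem nonneg (hF : IsFinslerNorm p F) (ξ : EuclideanSpace ℝ (Fin N)) : 0 ≤ F ξ := by
  obtain ⟨a, ha, h⟩ := hF.coercive
  exact (by positivity : 0 ≤ a * ‖ξ‖).trans (h ξ)

theorem add_le (hF : IsFinslerNorm p F) (ξ η : EuclideanSpace ℝ (Fin N)) :
    F (ξ + η) ≤ F ξ + F η := by
  have h := hF.convex.2 (mem_univ ((2 : ℝ) • ξ)) (mem_univ ((2 : ℝ) • η))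
    (by norm_num : (0 : ℝ) ≤ 1 / 2) (by norm_num : (0 : ℝ) ≤ 1 / 2) (by norm_num)
  rw [smul_smul, smul_smul, hF.homogeneous, hF.homogeneous] at h
  norm_num at h
  linarith

theorem continuous (hF : IsFinslerNorm p F) : Continuous F :=
  continuousOn_univ.1 (hF.convex.continuousOn isOpen_univ)

theorem exists_le_norm (hF : IsFinslerNorm p F) : ∃ C : ℝ, 0 < C ∧ ∀ ξ, F ξ ≤ C * ‖ξ‖ := by
  obtain ⟨C, hC⟩ := (isCompact_sphere (0 : EuclideanSpace ℝ (Fin N)) 1).exists_bound_of_continuousOn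
    hF.continuous.continuousOn
  refine ⟨max C 1, by positivity, fun ξ => ?_⟩
  rcases eq_or_ne ξ 0 with rfl | hξ
  · simp [hF.map_zero]
  have hn : 0 < ‖ξ‖ := norm_pos_iff.2 hξ
  have h1 := hC (‖ξ‖⁻¹ • ξ) (by simp [norm_smul, hn.ne'])
  rw [hF.map_smul_of_nonneg (by positivity), Real.norm_eq_abs] at h1
  have h2 := (le_abs_self _).trans (h1.trans (le_max_left C 1))
  rwa [inv_mul_eq_div, div_le_iff₀ hn] at h2

theorem differentiableAt (hF : IsFinslerNorm p F) {ξ : EuclideanSpace ℝ (Fin N)} (hξ : ξ ≠ 0) :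
    DifferentiableAt ℝ F ξ :=
  (hF.contDiffOn.contDiffAt (isOpen_compl_singleton.mem_nhds hξ)).differentiableAt (by norm_num)

theorem inner_gradient_self (hF : IsFinslerNorm p F) {ξ : EuclideanSpace ℝ (Fin N)} (hξ : ξ ≠ 0) :
    inner ℝ (gradient F ξ) ξ = F ξ := by
  rw [inner_gradient_eq_fderiv]
  have h1 : HasDerivAt (fun t : ℝ => F (ξ + t • ξ)) (fderiv ℝ F ξ ξ) 0 := by
    have h2 : HasDerivAt (fun t : ℝ => ξ + t • ξ) ξ 0 := by
      simpa using ((hasDerivAt_id (0 : ℝ)).smul_const ξ).const_add ξ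
    have h3 : HasFDerivAt F (fderiv ℝ F ξ) (ξ + (0 : ℝ) • ξ) := by
      simpa using (hF.differentiableAt hξ).hasFDerivAt
    exact h3.comp_hasDerivAt 0 h2
  have h4 : HasDerivAt (fun t : ℝ => F (ξ + t • ξ)) (F ξ) 0 := by
    have h5 : HasDerivAt (fun t : ℝ => (1 + t) * F ξ) (F ξ) 0 := by
      simpa using ((hasDerivAt_id (0 : ℝ)).const_add 1).mul_const (F ξ)
    refine h5.congr_of_eventuallyEq ?_
    filter_upwards [lt_mem_nhds (show (-1 : ℝ) < 0 by norm_num)] with t ht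
    rw [← hF.map_smul_of_nonneg (by linarith), add_smul, one_smul]
  exact h1.unique h4

theorem inner_gradient_le (hF : IsFinslerNorm p F) {η : EuclideanSpace ℝ (Fin N)} (hη : η ≠ 0)
    (ξ : EuclideanSpace ℝ (Fin N)) : inner ℝ (gradient F η) ξ ≤ F ξ := by
  rw [inner_gradient_eq_fderiv]
  have h1 : HasDerivAt (fun t : ℝ => F (η + t • ξ)) (fderiv ℝ F η ξ) 0 := by
    have h2 : HasDerivAt (fun t : ℝ => η + t • ξ) ξ 0 := by
      simpa using ((hasDerivAt_id (0 : ℝ)).smul_const ξ).const_add η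
    have h3 : HasFDerivAt F (fderiv ℝ F η) (η + (0 : ℝ) • ξ) := by
      simpa using (hF.differentiableAt hη).hasFDerivAt
    exact h3.comp_hasDerivAt 0 h2
  have h2 := h1.tendsto_slope_zero_right
  refine le_of_tendsto h2 ?_
  filter_upwards [self_mem_nhdsWithin] with t ht
  have ht : 0 < t := ht
  have h3 := hF.add_le η (t • ξ)
  rw [hF.map_smul_of_nonneg ht.le] at h3
  simp only [zero_add, zero_smul, add_zero, smul_eq_mul]
  rw [inv_mul_le_iff₀ ht]
  linarith

theorem gradient_smul (hF : IsFinslerNorm p F) {t : ℝ} (ht : 0 < t)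
    (ξ : EuclideanSpace ℝ (Fin N)) : gradient F (t • ξ) = gradient F ξ := by
  have h1 : (fun x => F (t • x)) = fun x => t • F x := by
    ext x; rw [hF.map_smul_of_nonneg ht.le, smul_eq_mul]
  have h2 : fderiv ℝ (fun x => F (t • x)) ξ = t • fderiv ℝ F (t • ξ) := fderiv_comp_smul t
  have h3 : fderiv ℝ (fun x => t • F x) ξ = t • fderiv ℝ F ξ := by
    exact congrFun (fderiv_const_smul_field (𝕜 := ℝ) (f := F) t) ξ
  rw [h1, h3] at h2
  have := smul_right_injective _ ht.ne' h2
  simp [gradient, this]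

theorem contDiffOn_gradient (hF : IsFinslerNorm p F) : ContDiffOn ℝ 2 (gradient F) {0}ᶜ :=
  RobinFinsler.contDiffOn_gradient isOpen_compl_singleton hF.contDiffOn (by norm_num)

theorem hasFDerivAt_gradient (hF : IsFinslerNorm p F) {ξ : EuclideanSpace ℝ (Fin N)}
    (hξ : ξ ≠ 0) : HasFDerivAt (gradient F) (fderiv ℝ (gradient F) ξ) ξ :=
  ((hF.contDiffOn_gradient.contDiffAt (isOpen_compl_singleton.mem_nhds hξ)).differentiableAt
    (by norm_num)).hasFDerivAt

/-- By homogeneity, the Hessian of `F` annihilates the radial direction. -/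
theorem hessian_self (hF : IsFinslerNorm p F) {ξ : EuclideanSpace ℝ (Fin N)} (hξ : ξ ≠ 0) :
    fderiv ℝ (gradient F) ξ ξ = 0 := by
  have h1 : HasDerivAt (fun t : ℝ => gradient F (ξ + t • ξ)) (fderiv ℝ (gradient F) ξ ξ) 0 := by
    have h2 : HasDerivAt (fun t : ℝ => ξ + t • ξ) ξ 0 := by
      simpa using ((hasDerivAt_id (0 : ℝ)).smul_const ξ).const_add ξ
    have h3 : HasFDerivAt (gradient F) (fderiv ℝ (gradient F) ξ) (ξ + (0 : ℝ) • ξ) := by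
      simpa using hF.hasFDerivAt_gradient hξ
    exact h3.comp_hasDerivAt 0 h2
  have h4 : HasDerivAt (fun t : ℝ => gradient F (ξ + t • ξ)) 0 0 := by
    refine (hasDerivAt_const (0 : ℝ) (gradient F ξ)).congr_of_eventuallyEq ?_
    filter_upwards [lt_mem_nhds (show (-1 : ℝ) < 0 by norm_num)] with t ht
    rw [show ξ + t • ξ = (1 + t) • ξ by rw [add_smul, one_smul], hF.gradient_smul (by linarith)]
  exact h1.unique h4

end IsFinslerNorm

theorem inner_fderiv_gradient {H : Type*} [NormedAddCommGroup H] [InnerProductSpace ℝ H]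
    [CompleteSpace H] {f : H → ℝ} {x : H} (hf : ContDiffAt ℝ 2 f x) (h k : H) :
    inner ℝ (fderiv ℝ (gradient f) x h) k = fderiv ℝ (fderiv ℝ f) x h k := by
  have h1 : DifferentiableAt ℝ (fderiv ℝ f) x :=
    (hf.fderiv_right (m := 1) (by norm_num)).differentiableAt (by norm_num)
  have h2 : HasFDerivAt (gradient f)
    ((InnerProductSpace.toDual ℝ H).symm.toContinuousLinearEquiv.toContinuousLinearMap ∘L
      fderiv ℝ (fderiv ℝ f) x) x :=
    ((InnerProductSpace.toDual ℝ
      H).symm.toContinuousLinearEquiv.toContinuousLinearMap.hasFDerivAt.comp x h1.hasFDerivAt)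
  rw [h2.fderiv]
  simp

theorem inner_fderiv_gradient_comm {H : Type*} [NormedAddCommGroup H] [InnerProductSpace ℝ H]
    [CompleteSpace H] {f : H → ℝ} {x : H} (hf : ContDiffAt ℝ 2 f x) (h k : H) :
    inner ℝ (fderiv ℝ (gradient f) x h) k = inner ℝ h (fderiv ℝ (gradient f) x k) := by
  rw [real_inner_comm _ h, inner_fderiv_gradient hf, inner_fderiv_gradient hf]
  exact (hf.isSymmSndFDerivAt (by simp)).eq h k

namespace IsFinslerNorm

theorem hessian_symm (hF : IsFinslerNorm p F) {ξ : EuclideanSpace ℝ (Fin N)} (hξ : ξ ≠ 0)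
    (h k : EuclideanSpace ℝ (Fin N)) :
    inner ℝ (fderiv ℝ (gradient F) ξ h) k = inner ℝ h (fderiv ℝ (gradient F) ξ k) :=
  inner_fderiv_gradient_comm ((hF.contDiffOn.contDiffAt
    (isOpen_compl_singleton.mem_nhds hξ)).of_le (by norm_num)) h k

theorem hessian_nonneg (hF : IsFinslerNorm p F) {ξ : EuclideanSpace ℝ (Fin N)} (hξ : ξ ≠ 0)
    (h : EuclideanSpace ℝ (Fin N)) : 0 ≤ inner ℝ (fderiv ℝ (gradient F) ξ h) h := by
  have h1 : HasDerivAt (fun t : ℝ => gradient F (ξ + t • h)) (fderiv ℝ (gradient F) ξ h) 0 := by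
    have h2 : HasDerivAt (fun t : ℝ => ξ + t • h) h 0 := by
      simpa using ((hasDerivAt_id (0 : ℝ)).smul_const h).const_add ξ
    have h3 : HasFDerivAt (gradient F) (fderiv ℝ (gradient F) ξ) (ξ + (0 : ℝ) • h) := by
      simpa using hF.hasFDerivAt_gradient hξ
    exact h3.comp_hasDerivAt 0 h2
  have h2 : Tendsto (fun t : ℝ => inner ℝ (t⁻¹ • (gradient F (ξ + t • h) - gradient F ξ)) h)
      (𝓝[>] 0) (𝓝 (inner ℝ (fderiv ℝ (gradient F) ξ h) h)) := by
    have := h1.tendsto_slope_zero_right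
    simp only [zero_add, zero_smul, add_zero] at this
    exact this.inner tendsto_const_nhds
  refine ge_of_tendsto h2 ?_
  have hc : Tendsto (fun t : ℝ => ξ + t • h) (𝓝[>] 0) (𝓝 ξ) := by
    have : Continuous (fun t : ℝ => ξ + t • h) := by fun_prop
    simpa using (this.tendsto 0).mono_left nhdsWithin_le_nhds
  filter_upwards [self_mem_nhdsWithin, hc.eventually (isOpen_compl_singleton.mem_nhds hξ)]
    with t ht hne
  have ht : 0 < t := ht
  have hne : ξ + t • h ≠ 0 := hne
  have e1 := hF.inner_gradient_self hξ
  have e2 := hF.inner_gradient_self hne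
  have i1 := hF.inner_gradient_le hξ (ξ + t • h)
  have i2 := hF.inner_gradient_le hne ξ
  rw [inner_add_right] at e2 i1
  rw [inner_smul_right] at e2 i1
  rw [inner_smul_left, inner_sub_left]
  have : 0 ≤ t * (inner ℝ (gradient F (ξ + t • h)) h - inner ℝ (gradient F ξ) h) := by linarith
  have h4 := nonneg_of_mul_nonneg_right this ht
  simp only [conj_trivial]
  positivity

theorem bddAbove_polar (hF : IsFinslerNorm p F) (v : EuclideanSpace ℝ (Fin N)) :
    BddAbove (range fun ξ : {ξ : EuclideanSpace ℝ (Fin N) // ξ ≠ 0} => inner ℝ ξ.1 v / F ξ.1) := by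
  obtain ⟨a, ha, h⟩ := hF.coercive
  refine ⟨‖v‖ / a, ?_⟩
  rintro _ ⟨⟨ξ, hξ⟩, rfl⟩
  have h1 := real_inner_le_norm ξ v
  simp only
  rw [div_le_div_iff₀ (hF.pos hξ) ha]
  have := mul_le_mul_of_nonneg_right (h ξ) (norm_nonneg v)
  have := mul_le_mul_of_nonneg_right h1 ha.le
  linarith

theorem inner_le_mul_polar (hF : IsFinslerNorm p F) (ξ v : EuclideanSpace ℝ (Fin N)) :
    inner ℝ ξ v ≤ F ξ * polar F v := by
  rcases eq_or_ne ξ 0 with rfl | hξ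
  · simp [hF.map_zero]
  have := le_ciSup (hF.bddAbove_polar v) ⟨ξ, hξ⟩
  simp only at this
  rw [div_le_iff₀ (hF.pos hξ)] at this
  rw [polar]; linarith

theorem polar_le (hF : IsFinslerNorm p F) {v : EuclideanSpace ℝ (Fin N)} {c : ℝ} (hc : 0 ≤ c)
    (h : ∀ ξ, inner ℝ ξ v ≤ F ξ * c) : polar F v ≤ c := by
  refine Real.iSup_le (fun ξ => ?_) hc
  rw [div_le_iff₀ (hF.pos ξ.2)]
  linarith [h ξ.1]

theorem polar_nonneg (hF : IsFinslerNorm p F) (v : EuclideanSpace ℝ (Fin N)) : 0 ≤ polar F v := by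
  rcases eq_or_ne v 0 with rfl | hv
  · simp [polar]
  have h1 := hF.inner_le_mul_polar v v
  have h2 := real_inner_self_nonneg (x := v)
  exact nonneg_of_mul_nonneg_right (h2.trans h1) (hF.pos hv)

theorem polar_zero (F : EuclideanSpace ℝ (Fin N) → ℝ) : polar F 0 = 0 := by simp [polar]

theorem polar_neg (hF : IsFinslerNorm p F) (v : EuclideanSpace ℝ (Fin N)) :
    polar F (-v) = polar F v := by
  have key : ∀ w, polar F (-w) ≤ polar F w := fun w => by
    refine hF.polar_le (hF.polar_nonneg w) fun ξ => ?_
    have := hF.inner_le_mul_polar (-ξ) w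
    rw [hF.map_neg, inner_neg_left] at this
    rwa [inner_neg_right]
  exact le_antisymm (key v) (by simpa using key (-v))

theorem polar_smul (F : EuclideanSpace ℝ (Fin N) → ℝ) {t : ℝ} (ht : 0 ≤ t)
    (v : EuclideanSpace ℝ (Fin N)) : polar F (t • v) = t * polar F v := by
  simp only [polar, inner_smul_right, mul_div_assoc]
  rw [Real.mul_iSup_of_nonneg ht]

theorem polar_add_le (hF : IsFinslerNorm p F) (v w : EuclideanSpace ℝ (Fin N)) :
    polar F (v + w) ≤ polar F v + polar F w := by
  refine hF.polar_le (add_nonneg (hF.polar_nonneg v) (hF.polar_nonneg w)) fun ξ => ?_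
  rw [inner_add_right, mul_add]
  exact add_le_add (hF.inner_le_mul_polar ξ v) (hF.inner_le_mul_polar ξ w)

theorem exists_polar_le_norm (hF : IsFinslerNorm p F) :
    ∃ C : ℝ≥0, ∀ v, polar F v ≤ C * ‖v‖ := by
  obtain ⟨a, ha, h⟩ := hF.coercive
  refine ⟨(1 / a).toNNReal, fun v => ?_⟩
  rw [Real.coe_toNNReal _ (by positivity)]
  refine hF.polar_le (by positivity) fun ξ => ?_
  refine (real_inner_le_norm ξ v).trans ?_
  rw [one_div, ← mul_assoc, ← div_eq_mul_inv]
  refine mul_le_mul_of_nonneg_right ?_ (norm_nonneg v)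
  rw [le_div_iff₀ ha]; linarith [h ξ]

theorem exists_norm_le_polar (hF : IsFinslerNorm p F) :
    ∃ C : ℝ, 0 < C ∧ ∀ v, ‖v‖ ≤ C * polar F v := by
  obtain ⟨C, hC, h⟩ := hF.exists_le_norm
  refine ⟨C, hC, fun v => ?_⟩
  rcases eq_or_ne v 0 with rfl | hv
  · simp [polar_zero]
  have h1 := hF.inner_le_mul_polar v v
  rw [real_inner_self_eq_norm_sq] at h1
  have hn : 0 < ‖v‖ := norm_pos_iff.2 hv
  have h2 := h1.trans (mul_le_mul_of_nonneg_right (h v) (hF.polar_nonneg v))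
  have h3 : ‖v‖ * ‖v‖ ≤ ‖v‖ * (C * polar F v) := by nlinarith
  exact le_of_mul_le_mul_left h3 hn

theorem polar_pos (hF : IsFinslerNorm p F) {v : EuclideanSpace ℝ (Fin N)} (hv : v ≠ 0) :
    0 < polar F v := by
  obtain ⟨C, hC, h⟩ := hF.exists_norm_le_polar
  exact pos_of_mul_pos_right ((norm_pos_iff.2 hv).trans_le (h v)) hC.le

theorem exists_lipschitzWith_polar (hF : IsFinslerNorm p F) :
    ∃ C : ℝ≥0, LipschitzWith C (polar F) := by
  obtain ⟨C, hC⟩ := hF.exists_polar_le_norm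
  refine ⟨C, LipschitzWith.of_le_add_mul C fun x y => ?_⟩
  have h := hF.polar_add_le y (x - y)
  rw [add_sub_cancel] at h
  rw [dist_eq_norm]
  linarith [hC (x - y)]

theorem continuous_polar (hF : IsFinslerNorm p F) : Continuous (polar F) :=
  hF.exists_lipschitzWith_polar.choose_spec.continuous

theorem polar_gradient (hF : IsFinslerNorm p F) {ξ : EuclideanSpace ℝ (Fin N)} (hξ : ξ ≠ 0) :
    polar F (gradient F ξ) = 1 := by
  refine le_antisymm (hF.polar_le zero_le_one fun η => ?_) ?_
  · rw [real_inner_comm, mul_one]; exact hF.inner_gradient_le hξ η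
  · have h1 := hF.inner_le_mul_polar ξ (gradient F ξ)
    rw [real_inner_comm, hF.inner_gradient_self hξ] at h1
    have := hF.pos hξ
    nlinarith

/-- A vector of polar norm at most one which attains `F ξ` in the pairing with `ξ` is the gradient
of `F` at `ξ`: it supports the convex function `F` at `ξ`, and `F` is differentiable there. -/
theorem eq_gradient_of_inner_eq (hF : IsFinslerNorm p F) {ξ w : EuclideanSpace ℝ (Fin N)}
    (hξ : ξ ≠ 0) (hw : polar F w ≤ 1) (h : F ξ ≤ inner ℝ ξ w) : w = gradient F ξ := by
  have hle : ∀ η, inner ℝ η w ≤ F η := fun η =>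
    (hF.inner_le_mul_polar η w).trans (by nlinarith [hF.nonneg η])
  have hmin : IsLocalMin (fun η => F η - inner ℝ η w) ξ := by
    refine Eventually.of_forall fun η => ?_
    have := hle η
    simp only
    linarith
  have hd : HasFDerivAt (fun η => F η - inner ℝ η w) (fderiv ℝ F ξ - innerSL ℝ w) ξ := by
    refine (hF.differentiableAt hξ).hasFDerivAt.sub ?_
    have : (fun η : EuclideanSpace ℝ (Fin N) => inner ℝ η w) = fun η => innerSL ℝ w η := by
      ext η; rw [innerSL_apply_apply, real_inner_comm]
    rw [this]
    exact (innerSL ℝ w).hasFDerivAt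
  have h0 := hmin.hasFDerivAt_eq_zero hd
  refine (ext_inner_right ℝ fun v => ?_)
  have := congrArg (fun L => L v) h0
  simp only [sub_apply, innerSL_apply_apply, zero_apply] at this
  rw [inner_gradient_eq_fderiv]; linarith

/-- The dual characterisation of `F`, as an upper bound. -/
theorem le_of_forall_inner_le_polar (hF : IsFinslerNorm p F) {ξ : EuclideanSpace ℝ (Fin N)} {c : ℝ}
    (hc : 0 ≤ c) (h : ∀ v, inner ℝ ξ v ≤ c * polar F v) : F ξ ≤ c := by
  rcases eq_or_ne ξ 0 with rfl | hξ
  · rwa [hF.map_zero]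
  have := h (gradient F ξ)
  rwa [real_inner_comm, hF.inner_gradient_self hξ, hF.polar_gradient hξ, mul_one] at this

end IsFinslerNorm

end Finsler

/-! ### The generalized hyperbolic cosine -/

section Cosh

variable {p : ℝ}

theorem rpow_sub_one_pos (hp : 1 < p) {t : ℝ} (ht : 1 < t) : 0 < t ^ p - 1 := by
  linarith [Real.one_lt_rpow ht (by linarith : 0 < p)]

theorem rpow_sub_one_nonneg (hp : 1 < p) {t : ℝ} (ht : 1 ≤ t) : 0 ≤ t ^ p - 1 := by
  linarith [Real.one_le_rpow ht (by linarith : 0 ≤ p)]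

theorem arccoshP_integrand_pos (hp : 1 < p) {t : ℝ} (ht : 1 < t) :
    0 < 1 / (t ^ p - 1) ^ (1 / p) :=
  one_div_pos.2 (Real.rpow_pos_of_pos (rpow_sub_one_pos hp ht) _)

theorem arccoshP_integrand_nonneg (hp : 1 < p) {t : ℝ} (ht : 1 ≤ t) :
    0 ≤ 1 / (t ^ p - 1) ^ (1 / p) :=
  one_div_nonneg.2 (Real.rpow_nonneg (rpow_sub_one_nonneg hp ht) _)

theorem measurable_arccoshP_integrand (p : ℝ) :
    Measurable fun t : ℝ => 1 / (t ^ p - 1) ^ (1 / p) := by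
  fun_prop

theorem continuousAt_arccoshP_integrand (hp : 1 < p) {t : ℝ} (ht : 1 < t) :
    ContinuousAt (fun t : ℝ => 1 / (t ^ p - 1) ^ (1 / p)) t := by
  have h := rpow_sub_one_pos hp ht
  refine continuousAt_const.div ?_ (Real.rpow_pos_of_pos h _).ne'
  refine ContinuousAt.rpow_const ?_ (Or.inl h.ne')
  exact (continuousAt_id.rpow_const (Or.inl (by simp; linarith))).sub continuousAt_const

theorem arccoshP_integrand_le (hp : 1 < p) {t : ℝ} (ht : 1 ≤ t) :
    1 / (t ^ p - 1) ^ (1 / p) ≤ (t - 1) ^ (-(1 / p)) := by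
  rcases ht.eq_or_lt with rfl | ht
  · have : (1 / p) ≠ 0 := by positivity
    simp [Real.zero_rpow (show p⁻¹ ≠ 0 by positivity),
      Real.zero_rpow (show -p⁻¹ ≠ 0 by rw [neg_ne_zero]; positivity)]
  rw [Real.rpow_neg (by linarith), one_div]
  refine inv_anti₀ (Real.rpow_pos_of_pos (by linarith) _)
    (Real.rpow_le_rpow (by linarith) ?_ (by positivity))
  linarith [Real.self_le_rpow_of_one_le ht.le hp.le]

theorem intervalIntegrable_arccoshP_integrand (hp : 1 < p) {x y : ℝ} (hx : 1 ≤ x) (hy : 1 ≤ y) :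
    IntervalIntegrable (fun t : ℝ => 1 / (t ^ p - 1) ^ (1 / p)) volume x y := by
  have hr : -1 < -(1 / p) := by
    rw [neg_lt_neg_iff, div_lt_one (by linarith)]; exact hp
  have h1 : ∀ z,
      IntervalIntegrable (fun t : ℝ => 1 / (t ^ p - 1) ^ (1 / p)) volume 1 (max 1 z) := by
    intro z
    have h := (intervalIntegral.intervalIntegrable_rpow' (a := 0)
      (b := max 1 z - 1) hr).comp_sub_right 1
    simp only [zero_add, sub_add_cancel] at h
    refine h.mono_fun' (measurable_arccoshP_integrand p).aestronglyMeasurable ?_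
    refine (ae_restrict_iff' measurableSet_uIoc).2 (Eventually.of_forall fun t ht => ?_)
    rw [uIoc_of_le (le_max_left _ _)] at ht
    beta_reduce
    rw [Real.norm_of_nonneg (arccoshP_integrand_nonneg hp ht.1.le)]
    exact arccoshP_integrand_le hp ht.1.le
  have hx' := h1 x
  have hy' := h1 y
  rw [max_eq_right hx] at hx'
  rw [max_eq_right hy] at hy'
  exact hx'.symm.trans hy'

theorem arccoshP_one (p : ℝ) : arccoshP p 1 = 0 := by simp [arccoshP]

theorem arccoshP_sub (hp : 1 < p) {x y : ℝ} (hx : 1 ≤ x) (hy : 1 ≤ y) :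
    arccoshP p y - arccoshP p x = ∫ t in x..y, 1 / (t ^ p - 1) ^ (1 / p) :=
  intervalIntegral.integral_interval_sub_left
    (intervalIntegrable_arccoshP_integrand hp le_rfl hy)
    (intervalIntegrable_arccoshP_integrand hp le_rfl hx)

/-- The integrand of `arccosh_p` is decreasing, so its increments are bounded below by the value at
the right end point. -/
theorem mul_le_arccoshP_sub (hp : 1 < p) {x y : ℝ} (hx : 1 ≤ x) (hxy : x ≤ y) :
    (y - x) * (1 / (y ^ p - 1) ^ (1 / p)) ≤ arccoshP p y - arccoshP p x := by
  rw [arccoshP_sub hp hx (hx.trans hxy)]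
  have h := intervalIntegral.integral_mono_on_of_le_Ioo hxy
    (f := fun _ => 1 / (y ^ p - 1) ^ (1 / p)) (g := fun t => 1 / (t ^ p - 1) ^ (1 / p))
    (by simp) (intervalIntegrable_arccoshP_integrand hp hx (hx.trans hxy)) (fun t ht => ?_)
  · simpa using h
  · have h1 : 1 < t := hx.trans_lt ht.1
    refine one_div_le_one_div_of_le (Real.rpow_pos_of_pos (rpow_sub_one_pos hp h1) _) ?_
    refine Real.rpow_le_rpow (rpow_sub_one_pos hp h1).le ?_ (by positivity)
    linarith [Real.rpow_le_rpow (by linarith) ht.2.le (by linarith : 0 ≤ p)]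

theorem strictMonoOn_arccoshP (hp : 1 < p) : StrictMonoOn (arccoshP p) (Ici 1) := by
  intro x hx y hy hxy
  have h := mul_le_arccoshP_sub hp hx hxy.le
  have h1 : 0 < (y - x) * (1 / (y ^ p - 1) ^ (1 / p)) :=
    mul_pos (by linarith) (arccoshP_integrand_pos hp (lt_of_le_of_lt hx hxy))
  linarith

theorem hasDerivAt_arccoshP (hp : 1 < p) {x : ℝ} (hx : 1 < x) :
    HasDerivAt (arccoshP p) (1 / (x ^ p - 1) ^ (1 / p)) x :=
  intervalIntegral.integral_hasDerivAt_right
    (intervalIntegrable_arccoshP_integrand hp le_rfl hx.le)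
    (measurable_arccoshP_integrand p).stronglyMeasurable.stronglyMeasurableAtFilter
    (continuousAt_arccoshP_integrand hp hx)

theorem log_le_arccoshP (hp : 1 < p) {x : ℝ} (hx : 1 ≤ x) : Real.log x ≤ arccoshP p x := by
  have h := intervalIntegral.integral_mono_on_of_le_Ioo hx
    (f := fun t => t⁻¹) (g := fun t => 1 / (t ^ p - 1) ^ (1 / p))
    (intervalIntegral.intervalIntegrable_inv (fun t ht => by
      rw [uIcc_of_le hx] at ht; linarith [ht.1]) continuousOn_id)
    (intervalIntegrable_arccoshP_integrand hp le_rfl hx) (fun t ht => ?_)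
  · rw [integral_inv_of_pos one_pos (by linarith), div_one] at h
    exact h
  · have h1 := rpow_sub_one_pos hp ht.1
    have h0 : 0 < t := by linarith [ht.1]
    rw [← one_div]
    refine one_div_le_one_div_of_le (Real.rpow_pos_of_pos h1 _) ?_
    calc (t ^ p - 1) ^ (1 / p) ≤ (t ^ p) ^ (1 / p) :=
          Real.rpow_le_rpow h1.le (by linarith) (by positivity)
      _ = t := by rw [← Real.rpow_mul h0.le, mul_one_div_cancel (by linarith), Real.rpow_one]

theorem continuousOn_arccoshP (hp : 1 < p) : ContinuousOn (arccoshP p) (Ici 1) := by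
  intro x hx
  have h1 : ContinuousOn (arccoshP p) (Icc 1 (x + 1)) := by
    have hx : 1 ≤ x + 1 := by linarith [show (1 : ℝ) ≤ x from hx]
    have := intervalIntegral.continuousOn_primitive_interval
      (μ := volume) (f := fun t : ℝ => 1 / (t ^ p - 1) ^ (1 / p)) (a := 1) (b := x + 1) (by
        rw [uIcc_of_le hx, integrableOn_Icc_iff_integrableOn_Ioc]
        exact (intervalIntegrable_iff_integrableOn_Ioc_of_le hx).1
          (intervalIntegrable_arccoshP_integrand hp le_rfl hx))
    rwa [uIcc_of_le hx] at this
  refine (h1 x ⟨hx, by linarith⟩).mono_of_mem_nhdsWithin ?_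
  rw [← Ici_inter_Iic]
  exact inter_mem_nhdsWithin _ (Iic_mem_nhds (by linarith))

theorem exists_arccoshP_eq (hp : 1 < p) {t : ℝ} (ht : 0 ≤ t) :
    ∃ x ∈ Ici (1 : ℝ), arccoshP p x = t := by
  have h1 : (1 : ℝ) ≤ Real.exp t := Real.one_le_exp ht
  have h2 := log_le_arccoshP hp h1
  rw [Real.log_exp] at h2
  obtain ⟨x, hx, h⟩ := intermediate_value_Icc h1
    ((continuousOn_arccoshP hp).mono Icc_subset_Ici_self)
    (show t ∈ Icc (arccoshP p 1) (arccoshP p (Real.exp t)) by rw [arccoshP_one]; exact ⟨ht, h2⟩)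
  exact ⟨x, hx.1, h⟩

theorem one_le_coshP (hp : 1 < p) (t : ℝ) : 1 ≤ coshP p t :=
  Function.invFunOn_mem (exists_arccoshP_eq hp (abs_nonneg t))

theorem coshP_pos (hp : 1 < p) (t : ℝ) : 0 < coshP p t := zero_lt_one.trans_le (one_le_coshP hp t)

theorem arccoshP_coshP (hp : 1 < p) (t : ℝ) : arccoshP p (coshP p t) = |t| :=
  Function.invFunOn_eq (exists_arccoshP_eq hp (abs_nonneg t))

theorem coshP_neg (p t : ℝ) : coshP p (-t) = coshP p t := by simp [coshP]

theorem coshP_abs (p t : ℝ) : coshP p |t| = coshP p t := by simp [coshP]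

theorem coshP_zero (hp : 1 < p) : coshP p 0 = 1 := by
  refine (strictMonoOn_arccoshP hp).injOn (one_le_coshP hp 0) self_mem_Ici ?_
  rw [arccoshP_coshP hp, arccoshP_one, abs_zero]

theorem strictMonoOn_coshP (hp : 1 < p) : StrictMonoOn (coshP p) (Ici 0) := by
  intro s hs t ht hst
  rw [← (strictMonoOn_arccoshP hp).lt_iff_lt (one_le_coshP hp s) (one_le_coshP hp t),
    arccoshP_coshP hp, arccoshP_coshP hp, abs_of_nonneg hs, abs_of_nonneg ht]
  exact hst

theorem monotoneOn_coshP (hp : 1 < p) : MonotoneOn (coshP p) (Ici 0) :=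
  (strictMonoOn_coshP hp).monotoneOn

theorem one_lt_coshP (hp : 1 < p) {t : ℝ} (ht : 0 < t) : 1 < coshP p t := by
  rw [← coshP_zero hp]
  exact strictMonoOn_coshP hp self_mem_Ici ht.le ht

/-- The generalized hyperbolic sine `(cosh_p ^ p - 1) ^ (1 / p)`, the derivative of `cosh_p` on
`[0, ∞)`. -/
def sinhP (p t : ℝ) : ℝ := (coshP p t ^ p - 1) ^ (1 / p)

theorem sinhP_nonneg (hp : 1 < p) (t : ℝ) : 0 ≤ sinhP p t :=
  Real.rpow_nonneg (rpow_sub_one_nonneg hp (one_le_coshP hp t)) _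

theorem sinhP_pos (hp : 1 < p) {t : ℝ} (ht : 0 < t) : 0 < sinhP p t :=
  Real.rpow_pos_of_pos (rpow_sub_one_pos hp (one_lt_coshP hp ht)) _

theorem sinhP_zero (hp : 1 < p) : sinhP p 0 = 0 := by
  rw [sinhP, coshP_zero hp, Real.one_rpow, sub_self, Real.zero_rpow (by positivity)]

theorem sinhP_rpow (hp : 1 < p) (t : ℝ) : sinhP p t ^ p = coshP p t ^ p - 1 := by
  rw [sinhP, ← Real.rpow_mul (rpow_sub_one_nonneg hp (one_le_coshP hp t)),
    one_div_mul_cancel (by linarith), Real.rpow_one]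

theorem monotoneOn_sinhP (hp : 1 < p) : MonotoneOn (sinhP p) (Ici 0) := fun s hs t ht hst =>
  Real.rpow_le_rpow (rpow_sub_one_nonneg hp (one_le_coshP hp s))
    (sub_le_sub_right (Real.rpow_le_rpow (coshP_pos hp s).le (monotoneOn_coshP hp hs ht hst)
      (by linarith)) 1) (by positivity)

theorem coshP_sub_le (hp : 1 < p) {s t : ℝ} (hs : 0 ≤ s) (hst : s ≤ t) :
    coshP p t - coshP p s ≤ sinhP p t * (t - s) := by
  rcases (hs.trans hst).eq_or_lt with h0 | h0
  · have : s = 0 := le_antisymm (h0 ▸ hst) hs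
    simp [← h0, this]
  have h := mul_le_arccoshP_sub hp (one_le_coshP hp s)
    (monotoneOn_coshP hp hs (hs.trans hst) hst)
  rw [arccoshP_coshP hp, arccoshP_coshP hp, abs_of_nonneg hs, abs_of_nonneg h0.le, mul_one_div] at h
  have h1 := (div_le_iff₀ (sinhP_pos hp h0)).1 h
  linarith

theorem abs_coshP_sub_le (hp : 1 < p) {M s t : ℝ} (hs : 0 ≤ s) (ht : 0 ≤ t) (hsM : s ≤ M)
    (htM : t ≤ M) : |coshP p t - coshP p s| ≤ sinhP p M * |t - s| := by
  wlog hst : s ≤ t generalizing s t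
  · rw [abs_sub_comm, abs_sub_comm t]
    exact this ht hs htM hsM (le_of_not_ge hst)
  rw [abs_of_nonneg (sub_nonneg.2 (monotoneOn_coshP hp hs ht hst)),
    abs_of_nonneg (sub_nonneg.2 hst)]
  refine (coshP_sub_le hp hs hst).trans ?_
  exact mul_le_mul_of_nonneg_right (monotoneOn_sinhP hp ht (ht.trans htM) htM) (sub_nonneg.2 hst)

theorem continuous_coshP (hp : 1 < p) : Continuous (coshP p) := by
  rw [continuous_iff_continuousAt]
  intro t
  have h : ∀ s ∈ Metric.ball t 1, dist (coshP p s) (coshP p t) ≤ sinhP p (|t| + 1) * dist s t := by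
    intro s hs
    rw [Metric.mem_ball, Real.dist_eq] at hs
    have hs' : |s| ≤ |t| + 1 := by
      have := abs_sub_abs_le_abs_sub s t
      linarith
    rw [Real.dist_eq, Real.dist_eq, ← coshP_abs p s, ← coshP_abs p t]
    refine (abs_coshP_sub_le hp (abs_nonneg t) (abs_nonneg s) (by linarith) hs').trans ?_
    exact mul_le_mul_of_nonneg_left (abs_abs_sub_abs_le_abs_sub s t) (sinhP_nonneg hp _)
  refine continuousAt_of_locally_lipschitz one_pos _ fun s hs => h s hs

theorem continuous_sinhP (hp : 1 < p) : Continuous (sinhP p) := by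
  have := continuous_coshP hp
  unfold sinhP
  refine Continuous.rpow_const (Continuous.sub ?_ continuous_const)
    (fun _ => Or.inr (by positivity))
  exact this.rpow_const (fun t => Or.inr (by linarith))

theorem hasDerivAt_coshP (hp : 1 < p) {t : ℝ} (ht : 0 < t) :
    HasDerivAt (coshP p) (sinhP p t) t := by
  have h1 := hasDerivAt_arccoshP hp (one_lt_coshP hp ht)
  have h2 := HasDerivAt.of_local_left_inverse (continuous_coshP hp).continuousAt h1
    (arccoshP_integrand_pos hp (one_lt_coshP hp ht)).ne' (by
      filter_upwards [lt_mem_nhds ht] with s hs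
      rw [arccoshP_coshP hp, abs_of_pos hs])
  simpa [sinhP] using h2

/-- The flux `sinh_p ^ (p - 1) * cosh_p` of the one-dimensional ground state. Its derivative
`p * cosh_p ^ p - 1` is the energy density `sinh_p ^ p + (p - 1) * cosh_p ^ p`. -/
def fluxP (p t : ℝ) : ℝ := sinhP p t ^ (p - 1) * coshP p t

theorem fluxP_zero (hp : 1 < p) : fluxP p 0 = 0 := by
  rw [fluxP, sinhP_zero hp, Real.zero_rpow (by linarith), zero_mul]

theorem continuous_fluxP (hp : 1 < p) : Continuous (fluxP p) :=
  ((continuous_sinhP hp).rpow_const (fun _ => Or.inr (by linarith))).mul (continuous_coshP hp)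

theorem hasDerivAt_sinhP_rpow (hp : 1 < p) {t : ℝ} (ht : 0 < t) :
    HasDerivAt (fun t => sinhP p t ^ (p - 1)) ((p - 1) * coshP p t ^ (p - 1)) t := by
  have hc := one_lt_coshP hp ht
  have hq := rpow_sub_one_pos hp hc
  have e : ∀ t, sinhP p t ^ (p - 1) = (coshP p t ^ p - 1) ^ (1 / p * (p - 1)) := fun t => by
    rw [sinhP, ← Real.rpow_mul (rpow_sub_one_nonneg hp (one_le_coshP hp t))]
  simp_rw [e]
  have h1 := (((hasDerivAt_coshP hp ht).rpow_const (p := p) (Or.inr hp.le)).sub_const 1).rpow_const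
    (p := 1 / p * (p - 1)) (Or.inl hq.ne')
  refine h1.congr_deriv ?_
  have h3 : sinhP p t * (coshP p t ^ p - 1) ^ (1 / p * (p - 1) - 1) = 1 := by
    rw [sinhP, ← Real.rpow_add hq]
    convert Real.rpow_zero _
    field_simp; ring
  have hp0 : p ≠ 0 := by linarith
  symm
  calc (p - 1) * coshP p t ^ (p - 1)
      = (p - 1) * coshP p t ^ (p - 1) *
        (sinhP p t * (coshP p t ^ p - 1) ^ (1 / p * (p - 1) - 1)) := by rw [h3, mul_one]
    _ = _ := by field_simp

theorem hasDerivAt_fluxP (hp : 1 < p) {t : ℝ} (ht : 0 < t) :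
    HasDerivAt (fluxP p) (p * coshP p t ^ p - 1) t := by
  have h := (hasDerivAt_sinhP_rpow hp ht).mul (hasDerivAt_coshP hp ht)
  refine h.congr_deriv ?_
  have h1 : coshP p t ^ (p - 1) * coshP p t = coshP p t ^ p := by
    rw [← Real.rpow_add_one (coshP_pos hp t).ne', sub_add_cancel]
  have h2 : sinhP p t ^ (p - 1) * sinhP p t = coshP p t ^ p - 1 := by
    rw [← Real.rpow_add_one (sinhP_pos hp ht).ne', sub_add_cancel, sinhP_rpow hp]
  rw [mul_assoc, h1, h2]; ring

theorem integral_fluxP (hp : 1 < p) {T : ℝ} (hT : 0 ≤ T) :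
    ∫ t in (0 : ℝ)..T, (p * coshP p t ^ p - 1) = fluxP p T := by
  have hc : Continuous fun t => p * coshP p t ^ p - 1 :=
    (continuous_const.mul ((continuous_coshP hp).rpow_const
      (fun _ => Or.inr (by linarith)))).sub continuous_const
  rw [intervalIntegral.integral_eq_sub_of_hasDerivAt_of_le hT (continuous_fluxP hp).continuousOn
    (fun t ht => hasDerivAt_fluxP hp ht.1) (hc.intervalIntegrable _ _), fluxP_zero hp, sub_zero]

/-- The generalized hyperbolic tangent to the power `p - 1`, the solution of the Riccati equation
attached to the one-dimensional problem. -/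
def riccatiP (p t : ℝ) : ℝ := (sinhP p t / coshP p t) ^ (p - 1)

theorem riccatiP_zero (hp : 1 < p) : riccatiP p 0 = 0 := by
  rw [riccatiP, sinhP_zero hp, zero_div, Real.zero_rpow (by linarith)]

theorem riccatiP_nonneg (hp : 1 < p) (t : ℝ) : 0 ≤ riccatiP p t :=
  Real.rpow_nonneg (div_nonneg (sinhP_nonneg hp t) (coshP_pos hp t).le) _

theorem continuous_riccatiP (hp : 1 < p) : Continuous (riccatiP p) :=
  ((continuous_sinhP hp).div (continuous_coshP hp) (fun t => (coshP_pos hp t).ne')).rpow_const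
    (fun _ => Or.inr (by linarith))

theorem sinhP_div_coshP_rpow (hp : 1 < p) (t : ℝ) :
    (sinhP p t / coshP p t) ^ p = 1 - coshP p t ^ (-p) := by
  have hc := coshP_pos hp t
  rw [Real.div_rpow (sinhP_nonneg hp t) hc.le, sinhP_rpow hp, Real.rpow_neg hc.le, sub_div,
    div_self (Real.rpow_pos_of_pos hc _).ne', one_div]

theorem riccatiP_rpow (hp : 1 < p) (t : ℝ) :
    riccatiP p t ^ (p / (p - 1)) = 1 - coshP p t ^ (-p) := by
  rw [riccatiP, ← Real.rpow_mul (div_nonneg (sinhP_nonneg hp t) (coshP_pos hp t).le),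
    mul_div_cancel₀ _ (by linarith), sinhP_div_coshP_rpow hp]

theorem hasDerivAt_riccatiP (hp : 1 < p) {t : ℝ} (ht : 0 < t) :
    HasDerivAt (riccatiP p) ((p - 1) * (1 - riccatiP p t ^ (p / (p - 1)))) t := by
  have hc := coshP_pos hp t
  have e : riccatiP p = fun t => sinhP p t ^ (p - 1) * coshP p t ^ (-(p - 1)) := by
    ext t
    rw [riccatiP, Real.div_rpow (sinhP_nonneg hp t) (coshP_pos hp t).le,
      Real.rpow_neg (coshP_pos hp t).le, div_eq_mul_inv]
  rw [riccatiP_rpow hp, e]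
  have h := (hasDerivAt_sinhP_rpow hp ht).mul
    ((hasDerivAt_coshP hp ht).rpow_const (p := -(p - 1)) (Or.inl hc.ne'))
  refine h.congr_deriv ?_
  have h1 : coshP p t ^ (p - 1) * coshP p t ^ (-(p - 1)) = 1 := by
    rw [← Real.rpow_add hc, add_neg_cancel, Real.rpow_zero]
  have h2 : sinhP p t ^ (p - 1) * sinhP p t = coshP p t ^ p - 1 := by
    rw [← Real.rpow_add_one (sinhP_pos hp ht).ne', sub_add_cancel, sinhP_rpow hp]
  have h3 : coshP p t ^ p * coshP p t ^ (-(p - 1) - 1) = 1 := by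
    rw [← Real.rpow_add hc]; convert Real.rpow_zero _; ring
  have h4 : -(p - 1) - 1 = -p := by ring
  rw [h4] at h3 ⊢
  linear_combination (p - 1) * h1 - (p - 1) * coshP p t ^ (-p) * h2 - (p - 1) * h3

theorem one_sub_coshP_pos (hp : 1 < p) {t : ℝ} (ht : 0 < t) : 0 < 1 - coshP p t ^ (-p) := by
  linarith [Real.rpow_lt_one_of_one_lt_of_neg (one_lt_coshP hp ht) (by linarith : -p < 0)]

/-- The left hand side of the equation `κ ^ p (1 - cosh_p ^ (-p) (κ R)) = |β| ^ (p / (p - 1))` for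
the root, written in terms of `κ`. -/
theorem strictMonoOn_rootFunction (hp : 1 < p) {R : ℝ} (hR : 0 < R) :
    StrictMonoOn (fun κ : ℝ => κ ^ p * (1 - coshP p (κ * R) ^ (-p))) (Ioi 0) := by
  intro a ha b hb hab
  have ha : 0 < a := ha
  have hb : 0 < b := hb
  have h1 : a ^ p < b ^ p := Real.rpow_lt_rpow ha.le hab (by linarith)
  have h2 : coshP p (a * R) ≤ coshP p (b * R) :=
    monotoneOn_coshP hp (mul_pos ha hR).le (mul_pos hb hR).le (by nlinarith)
  have h3 : coshP p (b * R) ^ (-p) ≤ coshP p (a * R) ^ (-p) :=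
    Real.rpow_le_rpow_of_nonpos (coshP_pos hp _) h2 (by linarith)
  exact mul_lt_mul h1 (by linarith) (one_sub_coshP_pos hp (mul_pos ha hR))
    (Real.rpow_nonneg hb.le _)

/-- Existence and uniqueness of the root `μ`, through `κ = (-μ / (p - 1)) ^ (1 / p)`. The first
identity, the Robin condition for `cosh_p (κ s)` at `s = R`, is the equation to the power
`(p - 1) / p`. -/
theorem exists_isNegativeRoot (hp : 1 < p) {β R : ℝ} (hβ : β < 0) (hR : 0 < R) :
    ∃ κ : ℝ, 0 < κ ∧ κ ^ (p - 1) * riccatiP p (κ * R) = |β| ∧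
      IsNegativeRoot p β R (-((p - 1) * κ ^ p)) ∧
      ∀ μ', IsNegativeRoot p β R μ' → μ' = -((p - 1) * κ ^ p) := by
  have hp1 : 0 < p - 1 := by linarith
  have hp0 : 0 < p := by linarith
  have hβ' : 0 < |β| := abs_pos.2 hβ.ne
  set b := |β| ^ (p / (p - 1)) with hb
  have hb0 : 0 < b := Real.rpow_pos_of_pos hβ' _
  have key : ∀ κ : ℝ, 0 < κ → ∀ μ', κ = (-μ' / (p - 1)) ^ (1 / p) → μ' < 0 →
      (IsNegativeRoot p β R μ' ↔ κ ^ p * (1 - coshP p (κ * R) ^ (-p)) = b) := by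
    intro κ hκ μ' h hμ'
    have h0 : 0 < -μ' / (p - 1) := div_pos (by linarith) hp1
    have h1 : κ ^ p = -μ' / (p - 1) := by
      rw [h, ← Real.rpow_mul h0.le, one_div_mul_cancel hp0.ne', Real.rpow_one]
    rw [IsNegativeRoot, ← h, ← h1, eq_div_iff (one_sub_coshP_pos hp (mul_pos hκ hR)).ne']
    simp [hμ', hb]
  have hcont : Continuous fun κ : ℝ => κ ^ p * (1 - coshP p (κ * R) ^ (-p)) := by
    have := continuous_coshP hp
    refine (continuous_id.rpow_const (fun _ => Or.inr hp0.le)).mul (continuous_const.sub ?_)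
    exact (this.comp (continuous_id.mul continuous_const)).rpow_const
      (fun t => Or.inl (coshP_pos hp _).ne')
  -- For `K ≥ 1` the second factor is at least its value `m` at `1`, so `K ^ p ≥ b / m` suffices.
  obtain ⟨K, hK, hKb⟩ : ∃ K : ℝ, 0 < K ∧ b ≤ K ^ p * (1 - coshP p (K * R) ^ (-p)) := by
    set m := 1 - coshP p (1 * R) ^ (-p) with hm
    have hm0 : 0 < m := one_sub_coshP_pos hp (by linarith)
    refine ⟨max 1 ((b / m) ^ (1 / p)), by positivity, ?_⟩
    have h1 : b / m ≤ (max 1 ((b / m) ^ (1 / p))) ^ p := by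
      calc b / m = ((b / m) ^ (1 / p)) ^ p := by
            rw [← Real.rpow_mul (by positivity), one_div_mul_cancel hp0.ne', Real.rpow_one]
        _ ≤ _ := Real.rpow_le_rpow (by positivity) (le_max_right _ _) hp0.le
    have h2 : m ≤ 1 - coshP p (max 1 ((b / m) ^ (1 / p)) * R) ^ (-p) := by
      refine sub_le_sub_left (Real.rpow_le_rpow_of_nonpos (coshP_pos hp _) ?_ (by linarith)) 1
      exact monotoneOn_coshP hp (by simp; linarith) (by simp only [mem_Ici]; positivity)
        (mul_le_mul_of_nonneg_right (le_max_left _ _) hR.le)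
    calc b = b / m * m := by field_simp
      _ ≤ _ := mul_le_mul h1 h2 hm0.le (by positivity)
  obtain ⟨κ, hκ, hκb⟩ := intermediate_value_Icc hK.le hcont.continuousOn
    (show b ∈ Icc ((0 : ℝ) ^ p * (1 - coshP p (0 * R) ^ (-p))) _ by
      rw [Real.zero_rpow hp0.ne', zero_mul]; exact ⟨hb0.le, hKb⟩)
  simp only at hκb
  have hκ0 : 0 < κ := by
    rcases hκ.1.eq_or_lt with h | h
    · rw [← h, Real.zero_rpow hp0.ne', zero_mul] at hκb; exact absurd hκb hb0.ne
    · exact h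
  refine ⟨κ, hκ0, ?_, ?_, ?_⟩
  · have h1 : (κ ^ (p - 1) * riccatiP p (κ * R)) ^ (p / (p - 1)) = b := by
      rw [Real.mul_rpow (by positivity) (riccatiP_nonneg hp _), riccatiP_rpow hp,
        ← Real.rpow_mul hκ0.le, mul_div_cancel₀ _ hp1.ne', hκb]
    refine (Real.rpow_left_inj (mul_nonneg (by positivity) (riccatiP_nonneg hp _)) hβ'.le
      (div_pos hp0 hp1).ne').1 (h1.trans hb)
  · refine (key κ hκ0 _ ?_ ?_).2 hκb
    · rw [neg_neg, mul_div_cancel_left₀ _ hp1.ne', ← Real.rpow_mul hκ0.le,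
        mul_one_div_cancel hp0.ne', Real.rpow_one]
    · have := Real.rpow_pos_of_pos hκ0 p
      nlinarith
  · intro μ' hμ'
    have h0 : 0 < -μ' / (p - 1) := div_pos (by linarith [hμ'.1]) hp1
    have hκ' := (key _ (Real.rpow_pos_of_pos h0 (1 / p)) μ' rfl hμ'.1).1 hμ'
    have := (strictMonoOn_rootFunction hp hR).injOn (Real.rpow_pos_of_pos h0 (1 / p)) hκ0
      (hκ'.trans hκb.symm)
    rw [← this, ← Real.rpow_mul h0.le, one_div_mul_cancel hp0.ne', Real.rpow_one]
    field_simp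

end Cosh

/-! ### A determinant bound -/

section Determinant

variable {V : Type*} [NormedAddCommGroup V] [InnerProductSpace ℝ V] [FiniteDimensional ℝ V]

/-- Sylvester's determinant identity for endomorphisms. -/
theorem det_one_sub_mul_comm (S T : V →ₗ[ℝ] V) :
    LinearMap.det (1 - S * T) = LinearMap.det (1 - T * S) := by
  classical
  let b := Module.finBasis ℝ V
  rw [← LinearMap.det_toMatrix b, ← LinearMap.det_toMatrix b, map_sub, map_sub,
    LinearMap.toMatrix_mul, LinearMap.toMatrix_mul, LinearMap.toMatrix_one,
    Matrix.det_one_sub_mul_comm]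

/-- A positive semidefinite symmetric operator has a symmetric square root. -/
theorem exists_symmetric_sqrt {A : V →ₗ[ℝ] V} (hA : A.IsSymmetric)
    (hA0 : ∀ v, 0 ≤ inner ℝ (A v) v) : ∃ C : V →ₗ[ℝ] V, C.IsSymmetric ∧ C * C = A := by
  set b := hA.eigenvectorBasis rfl with hb
  set l := hA.eigenvalues rfl with hl
  have hAb : ∀ i, A (b i) = l i • b i := fun i => hA.apply_eigenvectorBasis rfl i
  have hl0 : ∀ i, 0 ≤ l i := fun i => by
    have := hA0 (b i)
    rw [hAb, inner_smul_left, real_inner_self_eq_norm_sq, b.norm_eq_one] at this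
    simpa using this
  let C : V →ₗ[ℝ] V := b.toBasis.constr ℝ fun i => √(l i) • b i
  have hCb : ∀ i, C (b i) = √(l i) • b i := fun i => by
    have := b.toBasis.constr_basis ℝ (fun i => √(l i) • b i) i
    rwa [b.coe_toBasis] at this
  refine ⟨C, ?_, ?_⟩
  · have hC : ∀ i w, inner ℝ (C (b i)) w = inner ℝ (b i) (C w) := by
      intro i w
      have hw := b.sum_repr w
      rw [← hw, map_sum, inner_sum, inner_sum]
      refine Finset.sum_congr rfl fun j _ => ?_
      rw [map_smul, hCb, hCb, inner_smul_right, inner_smul_left, inner_smul_right,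
        inner_smul_right, orthonormal_iff_ite.1 b.orthonormal]
      split_ifs with h
      · subst h; simp
      · simp
    intro v w
    rw [← b.sum_repr v, map_sum, sum_inner, sum_inner]
    refine Finset.sum_congr rfl fun j _ => ?_
    rw [map_smul, inner_smul_left, inner_smul_left, hC]
  · refine b.toBasis.ext fun i => ?_
    rw [b.coe_toBasis, Module.End.mul_apply, hCb, map_smul, hCb, smul_smul,
      Real.mul_self_sqrt (hl0 i), hAb]

/-- The inequality between the arithmetic and the geometric mean for the operator `1 - A K`, whose
spectrum is that of the symmetric operator `1 - C K C` with `C * C = A`. -/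
theorem abs_det_one_sub_mul_le_one {A K : V →ₗ[ℝ] V} (hA : A.IsSymmetric)
    (hA0 : ∀ v, 0 ≤ inner ℝ (A v) v) (hK : K.IsSymmetric)
    (hle : ∀ v, inner ℝ (K (A v)) (A v) ≤ inner ℝ (A v) v)
    (htr : 0 ≤ LinearMap.trace ℝ V (A * K)) : |LinearMap.det (1 - A * K)| ≤ 1 := by
  obtain ⟨C, hC, rfl⟩ := exists_symmetric_sqrt hA hA0
  have hM : (1 - (C * K) * C).IsSymmetric := by
    intro v w
    simp only [LinearMap.sub_apply, Module.End.one_apply, Module.End.mul_apply, inner_sub_left,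
      inner_sub_right]
    rw [hC, hK, hC]
  rw [mul_assoc, det_one_sub_mul_comm]
  rw [mul_assoc, LinearMap.trace_mul_comm] at htr
  set M := 1 - (C * K) * C with hMdef
  set b := hM.eigenvectorBasis rfl with hb
  set l := hM.eigenvalues rfl with hl
  have hMb : ∀ i, M (b i) = l i • b i := fun i => hM.apply_eigenvectorBasis rfl i
  have hl0 : ∀ i, 0 ≤ l i := by
    intro i
    by_contra! hneg
    have h1 : 1 - l i ≠ 0 := by linarith
    -- An eigenvector for a nonzero eigenvalue of `C K C` lies in the range of `C`.
    obtain ⟨w, hw⟩ : ∃ w, b i = C w := by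
      refine ⟨(1 - l i)⁻¹ • K (C (b i)), ?_⟩
      have h2 := hMb i
      simp only [hMdef, LinearMap.sub_apply, Module.End.one_apply, Module.End.mul_apply] at h2
      rw [map_smul, ← sub_eq_iff_eq_add'.2 (sub_eq_iff_eq_add.1 h2)]
      rw [show b i - l i • b i = (1 - l i) • b i by rw [sub_smul, one_smul], smul_smul,
        inv_mul_cancel₀ h1, one_smul]
    have h2 : inner ℝ (M (b i)) (b i) = l i := by
      rw [hMb, inner_smul_left, real_inner_self_eq_norm_sq, b.norm_eq_one]
      simp
    have h3 : 0 ≤ inner ℝ (M (b i)) (b i) := by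
      rw [hw]
      simp only [hMdef, LinearMap.sub_apply, Module.End.one_apply, Module.End.mul_apply,
        inner_sub_left]
      have h4 := hle w
      simp only [Module.End.mul_apply] at h4
      rw [hC (C w) w] at h4
      rw [hC (K (C (C w)))]
      linarith
    linarith
  have hdet : LinearMap.det M = ∏ i, l i := hM.det_eq_prod_eigenvalues rfl
  have htrM : LinearMap.trace ℝ V M = ∑ i, l i := hM.trace_eq_sum_eigenvalues rfl
  have hsum : ∑ i, (l i - 1) ≤ 0 := by
    rw [Finset.sum_sub_distrib, ← htrM, hMdef, map_sub, LinearMap.trace_one]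
    simp only [Finset.sum_const, Finset.card_univ, Fintype.card_fin, nsmul_eq_mul, mul_one]
    linarith
  rw [hdet, abs_of_nonneg (Finset.prod_nonneg fun i _ => hl0 i)]
  calc ∏ i, l i ≤ ∏ i, Real.exp (l i - 1) :=
        Finset.prod_le_prod (fun i _ => hl0 i) fun i _ => by
          linarith [Real.add_one_le_exp (l i - 1)]
    _ = Real.exp (∑ i, (l i - 1)) := (Real.exp_sum _ _).symm
    _ ≤ 1 := Real.exp_le_one_iff.2 hsum

/-- If `L` takes values in the orthogonal complement of the unit vector `e`, then the operator on
the left is `1 - L` followed by the map which sends `e` to `-n` and fixes `e^⊥`. -/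
theorem det_normal_map {L : V →ₗ[ℝ] V} {e n : V} (he : ‖e‖ = 1)
    (hL : ∀ v, inner ℝ e (L v) = 0) :
    LinearMap.det (1 - L - (LinearMap.toSpanSingleton ℝ V (n + e)).comp (innerₛₗ ℝ e)) =
      - inner ℝ e n * LinearMap.det (1 - L) := by
  have hee : inner ℝ e e = (1 : ℝ) := by rw [real_inner_self_eq_norm_sq, he, one_pow]
  have h1 : 1 - L - (LinearMap.toSpanSingleton ℝ V (n + e)).comp (innerₛₗ ℝ e) =
      LinearMap.transvection (innerₛₗ ℝ e) (-(n + e)) * (1 - L) := by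
    ext v
    simp only [LinearMap.sub_apply, Module.End.one_apply, LinearMap.comp_apply,
      Module.End.mul_apply, LinearMap.transvection.apply, LinearMap.toSpanSingleton_apply,
      innerₛₗ_apply_apply, inner_sub_right, hL, sub_zero, smul_neg]
    abel
  rw [h1, map_mul, LinearMap.transvection.det]
  simp only [innerₛₗ_apply_apply, inner_neg_right, inner_add_right, hee]
  ring

end Determinant

/-! ### Normals and local charts of the boundary -/

section Charts

variable {N : ℕ} {Ω U : Set (EuclideanSpace ℝ (Fin N))} {y : EuclideanSpace ℝ (Fin N)}
  {ρ : EuclideanSpace ℝ (Fin N) → ℝ}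

/-- A half space determines its unit normal. -/
theorem normalize_eq_of_forall_inner_neg {H : Type*} [NormedAddCommGroup H]
    [InnerProductSpace ℝ H] {a b : H} (ha : a ≠ 0) (hb : b ≠ 0)
    (h : ∀ v : H, inner ℝ a v < 0 → inner ℝ b v ≤ 0) : ‖a‖⁻¹ • a = ‖b‖⁻¹ • b := by
  have ha' : 0 < ‖a‖ := norm_pos_iff.2 ha
  have hb' : 0 < ‖b‖ := norm_pos_iff.2 hb
  have na : ‖‖a‖⁻¹ • a‖ = 1 := by simp [norm_smul, ha'.ne']
  have nb : ‖‖b‖⁻¹ • b‖ = 1 := by simp [norm_smul, hb'.ne']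
  rw [← inner_eq_one_iff_of_norm_eq_one (𝕜 := ℝ) na nb]
  have hle : inner ℝ (‖a‖⁻¹ • a) (‖b‖⁻¹ • b) ≤ (1 : ℝ) := by
    simpa [na, nb] using real_inner_le_norm (‖a‖⁻¹ • a) (‖b‖⁻¹ • b)
  refine le_antisymm hle ?_
  by_contra! hlt
  set v := ‖b‖⁻¹ • b - ‖a‖⁻¹ • a with hv
  have h1 : inner ℝ (‖a‖⁻¹ • a) v < 0 := by
    rw [hv, inner_sub_right, real_inner_self_eq_norm_sq, na]; linarith
  have h2 : 0 < inner ℝ (‖b‖⁻¹ • b) v := by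
    rw [hv, inner_sub_right, real_inner_self_eq_norm_sq, nb, real_inner_comm]; linarith
  rw [real_inner_smul_left] at h1 h2
  have h3 := h v (by
    by_contra! h0
    have := mul_nonneg (inv_pos.2 ha').le h0
    linarith)
  have := mul_nonpos_of_nonneg_of_nonpos (inv_pos.2 hb').le h3
  linarith

namespace IsC2DefiningFunction

theorem contDiffAt (h : IsC2DefiningFunction Ω y U ρ) {x : EuclideanSpace ℝ (Fin N)}
    (hx : x ∈ U) : ContDiffAt ℝ 2 ρ x :=
  h.contDiffOn.contDiffAt (h.isOpen.mem_nhds hx)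

theorem hasFDerivAt (h : IsC2DefiningFunction Ω y U ρ) {x : EuclideanSpace ℝ (Fin N)}
    (hx : x ∈ U) : HasFDerivAt ρ (fderiv ℝ ρ x) x :=
  ((h.contDiffAt hx).differentiableAt (by norm_num)).hasFDerivAt

theorem contDiffOn_gradient (h : IsC2DefiningFunction Ω y U ρ) :
    ContDiffOn ℝ 1 (gradient ρ) U :=
  RobinFinsler.contDiffOn_gradient h.isOpen h.contDiffOn (by norm_num)

theorem hasFDerivAt_gradient (h : IsC2DefiningFunction Ω y U ρ) {x : EuclideanSpace ℝ (Fin N)}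
    (hx : x ∈ U) : HasFDerivAt (gradient ρ) (fderiv ℝ (gradient ρ) x) x :=
  ((h.contDiffOn_gradient.contDiffAt (h.isOpen.mem_nhds hx)).differentiableAt
    (by norm_num)).hasFDerivAt

/-- The chain rule along a differentiable curve. -/
theorem hasDerivAt_comp (h : IsC2DefiningFunction Ω y U ρ)
    {γ : ℝ → EuclideanSpace ℝ (Fin N)} {v : EuclideanSpace ℝ (Fin N)} {t : ℝ}
    (hx : γ t ∈ U) (hγ : HasDerivAt γ v t) :
    HasDerivAt (fun s => ρ (γ s)) (inner ℝ (gradient ρ (γ t)) v) t := by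
  rw [inner_gradient_eq_fderiv]
  exact (h.hasFDerivAt hx).comp_hasDerivAt t hγ

theorem le_zero_of_mem_closure (h : IsC2DefiningFunction Ω y U ρ) {x : EuclideanSpace ℝ (Fin N)}
    (hx : x ∈ U) (hxΩ : x ∈ closure Ω) : ρ x ≤ 0 := by
  rw [closure_eq_self_union_frontier] at hxΩ
  rcases hxΩ with hxΩ | hxΩ
  · exact ((h.mem_iff x hx).1 hxΩ).le
  · exact ((h.mem_frontier_iff x hx).1 hxΩ).le

theorem hasDerivAt_line (y v : EuclideanSpace ℝ (Fin N)) (t : ℝ) :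
    HasDerivAt (fun s : ℝ => y + s • v) v t := by
  simpa using ((hasDerivAt_id t).smul_const v).const_add y

/-- The gradient of a defining function is nonpositive along directions that meet the closure of
`Ω` arbitrarily close to the boundary point. -/
theorem inner_gradient_le_zero (h : IsC2DefiningFunction Ω y U ρ) (hy : y ∈ frontier Ω)
    {v : EuclideanSpace ℝ (Fin N)} (hv : ∃ᶠ t : ℝ in 𝓝[>] 0, y + t • v ∈ closure Ω) :
    inner ℝ (gradient ρ y) v ≤ 0 := by
  have h1 := h.hasDerivAt_comp (γ := fun s : ℝ => y + s • v) (t := 0) (by simpa using h.mem)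
    (hasDerivAt_line y v 0)
  have h2 := h1.tendsto_slope_zero_right
  simp only [zero_smul, add_zero, zero_add] at h2
  have hU : ∀ᶠ t : ℝ in 𝓝[>] 0, y + t • v ∈ U := by
    have hc : Tendsto (fun t : ℝ => y + t • v) (𝓝[>] 0) (𝓝 y) := by
      have : Continuous (fun t : ℝ => y + t • v) := by fun_prop
      simpa using (this.tendsto 0).mono_left nhdsWithin_le_nhds
    exact hc.eventually (h.isOpen.mem_nhds h.mem)
  refine le_of_tendsto_of_frequently h2 ?_
  refine (hv.and_eventually (hU.and self_mem_nhdsWithin)).mono fun t ht => ?_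
  have ht0 : 0 < t := ht.2.2
  rw [(h.mem_frontier_iff y h.mem).1 hy, sub_zero, smul_eq_mul]
  exact mul_nonpos_of_nonneg_of_nonpos (inv_pos.2 ht0).le (h.le_zero_of_mem_closure ht.2.1 ht.1)

theorem eventually_mem_of_inner_gradient_neg (h : IsC2DefiningFunction Ω y U ρ)
    (hy : y ∈ frontier Ω) {v : EuclideanSpace ℝ (Fin N)} (hv : inner ℝ (gradient ρ y) v < 0) :
    ∀ᶠ t : ℝ in 𝓝[>] 0, y + t • v ∈ Ω := by
  have h1 := h.hasDerivAt_comp (γ := fun s : ℝ => y + s • v) (t := 0) (by simpa using h.mem)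
    (hasDerivAt_line y v 0)
  have h2 := h1.tendsto_slope_zero_right
  simp only [zero_smul, add_zero, zero_add] at h2
  have hU : ∀ᶠ t : ℝ in 𝓝[>] 0, y + t • v ∈ U := by
    have hc : Tendsto (fun t : ℝ => y + t • v) (𝓝[>] 0) (𝓝 y) := by
      have : Continuous (fun t : ℝ => y + t • v) := by fun_prop
      simpa using (this.tendsto 0).mono_left nhdsWithin_le_nhds
    exact hc.eventually (h.isOpen.mem_nhds h.mem)
  filter_upwards [h2.eventually (gt_mem_nhds hv), hU, self_mem_nhdsWithin] with t ht htU ht0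
  have ht0 : 0 < t := ht0
  rw [(h.mem_frontier_iff y h.mem).1 hy, sub_zero, smul_eq_mul] at ht
  refine (h.mem_iff _ htU).2 ?_
  by_contra! h0
  have := mul_nonneg (inv_pos.2 ht0).le h0
  linarith

/-- The outer normal can be computed with any defining function. -/
theorem outerNormal_eq (h : IsC2DefiningFunction Ω y U ρ) (hy : y ∈ frontier Ω) :
    outerNormal Ω y = ‖gradient ρ y‖⁻¹ • gradient ρ y := by
  have hex : ∃ ρ : EuclideanSpace ℝ (Fin N) → ℝ, ∃ U, y ∈ frontier Ω ∧
    IsC2DefiningFunction Ω y U ρ := ⟨ρ, U, hy, h⟩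
  rw [outerNormal, dif_pos hex]
  obtain ⟨U', -, h'⟩ := hex.choose_spec
  refine normalize_eq_of_forall_inner_neg (h'.gradient_ne_zero y h'.mem)
    (h.gradient_ne_zero y h.mem) fun v hv => ?_
  exact h.inner_gradient_le_zero hy
    (((h'.eventually_mem_of_inner_gradient_neg hy hv).mono
      fun t ht => subset_closure ht).frequently)

theorem norm_outerNormal (h : IsC2DefiningFunction Ω y U ρ) (hy : y ∈ frontier Ω) :
    ‖outerNormal Ω y‖ = 1 := by
  rw [h.outerNormal_eq hy]
  simp [norm_smul, h.gradient_ne_zero y h.mem]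

theorem of_mem (h : IsC2DefiningFunction Ω y U ρ) {x : EuclideanSpace ℝ (Fin N)} (hx : x ∈ U) :
    IsC2DefiningFunction Ω x U ρ :=
  ⟨h.isOpen, hx, h.contDiffOn, h.gradient_ne_zero, h.mem_iff, h.mem_frontier_iff⟩

theorem gradient_eq_smul_outerNormal (h : IsC2DefiningFunction Ω y U ρ) (hy : y ∈ frontier Ω) :
    gradient ρ y = ‖gradient ρ y‖ • outerNormal Ω y := by
  rw [h.outerNormal_eq hy, smul_smul, mul_inv_cancel₀ (norm_ne_zero_iff.2
    (h.gradient_ne_zero y h.mem)), one_smul]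

theorem anisotropicNormal_eq {p : ℝ} {F : EuclideanSpace ℝ (Fin N) → ℝ} (hF : IsFinslerNorm p F)
    (h : IsC2DefiningFunction Ω y U ρ) (hy : y ∈ frontier Ω) :
    anisotropicNormal F Ω y = gradient F (gradient ρ y) := by
  rw [anisotropicNormal, h.outerNormal_eq hy, hF.gradient_smul]
  exact inv_pos.2 (norm_pos_iff.2 (h.gradient_ne_zero y h.mem))

end IsC2DefiningFunction

/-- The orthogonal projection onto the orthogonal complement of the unit vector `e`. -/
def projPerp (e : EuclideanSpace ℝ (Fin N)) :
    EuclideanSpace ℝ (Fin N) →L[ℝ] EuclideanSpace ℝ (Fin N) :=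
  ContinuousLinearMap.id ℝ _ - (innerSL ℝ e).smulRight e

theorem projPerp_apply (e x : EuclideanSpace ℝ (Fin N)) :
    projPerp e x = x - inner ℝ e x • e := by
  simp [projPerp]

theorem inner_projPerp {e : EuclideanSpace ℝ (Fin N)} (he : ‖e‖ = 1)
    (x : EuclideanSpace ℝ (Fin N)) : inner ℝ e (projPerp e x) = 0 := by
  rw [projPerp_apply, inner_sub_right, inner_smul_right, real_inner_self_eq_norm_sq, he]
  ring

theorem projPerp_of_inner_eq_zero {e x : EuclideanSpace ℝ (Fin N)} (hx : inner ℝ e x = 0) :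
    projPerp e x = x := by rw [projPerp_apply, hx, zero_smul, sub_zero]

theorem projPerp_self {e : EuclideanSpace ℝ (Fin N)} (he : ‖e‖ = 1) : projPerp e e = 0 := by
  rw [projPerp_apply, real_inner_self_eq_norm_sq, he]; simp

theorem projPerp_symm (e x z : EuclideanSpace ℝ (Fin N)) :
    inner ℝ (projPerp e x) z = inner ℝ x (projPerp e z) := by
  simp only [projPerp_apply, inner_sub_left, inner_sub_right, inner_smul_left, inner_smul_right,
    conj_trivial, real_inner_comm x e]
  ring

/-- A `C¹` chart of the boundary near `y`: with `e` the outer normal at `y`, the boundary is near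
`y` the image of a neighbourhood of the projection of `y` in the hyperplane `e^⊥`, under a map which
is inverse to the orthogonal projection. The chart `Θ` is defined on an open subset of the whole
space. It is the local inverse of `x ↦ P x + ρ x / |∇ρ y| • e`, whose derivative at `y` is the
identity. -/
theorem IsC2DefiningFunction.exists_chart (h : IsC2DefiningFunction Ω y U ρ)
    (hy : y ∈ frontier Ω) :
    ∃ (Θ : EuclideanSpace ℝ (Fin N) → EuclideanSpace ℝ (Fin N))
      (W O : Set (EuclideanSpace ℝ (Fin N))), IsOpen W ∧ IsOpen O ∧ y ∈ O ∧ O ⊆ U ∧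
      projPerp (outerNormal Ω y) y ∈ W ∧ ContDiffOn ℝ 1 Θ W ∧
      Θ (projPerp (outerNormal Ω y) y) = y ∧
      HasFDerivAt Θ (ContinuousLinearMap.id ℝ _) (projPerp (outerNormal Ω y) y) ∧
      (∀ w ∈ W, Θ w ∈ U) ∧
      (∀ w ∈ W, inner ℝ (outerNormal Ω y) w = 0 →
        Θ w ∈ frontier Ω ∧ projPerp (outerNormal Ω y) (Θ w) = w) ∧
      (∀ x ∈ O, x ∈ frontier Ω →
        projPerp (outerNormal Ω y) x ∈ W ∧ Θ (projPerp (outerNormal Ω y) x) = x) := by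
  set e := outerNormal Ω y with he
  have he1 : ‖e‖ = 1 := h.norm_outerNormal hy
  set r := ‖gradient ρ y‖⁻¹ with hr
  have hr0 : r ≠ 0 := inv_ne_zero (norm_ne_zero_iff.2 (h.gradient_ne_zero y h.mem))
  let G : EuclideanSpace ℝ (Fin N) → EuclideanSpace ℝ (Fin N) :=
    fun x => projPerp e x + (r * ρ x) • e
  have hG : ContDiffOn ℝ 1 G U := by
    refine (projPerp e).contDiff.contDiffOn.add ?_
    exact (contDiffOn_const.mul (h.contDiffOn.of_le (by norm_num))).smul contDiffOn_const
  have hGy : ContDiffAt ℝ 1 G y := hG.contDiffAt (h.isOpen.mem_nhds h.mem)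
  have hGfr : ∀ x ∈ U, x ∈ frontier Ω → G x = projPerp e x := fun x hx hxf => by
    simp only [G, (h.mem_frontier_iff x hx).1 hxf, mul_zero, zero_smul, add_zero]
  have hd : HasFDerivAt G
      ((ContinuousLinearEquiv.refl ℝ (EuclideanSpace ℝ (Fin N)) :
        EuclideanSpace ℝ (Fin N) →L[ℝ] EuclideanSpace ℝ (Fin N))) y := by
    have h1 := (projPerp e).hasFDerivAt (x := y) |>.add
      (((h.hasFDerivAt h.mem).const_mul r).smul_const e)
    refine h1.congr_fderiv ?_
    ext1 v
    have h2 : r * fderiv ℝ ρ y v = inner ℝ e v := by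
      rw [← inner_gradient_eq_fderiv, he, h.outerNormal_eq hy, real_inner_smul_left]
    simp [projPerp_apply, h2]
  set Φ := hGy.toOpenPartialHomeomorph G hd (by norm_num) with hΦ
  have hΦG : ∀ x, Φ x = G x := fun x => rfl
  have hys : y ∈ Φ.source := hGy.mem_toOpenPartialHomeomorph_source hd (by norm_num)
  have hyt : projPerp e y ∈ Φ.target := by
    have := Φ.map_source hys
    rwa [hΦG, hGfr y h.mem hy] at this
  have hΘy : Φ.symm (projPerp e y) = y := by
    have := Φ.left_inv hys
    rwa [hΦG, hGfr y h.mem hy] at this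
  have hΘC : ContDiffAt ℝ 1 Φ.symm (projPerp e y) := by
    have := hGy.to_localInverse hd (by norm_num)
    rw [hGfr y h.mem hy] at this
    exact this
  have hΘd : HasFDerivAt Φ.symm (ContinuousLinearMap.id ℝ _) (projPerp e y) := by
    have h1 : HasFDerivAt Φ ((ContinuousLinearEquiv.refl ℝ (EuclideanSpace ℝ (Fin N)) :
        EuclideanSpace ℝ (Fin N) →L[ℝ] EuclideanSpace ℝ (Fin N))) (Φ.symm (projPerp e y)) := by
      rw [hΘy]; exact hd
    have := Φ.hasFDerivAt_symm hyt h1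
    simpa using this
  obtain ⟨W₁, hW₁, hW₁C⟩ : ∃ W₁ ∈ 𝓝 (projPerp e y), ContDiffOn ℝ 1 Φ.symm W₁ :=
    hΘC.contDiffOn le_rfl (by simp)
  obtain ⟨W₂, hW₂s, hW₂o, hW₂y⟩ := mem_nhds_iff.1 hW₁
  set W := W₂ ∩ (Φ.target ∩ Φ.symm ⁻¹' (U ∩ Φ.source)) with hW
  have hWo : IsOpen W := hW₂o.inter
    (Φ.isOpen_inter_preimage_symm (h.isOpen.inter Φ.open_source))
  have hyW : projPerp e y ∈ W := ⟨hW₂y, hyt, by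
    simp only [mem_preimage, hΘy]; exact ⟨h.mem, hys⟩⟩
  refine ⟨Φ.symm, W, Φ.source ∩ U ∩ (projPerp e) ⁻¹' W, hWo,
    (Φ.open_source.inter h.isOpen).inter (hWo.preimage (projPerp e).continuous),
    ⟨⟨hys, h.mem⟩, hyW⟩, fun x hx => hx.1.2, hyW, hW₁C.mono (inter_subset_left.trans hW₂s), hΘy,
    hΘd, fun w hw => hw.2.2.1, ?_, ?_⟩
  · intro w hw hwe
    have h1 : G (Φ.symm w) = w := Φ.right_inv hw.2.1
    have h2 : r * ρ (Φ.symm w) = 0 := by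
      have := congrArg (inner ℝ e) h1
      simpa [G, inner_add_right, inner_projPerp he1, inner_smul_right, he1, hwe] using this
    refine ⟨(h.mem_frontier_iff _ hw.2.2.1).2 ((mul_eq_zero.1 h2).resolve_left hr0), ?_⟩
    simpa [G, h2] using h1
  · intro x hx hxf
    refine ⟨hx.2, ?_⟩
    have := Φ.left_inv hx.1.1
    rwa [hΦG, hGfr x hx.1.2 hxf] at this

end Charts

/-! ### The anisotropic distance to the boundary -/

section Distance

variable {N : ℕ} {p : ℝ} {F : EuclideanSpace ℝ (Fin N) → ℝ}
  {Ω U : Set (EuclideanSpace ℝ (Fin N))} {ρ : EuclideanSpace ℝ (Fin N) → ℝ}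

namespace IsFinslerNorm

theorem distBoundary_nonneg (hF : IsFinslerNorm p F) (x : EuclideanSpace ℝ (Fin N)) :
    0 ≤ distBoundary F Ω x :=
  Real.iInf_nonneg fun _ => hF.polar_nonneg _

theorem distBoundary_le (hF : IsFinslerNorm p F) {y : EuclideanSpace ℝ (Fin N)}
    (hy : y ∈ frontier Ω) (x : EuclideanSpace ℝ (Fin N)) :
    distBoundary F Ω x ≤ polar F (x - y) :=
  ciInf_le (f := fun y : frontier Ω => polar F (x - y.1))
    ⟨0, by rintro _ ⟨y, rfl⟩; exact hF.polar_nonneg _⟩ ⟨y, hy⟩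

theorem le_distBoundary (hne : (frontier Ω).Nonempty) {x : EuclideanSpace ℝ (Fin N)} {c : ℝ}
    (h : ∀ y ∈ frontier Ω, c ≤ polar F (x - y)) : c ≤ distBoundary F Ω x :=
  haveI := hne.to_subtype
  le_ciInf fun y => h y.1 y.2

theorem distBoundary_eq_zero (hF : IsFinslerNorm p F) {y : EuclideanSpace ℝ (Fin N)}
    (hy : y ∈ frontier Ω) : distBoundary F Ω y = 0 := by
  refine le_antisymm ?_ (hF.distBoundary_nonneg y)
  have := hF.distBoundary_le hy y
  rwa [sub_self, polar_zero] at this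

theorem distBoundary_le_add (hF : IsFinslerNorm p F) (hne : (frontier Ω).Nonempty)
    (x z : EuclideanSpace ℝ (Fin N)) :
    distBoundary F Ω x ≤ distBoundary F Ω z + polar F (x - z) := by
  rw [← sub_le_iff_le_add]
  refine le_distBoundary hne fun y hy => ?_
  rw [sub_le_iff_le_add]
  refine (hF.distBoundary_le hy x).trans ?_
  rw [add_comm, show x - y = (x - z) + (z - y) by abel]
  exact hF.polar_add_le _ _

theorem exists_lipschitzWith_distBoundary (hF : IsFinslerNorm p F) (hne : (frontier Ω).Nonempty) :
    ∃ C : ℝ≥0, LipschitzWith C (distBoundary F Ω) := by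
  obtain ⟨C, hC⟩ := hF.exists_polar_le_norm
  refine ⟨C, LipschitzWith.of_le_add_mul C fun x z => ?_⟩
  rw [dist_eq_norm]
  linarith [hC (x - z), hF.distBoundary_le_add hne x z]

theorem continuous_distBoundary (hF : IsFinslerNorm p F) (hne : (frontier Ω).Nonempty) :
    Continuous (distBoundary F Ω) :=
  (hF.exists_lipschitzWith_distBoundary hne).choose_spec.continuous

/-- The infimum in the distance to a compact boundary is attained. -/
theorem exists_foot (hF : IsFinslerNorm p F) (hc : IsCompact (frontier Ω))
    (hne : (frontier Ω).Nonempty) (x : EuclideanSpace ℝ (Fin N)) :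
    ∃ y ∈ frontier Ω, distBoundary F Ω x = polar F (x - y) := by
  have hcont : Continuous fun y => polar F (x - y) :=
    hF.continuous_polar.comp (continuous_const.sub continuous_id)
  obtain ⟨y, hy, hmin⟩ := hc.exists_isMinOn hne hcont.continuousOn
  exact ⟨y, hy, le_antisymm (hF.distBoundary_le hy x) (le_distBoundary hne fun z hz => hmin hz)⟩

theorem convex_polar_ball (hF : IsFinslerNorm p F) (x : EuclideanSpace ℝ (Fin N)) (r : ℝ) :
    Convex ℝ {z | polar F (z - x) < r} := by
  intro z hz w hw a b ha hb hab
  have hz : polar F (z - x) < r := hz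
  have hw : polar F (w - x) < r := hw
  have h1 : a • z + b • w - x = a • (z - x) + b • (w - x) := by
    have : x = a • x + b • x := by rw [← add_smul, hab, one_smul]
    nth_rewrite 1 [this]
    simp only [smul_sub]; abel
  simp only [mem_ofPred_eq, h1]
  refine (hF.polar_add_le _ _).trans_lt ?_
  rw [polar_smul F ha, polar_smul F hb]
  rcases ha.eq_or_lt with rfl | ha'
  · have : b = 1 := by linarith
    simpa [this] using hw
  · have h2 : a * polar F (z - x) < a * r := mul_lt_mul_of_pos_left hz ha'
    have h3 : b * polar F (w - x) ≤ b * r := mul_le_mul_of_nonneg_left hw.le hb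
    have : a * r + b * r = r := by rw [← add_mul, hab, one_mul]
    linarith

/-- The open Wulff ball around `x ∈ Ω` whose radius is the distance to the boundary lies in `Ω`. -/
theorem mem_of_polar_lt (hF : IsFinslerNorm p F) {x z : EuclideanSpace ℝ (Fin N)}
    (hx : x ∈ Ω) (hz : polar F (z - x) < distBoundary F Ω x) : z ∈ Ω := by
  by_contra hzΩ
  have hpre := (hF.convex_polar_ball x (distBoundary F Ω x)).isPreconnected
  have h0 : 0 < distBoundary F Ω x := (hF.polar_nonneg _).trans_lt hz
  have hxB : x ∈ {z | polar F (z - x) < distBoundary F Ω x} := by simpa [polar_zero] using h0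
  obtain ⟨w, hw, hwf⟩ : ({z | polar F (z - x) < distBoundary F Ω x} ∩ frontier Ω).Nonempty := by
    by_contra hempty
    have hsub : {z | polar F (z - x) < distBoundary F Ω x} ⊆ interior Ω ∪ (closure Ω)ᶜ := by
      intro w hw
      by_contra hcon
      simp only [mem_union, mem_compl_iff, not_or, not_not] at hcon
      exact hempty ⟨w, hw, hcon.2, hcon.1⟩
    obtain ⟨w, -, hw1, hw2⟩ := hpre _ _ isOpen_interior isClosed_closure.isOpen_compl hsub
      ⟨x, hxB, (hsub hxB).resolve_right fun hc => hc (subset_closure hx)⟩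
      ⟨z, hz, (hsub hz).resolve_left fun hc => hzΩ (interior_subset hc)⟩
    exact hw2 (subset_closure (interior_subset hw1))
  have h1 := hF.distBoundary_le hwf x
  have h2 : polar F (w - x) < distBoundary F Ω x := hw
  rw [← hF.polar_neg, neg_sub] at h2
  linarith

/-- The closed Wulff ball around `x ∈ Ω` whose radius is the distance to the boundary lies in the
closure of `Ω`. -/
theorem add_smul_mem_closure (hF : IsFinslerNorm p F) {x w : EuclideanSpace ℝ (Fin N)}
    (hx : x ∈ Ω) (hw : polar F w ≤ 1) : x + distBoundary F Ω x • w ∈ closure Ω := by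
  rcases (hF.distBoundary_nonneg x (Ω := Ω)).eq_or_lt with h0 | h0
  · rw [← h0, zero_smul, add_zero]; exact subset_closure hx
  have hc : Tendsto (fun t : ℝ => x + (t * distBoundary F Ω x) • w) (𝓝[<] 1)
      (𝓝 (x + distBoundary F Ω x • w)) := by
    have : Continuous (fun t : ℝ => x + (t * distBoundary F Ω x) • w) := by fun_prop
    simpa using (this.tendsto 1).mono_left nhdsWithin_le_nhds
  refine mem_closure_of_tendsto hc ?_
  filter_upwards [Ioo_mem_nhdsLT (zero_lt_one' ℝ)] with t ht
  refine hF.mem_of_polar_lt hx ?_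
  rw [add_sub_cancel_left, polar_smul F (mul_pos ht.1 h0).le]
  have h1 : t * distBoundary F Ω x < distBoundary F Ω x := by nlinarith [ht.2]
  have := mul_le_mul_of_nonneg_left hw (mul_pos ht.1 h0).le
  linarith

/-- A point of `Ω` is reached from its foot point on the boundary by following the anisotropic
normal. -/
theorem eq_sub_of_foot (hF : IsFinslerNorm p F) {x y : EuclideanSpace ℝ (Fin N)} (hx : x ∈ Ω)
    (hy : y ∈ frontier Ω) (hxy : distBoundary F Ω x = polar F (x - y)) (hxne : x ≠ y)
    (h : IsC2DefiningFunction Ω y U ρ) :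
    x = y - distBoundary F Ω x • gradient F (gradient ρ y) := by
  set s := distBoundary F Ω x with hs
  have hs0 : 0 < s := by rw [hxy]; exact hF.polar_pos (sub_ne_zero.2 hxne)
  set w := s⁻¹ • (y - x) with hw
  have hyw : y = x + s • w := by
    rw [hw, smul_smul, mul_inv_cancel₀ hs0.ne', one_smul, add_sub_cancel]
  have hw1 : polar F w = 1 := by
    rw [hw, polar_smul F (inv_nonneg.2 hs0.le), ← hF.polar_neg, neg_sub, ← hxy,
      inv_mul_cancel₀ hs0.ne']
  have hg := h.gradient_ne_zero y h.mem
  -- By convexity of the ball, `y` can be moved towards `x + s w'` inside the closure of `Ω`.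
  have hmax : ∀ w', polar F w' ≤ 1 → inner ℝ (gradient ρ y) (w' - w) ≤ 0 := by
    intro w' hw'
    refine h.inner_gradient_le_zero hy (Eventually.frequently ?_)
    filter_upwards [Ioo_mem_nhdsGT (show (0 : ℝ) < s from hs0)] with t ht
    have h1 : y + t • (w' - w) = x + s • ((1 - t / s) • w + (t / s) • w') := by
      have h0 : s * (t / s) = t := mul_div_cancel₀ _ hs0.ne'
      have h0' : s * (1 - t / s) = s - t := by rw [mul_sub, h0, mul_one]
      rw [smul_add, smul_smul s (1 - t / s) w, smul_smul s (t / s) w', h0, h0', sub_smul, smul_sub]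
      nth_rewrite 1 [hyw]
      abel
    rw [h1]
    refine hF.add_smul_mem_closure hx ?_
    have ht1 : t / s ≤ 1 := (div_le_one hs0).2 ht.2.le
    have ht0 : 0 ≤ t / s := div_nonneg ht.1.le hs0.le
    refine (hF.polar_add_le _ _).trans ?_
    rw [polar_smul F (by linarith), polar_smul F ht0, hw1]
    nlinarith
  have h2 := hmax _ (hF.polar_gradient hg).le
  rw [inner_sub_right, real_inner_comm, hF.inner_gradient_self hg] at h2
  have h3 := hF.eq_gradient_of_inner_eq hg hw1.le (by linarith)
  rw [← h3, eq_sub_iff_add_eq, ← hyw]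

end IsFinslerNorm

/-! ### Second order comparison with Wulff balls and the mean curvature -/

/-- A Wulff ball of radius `s` inside `Ω` which touches the boundary at `y` bounds the second
fundamental form of the boundary. The boundary of the ball is parametrized by `ξ ↦ x + s ∇F ξ`,
so that `ρ (x + s ∇F ξ)` has a local maximum at `ξ = ∇ρ y`. -/
theorem hessian_le_of_touching (hF : IsFinslerNorm p F) {x y : EuclideanSpace ℝ (Fin N)}
    (hy : y ∈ frontier Ω) (h : IsC2DefiningFunction Ω y U ρ) {s : ℝ} (hs : 0 < s)
    (hyx : y = x + s • gradient F (gradient ρ y))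
    (hin : ∀ ξ, ξ ≠ 0 → x + s • gradient F ξ ∈ closure Ω) (k : EuclideanSpace ℝ (Fin N)) :
    s * inner ℝ (fderiv ℝ (gradient ρ) y (fderiv ℝ (gradient F) (gradient ρ y) k))
      (fderiv ℝ (gradient F) (gradient ρ y) k) ≤
      inner ℝ (fderiv ℝ (gradient F) (gradient ρ y) k) k := by
  set g := gradient ρ y with hg
  have hg0 : g ≠ 0 := h.gradient_ne_zero y h.mem
  set c : ℝ → EuclideanSpace ℝ (Fin N) := fun t => x + s • gradient F (g + t • k) with hc
  set a : ℝ → EuclideanSpace ℝ (Fin N) := fun t => fderiv ℝ (gradient F) (g + t • k) k with ha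
  have hc0 : c 0 = y := by simp only [hc, zero_smul, add_zero]; exact hyx.symm
  have hlin : Tendsto (fun t : ℝ => g + t • k) (𝓝 0) (𝓝 g) := by
    have : Continuous (fun t : ℝ => g + t • k) := by fun_prop
    simpa using this.tendsto 0
  have hne : ∀ᶠ t : ℝ in 𝓝 0, g + t • k ≠ 0 := hlin.eventually (isOpen_compl_singleton.mem_nhds hg0)
  have hcd : ∀ᶠ t : ℝ in 𝓝 0, HasDerivAt c (s • a t) t := by
    filter_upwards [hne] with t ht
    exact (((hF.hasFDerivAt_gradient ht).comp_hasDerivAt t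
      (IsC2DefiningFunction.hasDerivAt_line g k t)).const_smul s).const_add x
  have hcc : ContinuousAt c 0 := hcd.self_of_nhds.continuousAt
  have hcU : ∀ᶠ t : ℝ in 𝓝 0, c t ∈ U := by
    refine hcc.eventually ?_
    rw [hc0]; exact h.isOpen.mem_nhds h.mem
  have hmd : ∀ᶠ t : ℝ in 𝓝 0,
      HasDerivAt (fun t => ρ (c t)) (inner ℝ (gradient ρ (c t)) (s • a t)) t := by
    filter_upwards [hcd, hcU] with t h1 h2
    exact h.hasDerivAt_comp h2 h1
  -- The derivative of `ρ ∘ c` at `t`, divided by `t`, tends to the difference of the two sides.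
  have hform : ∀ᶠ t : ℝ in 𝓝[>] 0, t⁻¹ * inner ℝ (gradient ρ (c t)) (s • a t) =
      s * (inner ℝ (t⁻¹ • (gradient ρ (c t) - g)) (a t) - inner ℝ (a t) k) := by
    filter_upwards [hne.filter_mono nhdsWithin_le_nhds, self_mem_nhdsWithin] with t ht ht0
    have ht0 : 0 < t := ht0
    have h1 : inner ℝ g (a t) = - (t * inner ℝ (a t) k) := by
      have h2 : inner ℝ (a t) (g + t • k) = 0 := by
        rw [ha, hF.hessian_symm ht, hF.hessian_self ht, inner_zero_right]
      rw [inner_add_right, inner_smul_right, real_inner_comm] at h2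
      linarith
    rw [inner_smul_right, real_inner_smul_left, inner_sub_left, h1]
    field_simp
    ring
  have haC : Tendsto a (𝓝 0) (𝓝 (fderiv ℝ (gradient F) g k)) := by
    have h1 : ContinuousAt (fderiv ℝ (gradient F)) g :=
      ((hF.contDiffOn_gradient.contDiffAt (isOpen_compl_singleton.mem_nhds hg0)).fderiv_right
        (m := 1) (by norm_num)).continuousAt
    exact ((ContinuousLinearMap.apply ℝ _ k).continuous.tendsto _).comp (h1.tendsto.comp hlin)
  have hgd : HasDerivAt (fun t => gradient ρ (c t))
      (fderiv ℝ (gradient ρ) y (s • fderiv ℝ (gradient F) g k)) 0 := by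
    have h1 := hcd.self_of_nhds
    have h2 : a 0 = fderiv ℝ (gradient F) g k := by simp [ha]
    rw [h2] at h1
    have h3 := h.hasFDerivAt_gradient h.mem
    rw [← hc0] at h3
    have := h3.comp_hasDerivAt 0 h1
    rwa [hc0] at this
  have hlim : Tendsto (fun t : ℝ => t⁻¹ * inner ℝ (gradient ρ (c t)) (s • a t)) (𝓝[>] 0)
      (𝓝 (s * (inner ℝ (fderiv ℝ (gradient ρ) y (s • fderiv ℝ (gradient F) g k))
        (fderiv ℝ (gradient F) g k) - inner ℝ (fderiv ℝ (gradient F) g k) k))) := by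
    refine Tendsto.congr' (hform.mono fun t ht => ht.symm) ?_
    have h1 := hgd.tendsto_slope_zero_right
    simp only [zero_add, hc0] at h1
    have h2 := haC.mono_left (nhdsWithin_le_nhds (s := Ioi 0))
    exact ((h1.inner h2).sub (h2.inner tendsto_const_nhds)).const_mul s
  -- Otherwise `ρ ∘ c` increases on a small interval, and is positive at a point of the closure.
  by_contra! hcon
  have hpos : 0 < s * (inner ℝ (fderiv ℝ (gradient ρ) y (s • fderiv ℝ (gradient F) g k))
        (fderiv ℝ (gradient F) g k) - inner ℝ (fderiv ℝ (gradient F) g k) k) := by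
    rw [map_smul, real_inner_smul_left]
    exact mul_pos hs (by linarith)
  have hev := hlim.eventually (lt_mem_nhds hpos)
  obtain ⟨δ, hδ0, hδ⟩ := mem_nhdsGT_iff_exists_Ioo_subset.1 hev
  obtain ⟨δ', hδ'0, hδ'⟩ := Metric.eventually_nhds_iff.1 (hmd.and (hcU.and hne))
  set τ := min δ δ' / 2 with hτ
  have hδ0 : 0 < δ := hδ0
  have hτ0 : 0 < τ := by positivity
  have hτδ : τ < δ := by
    have := min_le_left δ δ'
    have h2 : 0 < min δ δ' := by positivity
    rw [hτ]; linarith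
  have hτδ' : τ < δ' := by
    have := min_le_right δ δ'
    have h2 : 0 < min δ δ' := by positivity
    rw [hτ]; linarith
  have hball : ∀ t ∈ Icc 0 τ, dist t 0 < δ' := fun t ht => by
    rw [Real.dist_eq, sub_zero, abs_of_nonneg ht.1]; linarith [ht.2]
  have hmono : StrictMonoOn (fun t => ρ (c t)) (Icc 0 τ) := by
    refine strictMonoOn_of_deriv_pos (convex_Icc 0 τ) (fun t ht =>
      (hδ' (hball t ht)).1.continuousAt.continuousWithinAt) fun t ht => ?_
    rw [interior_Icc] at ht
    rw [(hδ' (hball t (Ioo_subset_Icc_self ht))).1.deriv]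
    have h1 := hδ ⟨ht.1, ht.2.trans hτδ⟩
    simp only [mem_ofPred_eq] at h1
    exact pos_of_mul_pos_right h1 (inv_pos.2 ht.1).le
  have h1 := hmono (left_mem_Icc.2 hτ0.le) (right_mem_Icc.2 hτ0.le) hτ0
  simp only [hc0, (h.mem_frontier_iff y h.mem).1 hy] at h1
  have h2 := hδ' (hball τ (right_mem_Icc.2 hτ0.le))
  have h3 := h.le_zero_of_mem_closure h2.2.1 (hin _ h2.2.2)
  linarith

/-- The derivative of the anisotropic normal along the boundary is the product of the Hessian of `F`
and the Hessian of the defining function. -/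
theorem hasFDerivWithinAt_anisotropicNormal (hF : IsFinslerNorm p F)
    {y : EuclideanSpace ℝ (Fin N)} (hy : y ∈ frontier Ω) (h : IsC2DefiningFunction Ω y U ρ) :
    HasFDerivWithinAt (anisotropicNormal F Ω)
      (fderiv ℝ (gradient F) (gradient ρ y) ∘L fderiv ℝ (gradient ρ) y) (frontier Ω) y := by
  have h1 : HasFDerivAt (fun x => gradient F (gradient ρ x))
      (fderiv ℝ (gradient F) (gradient ρ y) ∘L fderiv ℝ (gradient ρ) y) y :=
    (hF.hasFDerivAt_gradient (h.gradient_ne_zero y h.mem)).comp y (h.hasFDerivAt_gradient h.mem)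
  refine h1.hasFDerivWithinAt.congr_of_eventuallyEq ?_ (h.anisotropicNormal_eq hF hy)
  filter_upwards [self_mem_nhdsWithin, mem_nhdsWithin_of_mem_nhds (h.isOpen.mem_nhds h.mem)]
    with x hx hxU
  exact (h.of_mem hxU).anisotropicNormal_eq hF hx

/-- The boundary need not have unique differentials, but on tangent vectors the derivative within it
is determined: they are the velocities of curves on the boundary. -/
theorem fderivWithin_anisotropicNormal_apply (hF : IsFinslerNorm p F)
    {y : EuclideanSpace ℝ (Fin N)} (hy : y ∈ frontier Ω) (h : IsC2DefiningFunction Ω y U ρ)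
    {v : EuclideanSpace ℝ (Fin N)} (hv : inner ℝ (outerNormal Ω y) v = 0) :
    fderivWithin ℝ (anisotropicNormal F Ω) (frontier Ω) y v =
      fderiv ℝ (gradient F) (gradient ρ y) (fderiv ℝ (gradient ρ) y v) := by
  have h1 := hasFDerivWithinAt_anisotropicNormal hF hy h
  have h2 := h1.differentiableWithinAt.hasFDerivWithinAt
  obtain ⟨Θ, W, O, hWo, -, -, -, hyW, -, hΘy, hΘd, -, hΘf, -⟩ := h.exists_chart hy
  set e := outerNormal Ω y with he
  have he1 : ‖e‖ = 1 := h.norm_outerNormal hy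
  set γ : ℝ → EuclideanSpace ℝ (Fin N) := fun t => Θ (projPerp e y + t • v) with hγ
  have hγd : HasDerivAt γ v 0 := by
    have h3 : HasFDerivAt Θ (ContinuousLinearMap.id ℝ _) (projPerp e y + (0 : ℝ) • v) := by
      simpa using hΘd
    exact h3.comp_hasDerivAt 0 (IsC2DefiningFunction.hasDerivAt_line _ v 0)
  have hγ0 : γ 0 = y := by simp [hγ, hΘy]
  have hlin : Tendsto (fun t : ℝ => projPerp e y + t • v) (𝓝 0) (𝓝 (projPerp e y)) := by
    have : Continuous (fun t : ℝ => projPerp e y + t • v) := by fun_prop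
    simpa using this.tendsto 0
  obtain ⟨s, hs, hsW⟩ := (hlin.eventually (hWo.mem_nhds hyW)).exists_mem
  have hmaps : MapsTo γ s (frontier Ω) := fun t ht => by
    refine (hΘf _ (hsW t ht) ?_).1
    rw [inner_add_right, inner_smul_right, inner_projPerp he1, hv]; simp
  have key : ∀ f' : EuclideanSpace ℝ (Fin N) →L[ℝ] EuclideanSpace ℝ (Fin N),
      HasFDerivWithinAt (anisotropicNormal F Ω) f' (frontier Ω) y →
      HasDerivAt (fun t => anisotropicNormal F Ω (γ t)) (f' v) 0 := by
    intro f' hf'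
    rw [← hγ0] at hf'
    exact (hf'.comp_hasDerivWithinAt 0 (hγd.hasDerivWithinAt (s := s)) hmaps).hasDerivAt hs
  exact (key _ h2).unique (key _ h1)

/-- The mean curvature as the trace of an endomorphism of the whole space. -/
theorem anisotropicMeanCurvature_eq_trace (hF : IsFinslerNorm p F)
    {y : EuclideanSpace ℝ (Fin N)} (hy : y ∈ frontier Ω) (h : IsC2DefiningFunction Ω y U ρ) :
    anisotropicMeanCurvature F Ω y =
      LinearMap.trace ℝ (EuclideanSpace ℝ (Fin N))
        ((fderiv ℝ (gradient F) (gradient ρ y) : _ →ₗ[ℝ] _) *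
          ((fderiv ℝ (gradient ρ) y : _ →ₗ[ℝ] _) * (projPerp (outerNormal Ω y) : _ →ₗ[ℝ] _))) := by
  have he1 : ‖outerNormal Ω y‖ = 1 := h.norm_outerNormal hy
  set D : EuclideanSpace ℝ (Fin N) →ₗ[ℝ] EuclideanSpace ℝ (Fin N) :=
    (fderiv ℝ (gradient F) (gradient ρ y) : _ →ₗ[ℝ] _) * (fderiv ℝ (gradient ρ) y : _ →ₗ[ℝ] _)
    with hD
  set T := tangentSpace Ω y with hT
  have h1 : (weingarten F Ω y).toLinearMap =
      T.orthogonalProjectionOnto.toLinearMap ∘ₗ (D ∘ₗ T.subtype) := by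
    refine LinearMap.ext fun v => ?_
    have hv : inner ℝ (outerNormal Ω y) (v : EuclideanSpace ℝ (Fin N)) = 0 :=
      (Submodule.mem_orthogonal_singleton_iff_inner_right).1 v.2
    change T.orthogonalProjectionOnto (fderivWithin ℝ (anisotropicNormal F Ω) (frontier Ω) y
      (v : EuclideanSpace ℝ (Fin N))) = _
    rw [fderivWithin_anisotropicNormal_apply hF hy h hv]
    rfl
  have h2 : T.subtype ∘ₗ T.orthogonalProjectionOnto.toLinearMap =
      (projPerp (outerNormal Ω y) : _ →ₗ[ℝ] _) := by
    ext1 v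
    have := Submodule.starProjection_orthogonal_val (𝕜 := ℝ)
      (K := Submodule.span ℝ {outerNormal Ω y}) v
    simp only [LinearMap.comp_apply, ContinuousLinearMap.coe_coe, Submodule.subtype_apply,
      projPerp_apply]
    rw [← Submodule.starProjection_apply, this, Submodule.starProjection_unit_singleton ℝ he1]
  rw [anisotropicMeanCurvature, h1, LinearMap.trace_comp_comm', LinearMap.comp_assoc, h2,
    ← mul_assoc]
  rfl

/-- The Jacobian bound: at a boundary point `y` where the mean curvature is nonnegative and for `s`
not larger than the radius of an inner touching Wulff ball, the derivative of the normal
parametrization has determinant at most `F (ν y)` in absolute value. -/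
theorem abs_det_normal_map_le (hF : IsFinslerNorm p F) {y : EuclideanSpace ℝ (Fin N)}
    (hy : y ∈ frontier Ω) (h : IsC2DefiningFunction Ω y U ρ)
    (hcurv : 0 ≤ anisotropicMeanCurvature F Ω y) {s : ℝ} (hs : 0 ≤ s)
    (hin : 0 < s → ∀ ξ, ξ ≠ 0 →
      y - s • gradient F (gradient ρ y) + s • gradient F ξ ∈ closure Ω) :
    |(projPerp (outerNormal Ω y) -
      s • (fderiv ℝ (gradient F) (gradient ρ y) ∘L fderiv ℝ (gradient ρ) y ∘L
        projPerp (outerNormal Ω y)) -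
      (innerSL ℝ (outerNormal Ω y)).smulRight (gradient F (gradient ρ y))).det| ≤
      F (outerNormal Ω y) := by
  set e := outerNormal Ω y with he
  set g := gradient ρ y with hg
  have hg0 : g ≠ 0 := h.gradient_ne_zero y h.mem
  have hge : g = ‖g‖ • e := h.gradient_eq_smul_outerNormal hy
  have he1 : ‖e‖ = 1 := h.norm_outerNormal hy
  have he0 : e ≠ 0 := by intro h0; rw [h0] at he1; simp at he1
  set A : EuclideanSpace ℝ (Fin N) →ₗ[ℝ] EuclideanSpace ℝ (Fin N) :=
    (fderiv ℝ (gradient F) g).toLinearMap with hA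
  set B : EuclideanSpace ℝ (Fin N) →ₗ[ℝ] EuclideanSpace ℝ (Fin N) :=
    (fderiv ℝ (gradient ρ) y).toLinearMap with hB
  set P : EuclideanSpace ℝ (Fin N) →ₗ[ℝ] EuclideanSpace ℝ (Fin N) :=
    (projPerp e).toLinearMap with hP
  have hAs : A.IsSymmetric := fun v w => hF.hessian_symm hg0 v w
  have hBs : B.IsSymmetric := fun v w => inner_fderiv_gradient_comm (h.contDiffAt h.mem) v w
  have hPs : P.IsSymmetric := fun v w => projPerp_symm e v w
  have hAe : A e = 0 := by
    have h1 : A g = 0 := hF.hessian_self hg0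
    rw [hge, map_smul] at h1
    exact (smul_eq_zero.1 h1).resolve_left (norm_ne_zero_iff.2 hg0)
  have heA : ∀ v, inner ℝ e (A v) = 0 := fun v => by rw [← hAs, hAe, inner_zero_left]
  have hAP : A * P = A := by
    ext1 v
    simp only [Module.End.mul_apply, hP, ContinuousLinearMap.coe_coe, projPerp_apply, map_sub,
      map_smul, hAe, smul_zero, sub_zero]
  have hPA : ∀ v, P (A v) = A v := fun v => projPerp_of_inner_eq_zero (heA v)
  -- Symmetrize: since `A e = 0`, the projection may be inserted on both sides of `B`.
  set K : EuclideanSpace ℝ (Fin N) →ₗ[ℝ] EuclideanSpace ℝ (Fin N) := s • (P * (B * P)) with hK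
  have hAK : A * K = s • (A * (B * P)) := by
    rw [hK, mul_smul_comm, ← mul_assoc, hAP]
  have hdet : |LinearMap.det (1 - A * K)| ≤ 1 := by
    refine abs_det_one_sub_mul_le_one hAs (hF.hessian_nonneg hg0) ?_ ?_ ?_
    · intro v w
      simp only [hK, LinearMap.smul_apply, Module.End.mul_apply, inner_smul_left,
        inner_smul_right, conj_trivial]
      rw [hPs, hBs, hPs]
    · intro v
      simp only [hK, LinearMap.smul_apply, Module.End.mul_apply, inner_smul_left, conj_trivial]
      rw [hPs, hPA]
      rcases hs.eq_or_lt with h0 | h0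
      · rw [← h0, zero_mul]; exact hF.hessian_nonneg hg0 v
      · exact hessian_le_of_touching hF hy h h0 (by rw [sub_add_cancel]) (hin h0) v
    · rw [hAK, map_smul, smul_eq_mul, ← anisotropicMeanCurvature_eq_trace hF hy h]
      exact mul_nonneg hs hcurv
  have hL : ∀ v, inner ℝ e ((A * K) v) = 0 := fun v => heA _
  have hform := det_normal_map (n := gradient F g) he1 hL
  have hsame : ((projPerp e -
      s • (fderiv ℝ (gradient F) g ∘L fderiv ℝ (gradient ρ) y ∘L projPerp e) -
      (innerSL ℝ e).smulRight (gradient F g) :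
        EuclideanSpace ℝ (Fin N) →L[ℝ] EuclideanSpace ℝ (Fin N)) : _ →ₗ[ℝ] _) =
      1 - A * K - (LinearMap.toSpanSingleton ℝ _ (gradient F g + e)).comp (innerₛₗ ℝ e) := by
    rw [hAK]
    ext1 v
    simp only [ContinuousLinearMap.coe_coe, sub_apply, smul_apply,
      ContinuousLinearMap.comp_apply, ContinuousLinearMap.smulRight_apply, innerSL_apply_apply,
      LinearMap.sub_apply, LinearMap.smul_apply, Module.End.mul_apply, Module.End.one_apply,
      LinearMap.comp_apply, LinearMap.toSpanSingleton_apply, innerₛₗ_apply_apply, smul_add,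
      projPerp_apply, hA, hB, hP]
    abel
  rw [ContinuousLinearMap.det, hsame, hform, abs_mul, abs_neg]
  have hFe : inner ℝ e (gradient F g) = F e := by
    rw [hge, hF.gradient_smul (norm_pos_iff.2 hg0), real_inner_comm, hF.inner_gradient_self he0]
  rw [hFe, abs_of_nonneg (hF.nonneg e)]
  exact mul_le_of_le_one_right (hF.nonneg e) hdet

end Distance

/-! ### Measures: orthonormal frames, images and projections -/

section MeasureTools

variable {n : ℕ}

/-- Orthonormal coordinates adapted to a unit vector `e`: a linear isometry `ι` onto the hyperplane
`e^⊥` such that `(z, s) ↦ ι z + s e` preserves the Lebesgue measure. The hyperplane is parametrized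
by a Euclidean space, and not taken as a submodule, because on a subtype `volume` may stand for the
restriction of the ambient measure, which vanishes. -/
theorem exists_frame {e : EuclideanSpace ℝ (Fin (n + 1))} (he : ‖e‖ = 1) :
    ∃ ι : EuclideanSpace ℝ (Fin n) →ₗᵢ[ℝ] EuclideanSpace ℝ (Fin (n + 1)),
      (∀ z, inner ℝ e (ι z) = 0) ∧ (∀ x, inner ℝ e x = 0 → ∃ z, ι z = x) ∧
      MeasurePreserving (fun q : EuclideanSpace ℝ (Fin n) × ℝ => ι q.1 + q.2 • e)
        (volume.prod volume) volume := by
  have he0 : e ≠ 0 := by intro h0; rw [h0] at he; simp at he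
  have : Fact (Module.finrank ℝ (EuclideanSpace ℝ (Fin (n + 1))) = n + 1) := ⟨by simp⟩
  let b := OrthonormalBasis.fromOrthogonalSpanSingleton (𝕜 := ℝ) n he0
  let ι : EuclideanSpace ℝ (Fin n) →ₗᵢ[ℝ] EuclideanSpace ℝ (Fin (n + 1)) :=
    ((Submodule.span ℝ {e})ᗮ).subtypeₗᵢ.comp b.repr.symm.toLinearIsometry
  have hι : ∀ z, inner ℝ e (ι z) = 0 := fun z =>
    (Submodule.mem_orthogonal_singleton_iff_inner_right).1 (b.repr.symm z).2
  refine ⟨ι, hι, fun x hx => ?_, ?_⟩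
  · have hxT : x ∈ (Submodule.span ℝ {e})ᗮ :=
      (Submodule.mem_orthogonal_singleton_iff_inner_right).2 hx
    refine ⟨b.repr ⟨x, hxT⟩, ?_⟩
    change ((b.repr.symm (b.repr ⟨x, hxT⟩) : (Submodule.span ℝ {e})ᗮ) : EuclideanSpace ℝ _) = x
    rw [LinearIsometryEquiv.symm_apply_apply]
  · let J₀ : WithLp 2 (EuclideanSpace ℝ (Fin n) × ℝ) →ₗ[ℝ] EuclideanSpace ℝ (Fin (n + 1)) :=
      { toFun := fun q => ι q.fst + q.snd • e
        map_add' := fun q r => by simp [add_smul]; abel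
        map_smul' := fun c q => by simp [smul_smul] }
    let J : WithLp 2 (EuclideanSpace ℝ (Fin n) × ℝ) →ₗᵢ[ℝ] EuclideanSpace ℝ (Fin (n + 1)) :=
      { J₀ with
        norm_map' := fun q => by
          have h1 : ‖J₀ q‖ ^ 2 = ‖q‖ ^ 2 := by
            rw [WithLp.prod_norm_sq_eq_of_L2]
            change ‖ι q.fst + q.snd • e‖ ^ 2 = _
            rw [← real_inner_self_eq_norm_sq, inner_add_add_self, inner_smul_right,
              real_inner_comm e, real_inner_smul_left, hι]
            simp [norm_smul, he]
          exact (sq_eq_sq₀ (norm_nonneg _) (norm_nonneg _)).1 h1 }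
    let J' := J.toLinearIsometryEquiv (by
      rw [(WithLp.linearEquiv 2 ℝ (EuclideanSpace ℝ (Fin n) × ℝ)).finrank_eq]; simp)
    have h1 := J'.measurePreserving.comp
      (WithLp.volume_preserving_toLp (EuclideanSpace ℝ (Fin n)) ℝ)
    exact h1

theorem measurableSet_inter_preimage_of_continuousOn {α β : Type*} [TopologicalSpace α]
    [MeasurableSpace α] [OpensMeasurableSpace α] [TopologicalSpace β] [MeasurableSpace β]
    [BorelSpace β] {f : α → β} {s : Set α} {t : Set β} (hf : ContinuousOn f s)
    (hs : MeasurableSet s) (ht : MeasurableSet t) : MeasurableSet (s ∩ f ⁻¹' t) := by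
  have h1 : Measurable (s.domRestrict f) :=
    (continuousOn_iff_continuous_domRestrict.1 hf).measurable
  have h2 := hs.subtype_image (h1 ht)
  have h3 : Subtype.val '' (s.domRestrict f ⁻¹' t) = s ∩ f ⁻¹' t := by
    ext x; simp [Set.domRestrict, and_comm]
  rwa [h3] at h2

/-- Change of variables as an inequality, for a map which need not be injective. -/
theorem lintegral_image_le_mul {V : Type*} [NormedAddCommGroup V] [NormedSpace ℝ V]
    [FiniteDimensional ℝ V] [MeasurableSpace V] [BorelSpace V] (μ : Measure V)
    [μ.IsAddHaarMeasure] {ψ : V → V} {ψ' : V → V →L[ℝ] V} {D : Set V} (hD : MeasurableSet D)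
    (hψ : ∀ x ∈ D, HasFDerivWithinAt ψ (ψ' x) D x) {c : ℝ≥0∞}
    (hc : ∀ x ∈ D, ENNReal.ofReal |(ψ' x).det| ≤ c) {f : V → ℝ≥0∞} (hf : Measurable f) :
    ∫⁻ x in ψ '' D, f x ∂μ ≤ c * ∫⁻ x in D, f (ψ x) ∂μ := by
  have hcont : ContinuousOn ψ D := fun x hx => (hψ x hx).continuousWithinAt
  have hm : AEMeasurable ψ (μ.restrict D) := hcont.aemeasurable hD
  have hle : μ.restrict (ψ '' D) ≤ c • (μ.restrict D).map ψ := by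
    refine Measure.le_iff.2 fun B hB => ?_
    have hDB : MeasurableSet (D ∩ ψ ⁻¹' B) :=
      measurableSet_inter_preimage_of_continuousOn hcont hD hB
    rw [Measure.restrict_apply hB, Measure.smul_apply, Measure.map_apply_of_aemeasurable hm hB,
      smul_eq_mul]
    have h1 : B ∩ ψ '' D ⊆ ψ '' (D ∩ ψ ⁻¹' B) := by
      rintro _ ⟨hx, x, hxD, rfl⟩; exact ⟨x, ⟨hxD, hx⟩, rfl⟩
    calc μ (B ∩ ψ '' D) ≤ μ (ψ '' (D ∩ ψ ⁻¹' B)) := measure_mono h1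
      _ ≤ ∫⁻ x in D ∩ ψ ⁻¹' B, ENNReal.ofReal |(ψ' x).det| ∂μ :=
          addHaar_image_le_lintegral_abs_det_fderiv μ hDB
            fun x hx => (hψ x hx.1).mono inter_subset_left
      _ ≤ ∫⁻ _ in D ∩ ψ ⁻¹' B, c ∂μ := setLIntegral_mono' hDB fun x hx => hc x hx.1
      _ = c * μ (D ∩ ψ ⁻¹' B) := by rw [setLIntegral_const]
      _ = c * μ (ψ ⁻¹' B ∩ D) := by rw [inter_comm]
      _ ≤ c * μ.restrict D (ψ ⁻¹' B) := mul_le_mul_right (Measure.le_restrict_apply _ _) c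
  calc ∫⁻ x in ψ '' D, f x ∂μ ≤ ∫⁻ x, f x ∂(c • (μ.restrict D).map ψ) := lintegral_mono' hle le_rfl
    _ = c * ∫⁻ x in D, f (ψ x) ∂μ := by
      rw [lintegral_smul_measure, lintegral_map' hf.aemeasurable hm, smul_eq_mul]

theorem euclideanHausdorffMeasure_image_le {α β : Type*} [MetricSpace α] [MeasurableSpace α]
    [BorelSpace α] [MetricSpace β] [MeasurableSpace β] [BorelSpace β] {K : ℝ≥0} {f : α → β}
    {s : Set α} (hf : LipschitzOnWith K f s) (d : ℕ) :
    Measure.euclideanHausdorffMeasure d (f '' s) ≤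
      (K : ℝ≥0∞) ^ (d : ℝ) * Measure.euclideanHausdorffMeasure d s := by
  simp only [Measure.euclideanHausdorffMeasure_def, Measure.smul_apply]
  have h1 := hf.hausdorffMeasure_image_le (d := (d : ℝ)) (Nat.cast_nonneg d)
  rw [ENNReal.smul_def, ENNReal.smul_def, smul_eq_mul, smul_eq_mul, mul_left_comm]
  gcongr

theorem norm_projPerp_le {N : ℕ} {e : EuclideanSpace ℝ (Fin N)} (he : ‖e‖ = 1)
    (x : EuclideanSpace ℝ (Fin N)) : ‖projPerp e x‖ ≤ ‖x‖ := by
  have h1 : ‖x‖ ^ 2 = ‖projPerp e x‖ ^ 2 + inner ℝ e x ^ 2 := by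
    have hx : x = projPerp e x + inner ℝ e x • e := by rw [projPerp_apply]; abel
    nth_rewrite 1 [hx]
    rw [← real_inner_self_eq_norm_sq, inner_add_add_self, inner_smul_right, real_inner_smul_left,
      real_inner_comm e, inner_projPerp he]
    rw [real_inner_self_eq_norm_sq, inner_smul_right, real_inner_smul_left,
      real_inner_self_eq_norm_sq, he]
    ring
  exact le_of_sq_le_sq (by nlinarith [sq_nonneg (inner ℝ e x : ℝ)]) (norm_nonneg _)
where
  le_of_sq_le_sq {a b : ℝ} (h : a ^ 2 ≤ b ^ 2) (hb : 0 ≤ b) : a ≤ b := by nlinarith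

theorem lipschitzWith_projPerp {N : ℕ} {e : EuclideanSpace ℝ (Fin N)} (he : ‖e‖ = 1) :
    LipschitzWith 1 (projPerp e) :=
  LipschitzWith.of_dist_le_mul fun x y => by
    rw [dist_eq_norm, dist_eq_norm, ← map_sub, NNReal.coe_one, one_mul]
    exact norm_projPerp_le he _

/-- The orthogonal projection onto a hyperplane does not increase the surface measure. -/
theorem volume_le_euclideanHausdorffMeasure {e : EuclideanSpace ℝ (Fin (n + 1))} (he : ‖e‖ = 1)
    (ι : EuclideanSpace ℝ (Fin n) →ₗᵢ[ℝ] EuclideanSpace ℝ (Fin (n + 1)))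
    {B : Set (EuclideanSpace ℝ (Fin n))} {A : Set (EuclideanSpace ℝ (Fin (n + 1)))}
    (h : ∀ z ∈ B, ∃ y ∈ A, projPerp e y = ι z) :
    volume B ≤ Measure.euclideanHausdorffMeasure n A := by
  rw [← EuclideanSpace.euclideanHausdorffMeasure_eq_volume,
    ← ι.isometry.euclideanHausdorffMeasure_image]
  have h1 : ι '' B ⊆ projPerp e '' A := by
    rintro _ ⟨z, hz, rfl⟩
    obtain ⟨y, hy, hyz⟩ := h z hz
    exact ⟨y, hy, hyz⟩
  refine (measure_mono h1).trans ?_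
  simpa using euclideanHausdorffMeasure_image_le
    ((lipschitzWith_projPerp he).lipschitzOnWith (s := A)) n

/-- The surface measure of the boundary of a `C²` set is locally finite. -/
theorem isLocallyFiniteMeasure_surfaceMeasure {Ω : Set (EuclideanSpace ℝ (Fin (n + 1)))}
    (hΩ : ∀ y ∈ frontier Ω, ∃ U ρ, IsC2DefiningFunction Ω y U ρ) :
    IsLocallyFiniteMeasure (surfaceMeasure Ω) := by
  refine ⟨fun y => ?_⟩
  by_cases hy : y ∈ frontier Ω
  · obtain ⟨U, ρ, h⟩ := hΩ y hy
    obtain ⟨Θ, W, O, hWo, hOo, hyO, -, hyW, hΘC, hΘy, -, -, -, hO⟩ := h.exists_chart hy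
    set e := outerNormal Ω y with he
    have he1 : ‖e‖ = 1 := h.norm_outerNormal hy
    obtain ⟨ι, hι, hιs, -⟩ := exists_frame he1
    obtain ⟨K, t, ht, hK⟩ := (hΘC.contDiffAt (hWo.mem_nhds hyW)).exists_lipschitzOnWith
    obtain ⟨r, hr, hrt⟩ := Metric.mem_nhds_iff.1 ht
    have hnb : O ∩ projPerp e ⁻¹' Metric.ball (projPerp e y) r ∈ 𝓝 y :=
      (hOo.inter (Metric.isOpen_ball.preimage (projPerp e).continuous)).mem_nhds
        ⟨hyO, by rw [mem_preimage]; exact Metric.mem_ball_self hr⟩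
    refine ⟨O ∩ projPerp e ⁻¹' Metric.ball (projPerp e y) r, hnb, ?_⟩
    rw [surfaceMeasure, Measure.restrict_apply' isClosed_frontier.measurableSet]
    set B : Set (EuclideanSpace ℝ (Fin n)) := ι ⁻¹' Metric.ball (projPerp e y) r with hB
    have hsub : O ∩ projPerp e ⁻¹' Metric.ball (projPerp e y) r ∩ frontier Ω ⊆
        (fun z => Θ (ι z)) '' B := by
      rintro x ⟨⟨hxO, hxr⟩, hxf⟩
      obtain ⟨z, hz⟩ := hιs (projPerp e x) (inner_projPerp he1 x)
      refine ⟨z, ?_, ?_⟩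
      · rw [hB, mem_preimage, hz]; exact hxr
      · simp only [hz]; exact (hO x hxO hxf).2
    refine (measure_mono hsub).trans_lt ?_
    have hL : LipschitzOnWith (K * 1) (Θ ∘ ι) B :=
      (hK.mono hrt).comp ι.lipschitz.lipschitzOnWith fun z hz => hz
    refine (euclideanHausdorffMeasure_image_le hL n).trans_lt ?_
    rw [EuclideanSpace.euclideanHausdorffMeasure_eq_volume]
    refine ENNReal.mul_lt_top (ENNReal.rpow_lt_top_of_nonneg (Nat.cast_nonneg n)
      ENNReal.coe_ne_top) ?_
    have hbd : Bornology.IsBounded B := by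
      obtain ⟨z₀, hz₀⟩ := hιs (projPerp e y) (inner_projPerp he1 y)
      refine (Metric.isBounded_ball (x := z₀) (r := r)).subset fun z hz => ?_
      rw [hB, mem_preimage, ← hz₀, Metric.mem_ball, ι.dist_map] at hz
      exact hz
    exact hbd.measure_lt_top
  · refine ⟨(frontier Ω)ᶜ, isClosed_frontier.isOpen_compl.mem_nhds hy, ?_⟩
    rw [surfaceMeasure, Measure.restrict_apply' isClosed_frontier.measurableSet, compl_inter_self,
      measure_empty]
    exact ENNReal.zero_lt_top

end MeasureTools

/-! ### The volume of inner parallel sets of mean convex domains -/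

section Tube

variable {n : ℕ} {p : ℝ} {F : EuclideanSpace ℝ (Fin (n + 1)) → ℝ}
  {Ω U : Set (EuclideanSpace ℝ (Fin (n + 1)))} {ρ : EuclideanSpace ℝ (Fin (n + 1)) → ℝ}

/-- Normal coordinates near a boundary point with outer normal `e`: the point with boundary
parameter `P w` is pushed inside along the anisotropic normal up to the distance `⟨e, w⟩`. -/
def normalMap (F ρ : EuclideanSpace ℝ (Fin (n + 1)) → ℝ)
    (Θ : EuclideanSpace ℝ (Fin (n + 1)) → EuclideanSpace ℝ (Fin (n + 1)))
    (e w : EuclideanSpace ℝ (Fin (n + 1))) : EuclideanSpace ℝ (Fin (n + 1)) :=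
  Θ (projPerp e w) - inner ℝ e w • gradient F (gradient ρ (Θ (projPerp e w)))

theorem contDiffOn_normalMap {y : EuclideanSpace ℝ (Fin (n + 1))} (hF : IsFinslerNorm p F)
    (h : IsC2DefiningFunction Ω y U ρ)
    {Θ : EuclideanSpace ℝ (Fin (n + 1)) → EuclideanSpace ℝ (Fin (n + 1))}
    {W : Set (EuclideanSpace ℝ (Fin (n + 1)))} (hΘ : ContDiffOn ℝ 1 Θ W) (hΘU : ∀ w ∈ W, Θ w ∈ U)
    (e : EuclideanSpace ℝ (Fin (n + 1))) :
    ContDiffOn ℝ 1 (normalMap F ρ Θ e) (projPerp e ⁻¹' W) := by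
  have h1 : ContDiffOn ℝ 1 (fun w => Θ (projPerp e w)) (projPerp e ⁻¹' W) :=
    hΘ.comp (projPerp e).contDiff.contDiffOn (mapsTo_preimage _ _)
  have h2 : ContDiffOn ℝ 1 (fun w => gradient ρ (Θ (projPerp e w))) (projPerp e ⁻¹' W) :=
    h.contDiffOn_gradient.comp h1 fun w hw => hΘU _ hw
  have h3 : ContDiffOn ℝ 1 (fun w => gradient F (gradient ρ (Θ (projPerp e w))))
      (projPerp e ⁻¹' W) :=
    (hF.contDiffOn_gradient.of_le (by norm_num)).comp h2
      fun w hw => h.gradient_ne_zero _ (hΘU _ hw)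
  have h4 : ContDiffOn ℝ 1 (fun w => inner ℝ e w) (projPerp e ⁻¹' W) :=
    (innerSL ℝ e).contDiff.contDiffOn
  exact h1.sub (h4.smul h3)

theorem hasFDerivAt_normalMap {y : EuclideanSpace ℝ (Fin (n + 1))} (hF : IsFinslerNorm p F)
    (h : IsC2DefiningFunction Ω y U ρ)
    {Θ : EuclideanSpace ℝ (Fin (n + 1)) → EuclideanSpace ℝ (Fin (n + 1))}
    {e w : EuclideanSpace ℝ (Fin (n + 1))} (hΘw : Θ (projPerp e w) = y)
    (hΘ : HasFDerivAt Θ (ContinuousLinearMap.id ℝ _) (projPerp e w)) :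
    HasFDerivAt (normalMap F ρ Θ e)
      (projPerp e - (inner ℝ e w : ℝ) •
        (fderiv ℝ (gradient F) (gradient ρ y) ∘L fderiv ℝ (gradient ρ) y ∘L projPerp e) -
        (innerSL ℝ e).smulRight (gradient F (gradient ρ y))) w := by
  have h1 : HasFDerivAt (fun w => Θ (projPerp e w)) (projPerp e) w := by
    exact hΘ.comp w (projPerp e).hasFDerivAt
  have h2 : HasFDerivAt (fun w => gradient ρ (Θ (projPerp e w)))
      (fderiv ℝ (gradient ρ) y ∘L projPerp e) w := by
    have h3 := h.hasFDerivAt_gradient h.mem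
    rw [← hΘw] at h3
    have := h3.comp w h1
    rwa [hΘw] at this
  have h4 : HasFDerivAt (fun w => gradient F (gradient ρ (Θ (projPerp e w))))
      (fderiv ℝ (gradient F) (gradient ρ y) ∘L (fderiv ℝ (gradient ρ) y ∘L projPerp e)) w := by
    have h3 := hF.hasFDerivAt_gradient (h.gradient_ne_zero y h.mem)
    rw [← hΘw] at h3
    have := h3.comp w h2
    rwa [hΘw] at this
  have h5 : HasFDerivAt (fun w => (inner ℝ e w : ℝ)) (innerSL ℝ e) w := (innerSL ℝ e).hasFDerivAt
  refine (h1.sub (h5.smul h4)).congr_fderiv ?_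
  rw [hΘw, sub_sub]

/-- Near a boundary point with nonnegative mean curvature the Jacobian of the normal coordinates is
at most `F (ν y) + ε` at all parameters for which the boundary point is a foot point. The set of
these parameters is closed, so the bound at the centre extends to a neighbourhood by compactness. -/
theorem exists_nhds_det_normalMap_le {y : EuclideanSpace ℝ (Fin (n + 1))} (hF : IsFinslerNorm p F)
    (hy : y ∈ frontier Ω) (h : IsC2DefiningFunction Ω y U ρ)
    (hcurv : 0 ≤ anisotropicMeanCurvature F Ω y)
    {Θ : EuclideanSpace ℝ (Fin (n + 1)) → EuclideanSpace ℝ (Fin (n + 1))}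
    {W : Set (EuclideanSpace ℝ (Fin (n + 1)))} (hWo : IsOpen W)
    (hyW : projPerp (outerNormal Ω y) y ∈ W) (hΘC : ContDiffOn ℝ 1 Θ W)
    (hΘy : Θ (projPerp (outerNormal Ω y) y) = y)
    (hΘd : HasFDerivAt Θ (ContinuousLinearMap.id ℝ _) (projPerp (outerNormal Ω y) y))
    (hΘU : ∀ w ∈ W, Θ w ∈ U) (R : ℝ) {ε : ℝ} (hε : 0 < ε) :
    ∃ W' ⊆ W, IsOpen W' ∧ projPerp (outerNormal Ω y) y ∈ W' ∧
      ∀ w, projPerp (outerNormal Ω y) w ∈ W' → inner ℝ (outerNormal Ω y) w ∈ Icc 0 R →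
        distBoundary F Ω (normalMap F ρ Θ (outerNormal Ω y) w) = inner ℝ (outerNormal Ω y) w →
        normalMap F ρ Θ (outerNormal Ω y) w ∈ closure Ω →
        |(fderiv ℝ (normalMap F ρ Θ (outerNormal Ω y)) w).det| ≤ F (outerNormal Ω y) + ε := by
  set e := outerNormal Ω y with he
  have he1 : ‖e‖ = 1 := h.norm_outerNormal hy
  have hne : (frontier Ω).Nonempty := ⟨y, hy⟩
  set Ψ := normalMap F ρ Θ e with hΨ
  have hopen : IsOpen (projPerp e ⁻¹' W) := hWo.preimage (projPerp e).continuous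
  have hΨC : ContDiffOn ℝ 1 Ψ (projPerp e ⁻¹' W) := contDiffOn_normalMap hF h hΘC hΘU e
  have hPs : ∀ (x : EuclideanSpace ℝ (Fin (n + 1))) (s : ℝ),
      projPerp e (x + s • e) = projPerp e x := fun x s => by
    rw [map_add, map_smul, projPerp_self he1, smul_zero, add_zero]
  have hPP : projPerp e (projPerp e y) = projPerp e y :=
    projPerp_of_inner_eq_zero (inner_projPerp he1 y)
  have hes : ∀ s : ℝ, inner ℝ e (projPerp e y + s • e) = s := fun s => by
    rw [inner_add_right, inner_projPerp he1, inner_smul_right, real_inner_self_eq_norm_sq, he1]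
    ring
  have hpt : ∀ s ∈ Icc 0 R, ∀ᶠ w in 𝓝 (projPerp e y + s • e),
      distBoundary F Ω (Ψ w) = inner ℝ e w → Ψ w ∈ closure Ω →
        |(fderiv ℝ Ψ w).det| ≤ F e + ε := by
    intro s hs
    have hmem : projPerp e y + s • e ∈ projPerp e ⁻¹' W := by
      rw [mem_preimage, hPs, hPP]; exact hyW
    have hΨc : ContinuousAt Ψ (projPerp e y + s • e) :=
      hΨC.continuousOn.continuousAt (hopen.mem_nhds hmem)
    by_cases hgood : distBoundary F Ω (Ψ (projPerp e y + s • e)) = s ∧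
        Ψ (projPerp e y + s • e) ∈ closure Ω
    · have hfc : ContinuousAt (fun w => |(fderiv ℝ Ψ w).det|) (projPerp e y + s • e) := by
        have h1 : ContinuousAt (fderiv ℝ Ψ) (projPerp e y + s • e) :=
          (hΨC.continuousOn_fderiv_of_isOpen hopen le_rfl).continuousAt (hopen.mem_nhds hmem)
        exact (ContinuousLinearMap.continuous_det.continuousAt.comp h1).abs
      have hval : |(fderiv ℝ Ψ (projPerp e y + s • e)).det| ≤ F e := by
        have hd := hasFDerivAt_normalMap hF h (Θ := Θ) (e := e) (w := projPerp e y + s • e)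
          (by rw [hPs, hPP, hΘy]) (by rw [hPs, hPP]; exact hΘd)
        rw [hd.fderiv, hes]
        refine abs_det_normal_map_le hF hy h hcurv hs.1 fun hs0 ξ hξ => ?_
        have hx : Ψ (projPerp e y + s • e) = y - s • gradient F (gradient ρ y) := by
          rw [hΨ, normalMap, hPs, hPP, hΘy, hes]
        have hxΩ : Ψ (projPerp e y + s • e) ∈ Ω := by
          have h2 := hgood.2
          rw [closure_eq_self_union_frontier] at h2
          refine h2.resolve_right fun hf => ?_
          rw [hF.distBoundary_eq_zero hf] at hgood
          exact hs0.ne hgood.1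
        have h3 := hF.add_smul_mem_closure hxΩ (hF.polar_gradient hξ).le
        rwa [hgood.1, hx] at h3
      have hlt := hfc.eventually (gt_mem_nhds (show _ < F e + ε by linarith))
      exact hlt.mono fun w hw _ _ => hw.le
    -- Where the conditions fail at the centre, they fail nearby, and there is nothing to bound.
    · rw [not_and_or] at hgood
      rcases hgood with hbad | hbad
      · have hcd : ContinuousAt (fun w => distBoundary F Ω (Ψ w) - inner ℝ e w)
            (projPerp e y + s • e) :=
          ((hF.continuous_distBoundary hne).continuousAt.comp hΨc).sub
            (innerSL ℝ e).continuous.continuousAt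
        have hne0 := hcd.eventually_ne (y := 0) (by rw [hes]; exact sub_ne_zero.2 hbad)
        exact hne0.mono fun w hw h1 => absurd (sub_eq_zero.2 h1) hw
      · have hev := hΨc.eventually (isClosed_closure.isOpen_compl.mem_nhds hbad)
        exact hev.mono fun w hw _ h1 => absurd h1 hw
  have hunif : ∀ᶠ z in 𝓝 (projPerp e y), ∀ s ∈ Icc 0 R,
      distBoundary F Ω (Ψ (z + s • e)) = inner ℝ e (z + s • e) → Ψ (z + s • e) ∈ closure Ω →
        |(fderiv ℝ Ψ (z + s • e)).det| ≤ F e + ε := by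
    refine isCompact_Icc.eventually_forall_of_forall_eventually fun s hs => ?_
    have hc : Continuous fun q : EuclideanSpace ℝ (Fin (n + 1)) × ℝ => q.1 + q.2 • e := by fun_prop
    exact (hc.tendsto (projPerp e y, s)).eventually (hpt s hs)
  obtain ⟨W', hW', hW'o, hyW'⟩ := mem_nhds_iff.1 (hunif.and (hWo.mem_nhds hyW))
  refine ⟨W', fun z hz => (hW' hz).2, hW'o, hyW', fun w hw hwR h1 h2 => ?_⟩
  have hw' : projPerp e w + (inner ℝ e w : ℝ) • e = w := by rw [projPerp_apply]; abel
  have := (hW' hw).1 (inner ℝ e w) hwR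
  rw [hw'] at this
  exact this h1 h2

/-- The local form of the volume comparison: the points of `Ω` with a foot point in a small piece
`A` of the boundary. -/
theorem exists_nhds_lintegral_foot_le {y : EuclideanSpace ℝ (Fin (n + 1))}
    (hF : IsFinslerNorm p F) (hΩ : IsOpen Ω) (hy : y ∈ frontier Ω)
    (h : IsC2DefiningFunction Ω y U ρ) (hcurv : 0 ≤ anisotropicMeanCurvature F Ω y) {R : ℝ}
    (hR : ∀ x ∈ Ω, distBoundary F Ω x ≤ R) {ε : ℝ} (hε : 0 < ε) :
    ∃ O, IsOpen O ∧ y ∈ O ∧ ∀ A ⊆ O ∩ frontier Ω, MeasurableSet A →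
      ∀ f : ℝ → ℝ≥0∞, Measurable f →
      ∫⁻ x in {x | x ∈ Ω ∧ ∃ z ∈ A, distBoundary F Ω x = polar F (x - z)}, f (distBoundary F Ω x) ≤
        ENNReal.ofReal (F (outerNormal Ω y) + ε) *
          ((∫⁻ s in Icc 0 R, f s) * Measure.euclideanHausdorffMeasure n A) := by
  have hne : (frontier Ω).Nonempty := ⟨y, hy⟩
  obtain ⟨Θ, W, O, hWo, hOo, hyO, hOU, hyW, hΘC, hΘy, hΘd, hΘU, hΘf, hO⟩ := h.exists_chart hy
  obtain ⟨W', hW'W, hW'o, hyW', hdet⟩ :=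
    exists_nhds_det_normalMap_le hF hy h hcurv hWo hyW hΘC hΘy hΘd hΘU R hε
  set e := outerNormal Ω y with he
  have he1 : ‖e‖ = 1 := h.norm_outerNormal hy
  set Ψ := normalMap F ρ Θ e with hΨ
  have hopen : IsOpen (projPerp e ⁻¹' W') := hW'o.preimage (projPerp e).continuous
  have hΨC : ContDiffOn ℝ 1 Ψ (projPerp e ⁻¹' W') :=
    (contDiffOn_normalMap hF h hΘC hΘU e).mono (preimage_mono hW'W)
  refine ⟨O ∩ projPerp e ⁻¹' W', hOo.inter hopen, ⟨hyO, hyW'⟩, fun A hA hAm f hf => ?_⟩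
  obtain ⟨ι, hι, hιs, hmp⟩ := exists_frame he1
  have hdc := hF.continuous_distBoundary hne
  -- The parameters over `A` at which the point of the normal line is as far from the boundary as
  -- its parameter says.
  set D : Set (EuclideanSpace ℝ (Fin (n + 1))) :=
    ((projPerp e ⁻¹' W' ∩ (fun w => Θ (projPerp e w)) ⁻¹' A) ∩
    (projPerp e ⁻¹' W' ∩ (fun w => distBoundary F Ω (Ψ w) - inner ℝ e w) ⁻¹' {0})) ∩
    ((projPerp e ⁻¹' W' ∩ Ψ ⁻¹' closure Ω) ∩ (fun w => (inner ℝ e w : ℝ)) ⁻¹' Icc 0 R) with hD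
  have hic : Continuous fun w => (inner ℝ e w : ℝ) := (innerSL ℝ e).continuous
  have hDm : MeasurableSet D := by
    refine ((measurableSet_inter_preimage_of_continuousOn ?_ hopen.measurableSet hAm).inter
      (measurableSet_inter_preimage_of_continuousOn ?_ hopen.measurableSet
        (measurableSet_singleton _))).inter
      ((measurableSet_inter_preimage_of_continuousOn hΨC.continuousOn hopen.measurableSet
        isClosed_closure.measurableSet).inter (hic.measurable measurableSet_Icc))
    · exact (hΘC.continuousOn.mono hW'W).comp (projPerp e).continuous.continuousOn
        (mapsTo_preimage _ _)
    · exact (hdc.comp_continuousOn hΨC.continuousOn).sub hic.continuousOn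
  have hDd : ∀ w ∈ D, distBoundary F Ω (Ψ w) = inner ℝ e w := fun w hw =>
    sub_eq_zero.1 hw.1.2.2
  have hsub : {x | x ∈ Ω ∧ ∃ z ∈ A, distBoundary F Ω x = polar F (x - z)} ⊆ Ψ '' D := by
    rintro x ⟨hx, z, hz, hxz⟩
    obtain ⟨⟨hzO, hzW'⟩, hzf⟩ := hA hz
    have hxne : x ≠ z := by
      rintro rfl
      rw [hΩ.frontier_eq] at hzf
      exact hzf.2 hx
    have hfoot := hF.eq_sub_of_foot hx hzf hxz hxne (h.of_mem (hOU hzO))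
    set s := distBoundary F Ω x with hs
    have hPw : projPerp e (projPerp e z + s • e) = projPerp e z := by
      rw [map_add, map_smul, projPerp_self he1, smul_zero, add_zero,
        projPerp_of_inner_eq_zero (inner_projPerp he1 z)]
    have hes : inner ℝ e (projPerp e z + s • e) = s := by
      rw [inner_add_right, inner_projPerp he1, inner_smul_right, real_inner_self_eq_norm_sq, he1]
      ring
    have hΨw : Ψ (projPerp e z + s • e) = x := by
      rw [hΨ, normalMap, hPw, hes, (hO z hzO hzf).2]
      exact hfoot.symm
    have hW'' : projPerp e z + s • e ∈ projPerp e ⁻¹' W' := by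
      rw [mem_preimage, hPw]; exact hzW'
    refine ⟨projPerp e z + s • e, ⟨⟨⟨hW'', ?_⟩, ⟨hW'', ?_⟩⟩, ⟨⟨hW'', ?_⟩, ?_⟩⟩, hΨw⟩
    · rw [mem_preimage, hPw, (hO z hzO hzf).2]; exact hz
    · rw [mem_preimage, hΨw, hes, mem_singleton_iff, ← hs, sub_self]
    · rw [mem_preimage, hΨw]; exact subset_closure hx
    · rw [mem_preimage, hes]; exact ⟨hF.distBoundary_nonneg x, hR x hx⟩
  set c := ENNReal.ofReal (F e + ε) with hc
  have himage := lintegral_image_le_mul volume hDm (ψ := Ψ) (ψ' := fderiv ℝ Ψ)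
    (fun w hw => ((hΨC.contDiffAt (hopen.mem_nhds hw.1.1.1)).differentiableAt
      (by norm_num)).hasFDerivAt.hasFDerivWithinAt)
    (c := c) (fun w hw => ENNReal.ofReal_le_ofReal
      (hdet w hw.1.1.1 hw.2.2 (hDd w hw) hw.2.1.2))
    (f := fun x => f (distBoundary F Ω x)) (hf.comp hdc.measurable)
  set B : Set (EuclideanSpace ℝ (Fin n)) := ι ⁻¹' W' ∩ (fun z => Θ (ι z)) ⁻¹' A with hB
  have hBm : MeasurableSet B :=
    measurableSet_inter_preimage_of_continuousOn
      ((hΘC.continuousOn.mono hW'W).comp ι.continuous.continuousOn (mapsTo_preimage _ _))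
      (hW'o.preimage ι.continuous).measurableSet hAm
  have hcoord : ∀ q : EuclideanSpace ℝ (Fin n) × ℝ,
      projPerp e (ι q.1 + q.2 • e) = ι q.1 ∧ inner ℝ e (ι q.1 + q.2 • e) = q.2 := fun q => by
    constructor
    · rw [map_add, map_smul, projPerp_self he1, smul_zero, add_zero,
        projPerp_of_inner_eq_zero (hι _)]
    · rw [inner_add_right, hι, inner_smul_right, real_inner_self_eq_norm_sq, he1]; ring
  have hfub : ∫⁻ w in D, f (inner ℝ e w) ≤ volume B * ∫⁻ s in Icc 0 R, f s := by
    have hgm : Measurable (D.indicator fun w => f (inner ℝ e w)) :=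
      (hf.comp hic.measurable).indicator hDm
    rw [← lintegral_indicator hDm, ← hmp.lintegral_comp hgm]
    calc ∫⁻ q : EuclideanSpace ℝ (Fin n) × ℝ, D.indicator (fun w => f (inner ℝ e w))
            (ι q.1 + q.2 • e) ∂(volume.prod volume)
        ≤ ∫⁻ q : EuclideanSpace ℝ (Fin n) × ℝ, B.indicator 1 q.1 * (Icc 0 R).indicator f q.2
            ∂(volume.prod volume) := by
          refine lintegral_mono fun q => ?_
          by_cases hq : ι q.1 + q.2 • e ∈ D
          · rw [indicator_of_mem hq]
            have h1 : q.1 ∈ B := by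
              have h2 := hq.1.1.1
              have h3 := hq.1.1.2
              rw [mem_preimage, (hcoord q).1] at h2 h3
              exact ⟨h2, h3⟩
            have h2 : q.2 ∈ Icc 0 R := by
              have h3 := hq.2.2
              rwa [mem_preimage, (hcoord q).2] at h3
            simp only [indicator_of_mem h1, indicator_of_mem h2, (hcoord q).2, Pi.one_apply,
              one_mul, le_refl]
          · rw [indicator_of_notMem hq]; exact zero_le
      _ = (∫⁻ z, B.indicator 1 z) * ∫⁻ s, (Icc 0 R).indicator f s :=
          lintegral_prod_mul ((measurable_one.indicator hBm).aemeasurable)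
            ((hf.indicator measurableSet_Icc).aemeasurable)
      _ = volume B * ∫⁻ s in Icc 0 R, f s := by
          rw [lintegral_indicator_one hBm, lintegral_indicator measurableSet_Icc]
  have hBA : volume B ≤ Measure.euclideanHausdorffMeasure n A := by
    refine volume_le_euclideanHausdorffMeasure he1 ι fun z hz => ⟨Θ (ι z), hz.2, ?_⟩
    exact (hΘf _ (hW'W hz.1) (hι z)).2
  calc ∫⁻ x in {x | x ∈ Ω ∧ ∃ z ∈ A, distBoundary F Ω x = polar F (x - z)},
        f (distBoundary F Ω x)
      ≤ ∫⁻ x in Ψ '' D, f (distBoundary F Ω x) := lintegral_mono_set hsub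
    _ ≤ c * ∫⁻ w in D, f (distBoundary F Ω (Ψ w)) := himage
    _ = c * ∫⁻ w in D, f (inner ℝ e w) := by
        rw [setLIntegral_congr_fun (g := fun w => f (inner ℝ e w)) hDm
          fun w hw => by simp only [hDd w hw]]
    _ ≤ c * (Measure.euclideanHausdorffMeasure n A * ∫⁻ s in Icc 0 R, f s) := by
        gcongr
        exact hfub.trans (by gcongr)
    _ = _ := by rw [mul_comm (Measure.euclideanHausdorffMeasure n A)]

theorem exists_nhds_abs_map_outerNormal_sub_lt {y : EuclideanSpace ℝ (Fin (n + 1))}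
    (hF : IsFinslerNorm p F) (hy : y ∈ frontier Ω) (h : IsC2DefiningFunction Ω y U ρ) {ε : ℝ}
    (hε : 0 < ε) : ∃ O, IsOpen O ∧ y ∈ O ∧
      ∀ x ∈ O ∩ frontier Ω, |F (outerNormal Ω x) - F (outerNormal Ω y)| < ε := by
  have h1 : ContinuousAt (fun x => F (‖gradient ρ x‖⁻¹ • gradient ρ x)) y := by
    have h2 := (h.hasFDerivAt_gradient h.mem).continuousAt
    exact hF.continuous.continuousAt.comp ((h2.norm.inv₀
      (norm_ne_zero_iff.2 (h.gradient_ne_zero y h.mem))).smul h2)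
  have h2 := (Metric.tendsto_nhds.1 h1 ε hε).and (h.isOpen.mem_nhds h.mem)
  obtain ⟨O, hO, hOo, hyO⟩ := mem_nhds_iff.1 h2
  refine ⟨O, hOo, hyO, fun x hx => ?_⟩
  have h3 := hO hx.1
  rw [(h.of_mem h3.2).outerNormal_eq hx.2, h.outerNormal_eq hy]
  exact h3.1

/-- The volume comparison: in a bounded domain with nonnegative anisotropic mean curvature, the
integral of a function of the distance to the boundary is at most that on a cylinder over the
boundary, weighted by `F (ν)`. -/
theorem lintegral_distBoundary_le (hF : IsFinslerNorm p F) (hΩ : IsC2Domain Ω)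
    (hb : Bornology.IsBounded Ω) (hcurv : ∀ y ∈ frontier Ω, 0 ≤ anisotropicMeanCurvature F Ω y)
    {R : ℝ} (hR : ∀ x ∈ Ω, distBoundary F Ω x ≤ R) {f : ℝ → ℝ≥0∞} (hf : Measurable f)
    (hfR : ∫⁻ s in Icc 0 R, f s ≠ ⊤) (hne : (frontier Ω).Nonempty) :
    ∫⁻ x in Ω, f (distBoundary F Ω x) ≤
      (∫⁻ s in Icc 0 R, f s) *
        ∫⁻ y, ENNReal.ofReal (F (outerNormal Ω y)) ∂(surfaceMeasure Ω) := by
  have hcomp : IsCompact (frontier Ω) :=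
    Metric.isCompact_of_isClosed_isBounded isClosed_frontier
      (hb.closure.subset frontier_subset_closure)
  set I := ∫⁻ s in Icc 0 R, f s with hI
  have hfin := isLocallyFiniteMeasure_surfaceMeasure hΩ.boundary
  have hS : surfaceMeasure Ω univ ≠ ⊤ := by
    have h1 : surfaceMeasure Ω univ = surfaceMeasure Ω (frontier Ω) := by
      rw [surfaceMeasure, Measure.restrict_apply_univ, Measure.restrict_apply_self]
    rw [h1]
    exact hcomp.measure_lt_top.ne
  have key : ∀ ε : ℝ, 0 < ε → ∫⁻ x in Ω, f (distBoundary F Ω x) ≤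
      I * (∫⁻ y, ENNReal.ofReal (F (outerNormal Ω y)) ∂(surfaceMeasure Ω) +
        ENNReal.ofReal (2 * ε) * surfaceMeasure Ω univ) := by
    intro ε hε
    -- The local estimate holds over small pieces of the boundary; by compactness it holds over all
    -- of it, as both sides are subadditive and additive, respectively, in the piece `A`.
    obtain ⟨t, htm, hts, ht⟩ : ∃ t, MeasurableSet t ∧ frontier Ω ⊆ t ∧
        ∀ A ⊆ t ∩ frontier Ω, MeasurableSet A →
        ∫⁻ x in {x | x ∈ Ω ∧ ∃ z ∈ A, distBoundary F Ω x = polar F (x - z)},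
          f (distBoundary F Ω x) ≤
          I * ∫⁻ y in A, (ENNReal.ofReal (F (outerNormal Ω y)) + ENNReal.ofReal (2 * ε))
            ∂(Measure.euclideanHausdorffMeasure n) := by
      refine hcomp.induction_on (p := fun s => ∃ t, MeasurableSet t ∧ s ⊆ t ∧
        ∀ A ⊆ t ∩ frontier Ω, MeasurableSet A →
        ∫⁻ x in {x | x ∈ Ω ∧ ∃ z ∈ A, distBoundary F Ω x = polar F (x - z)},
          f (distBoundary F Ω x) ≤
          I * ∫⁻ y in A, (ENNReal.ofReal (F (outerNormal Ω y)) + ENNReal.ofReal (2 * ε))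
            ∂(Measure.euclideanHausdorffMeasure n)) ?_ ?_ ?_ ?_
      · refine ⟨∅, MeasurableSet.empty, Subset.rfl, fun A hA _ => ?_⟩
        rw [empty_inter, subset_empty_iff] at hA
        simp [hA]
      · rintro s s' hss' ⟨t, htm, hts, ht⟩
        exact ⟨t, htm, hss'.trans hts, ht⟩
      · rintro s s' ⟨t, htm, hts, ht⟩ ⟨t', htm', hts', ht'⟩
        refine ⟨t ∪ t', htm.union htm', union_subset_union hts hts', fun A hA hAm => ?_⟩
        have h1 := ht (A ∩ t) (fun x hx => ⟨hx.2, (hA hx.1).2⟩) (hAm.inter htm)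
        have h2 := ht' (A \ t) (fun x hx => ⟨(hA hx.1).1.resolve_left hx.2, (hA hx.1).2⟩)
          (hAm.diff htm)
        have hcover : {x | x ∈ Ω ∧ ∃ z ∈ A, distBoundary F Ω x = polar F (x - z)} ⊆
            {x | x ∈ Ω ∧ ∃ z ∈ A ∩ t, distBoundary F Ω x = polar F (x - z)} ∪
            {x | x ∈ Ω ∧ ∃ z ∈ A \ t, distBoundary F Ω x = polar F (x - z)} := by
          rintro x ⟨hx, z, hz, hxz⟩
          by_cases hzt : z ∈ t
          · exact Or.inl ⟨hx, z, ⟨hz, hzt⟩, hxz⟩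
          · exact Or.inr ⟨hx, z, ⟨hz, hzt⟩, hxz⟩
        refine (lintegral_mono_set hcover).trans ((lintegral_union_le _ _ _).trans ?_)
        refine (add_le_add h1 h2).trans ?_
        rw [← mul_add, ← lintegral_union (hAm.diff htm)
          (disjoint_sdiff_right.mono_left inter_subset_right), inter_union_sdiff]
      · intro y hy
        obtain ⟨U, ρ, h⟩ := hΩ.boundary y hy
        obtain ⟨O₁, hO₁o, hyO₁, hO₁⟩ :=
          exists_nhds_lintegral_foot_le hF hΩ.isOpen hy h (hcurv y hy) hR hε
        obtain ⟨O₂, hO₂o, hyO₂, hO₂⟩ := exists_nhds_abs_map_outerNormal_sub_lt hF hy h hε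
        refine ⟨O₁ ∩ O₂, mem_nhdsWithin_of_mem_nhds ((hO₁o.inter hO₂o).mem_nhds ⟨hyO₁, hyO₂⟩),
          O₁ ∩ O₂, (hO₁o.inter hO₂o).measurableSet, Subset.rfl, fun A hA hAm => ?_⟩
        refine (hO₁ A (fun x hx => ⟨(hA hx).1.1, (hA hx).2⟩) hAm f hf).trans ?_
        rw [mul_left_comm, ← setLIntegral_const]
        refine mul_le_mul_right ?_ I
        refine setLIntegral_mono' hAm fun x hx => ?_
        rw [← ENNReal.ofReal_add (hF.nonneg _) (by positivity)]
        refine ENNReal.ofReal_le_ofReal ?_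
        have := (abs_lt.1 (hO₂ x ⟨(hA hx).1.2, (hA hx).2⟩)).1
        linarith
    have h1 := ht (frontier Ω) (subset_inter hts Subset.rfl) isClosed_frontier.measurableSet
    have h2 : {x | x ∈ Ω ∧ ∃ z ∈ frontier Ω, distBoundary F Ω x = polar F (x - z)} = Ω := by
      ext x
      exact ⟨fun hx => hx.1, fun hx => ⟨hx, hF.exists_foot hcomp hne x⟩⟩
    rw [h2, lintegral_add_right _ measurable_const, lintegral_const] at h1
    exact h1
  have hlim : Tendsto (fun ε : ℝ =>
      I * (∫⁻ y, ENNReal.ofReal (F (outerNormal Ω y)) ∂(surfaceMeasure Ω) +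
        ENNReal.ofReal (2 * ε) * surfaceMeasure Ω univ)) (𝓝[>] 0)
      (𝓝 (I * (∫⁻ y, ENNReal.ofReal (F (outerNormal Ω y)) ∂(surfaceMeasure Ω) +
        ENNReal.ofReal (2 * 0) * surfaceMeasure Ω univ))) := by
    refine ENNReal.Tendsto.const_mul (Tendsto.add tendsto_const_nhds
      (ENNReal.Tendsto.mul_const ?_ (Or.inr hS))) (Or.inr hfR)
    have hc : Continuous fun ε : ℝ => ENNReal.ofReal (2 * ε) :=
      ENNReal.continuous_ofReal.comp (continuous_const.mul continuous_id)
    exact (hc.tendsto 0).mono_left nhdsWithin_le_nhds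
  have := ge_of_tendsto hlim (eventually_mem_nhdsWithin.mono fun ε hε => key ε hε)
  simpa using this

end Tube

/-! ### Lipschitz functions as Sobolev functions -/

section Sobolev

variable {N : ℕ} {p : ℝ} {u : EuclideanSpace ℝ (Fin N) → ℝ} {C : ℝ≥0}

/-- Dominated convergence for functions that vanish outside a common set of finite measure. -/
theorem tendsto_eLpNorm_zero_of_bounded {α G : Type*} [MeasurableSpace α] {μ : Measure α}
    [NormedAddCommGroup G] {f : ℕ → α → G} {K : Set α} {c p : ℝ} (hp : 0 < p)
    (hf : ∀ k, AEStronglyMeasurable (f k) μ) (hK : MeasurableSet K) (hμK : μ K ≠ ⊤)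
    (hfK : ∀ k, ∀ x ∉ K, f k x = 0) (hfc : ∀ k x, ‖f k x‖ ≤ c)
    (hlim : ∀ᵐ x ∂μ, Tendsto (fun k => f k x) atTop (𝓝 0)) :
    Tendsto (fun k => eLpNorm (f k) (ENNReal.ofReal p) μ) atTop (𝓝 0) := by
  have hp0 : ENNReal.ofReal p ≠ 0 := by simpa using hp
  have h1 : Tendsto (fun k => ∫⁻ x, ‖f k x‖ₑ ^ p ∂μ) atTop (𝓝 (∫⁻ _, 0 ∂μ)) := by
    refine tendsto_lintegral_of_dominated_convergence' (K.indicator fun _ => ENNReal.ofReal c ^ p)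
      (fun k => (hf k).enorm.pow_const p) (fun k => Eventually.of_forall fun x => ?_) ?_ ?_
    · beta_reduce
      by_cases hx : x ∈ K
      · rw [indicator_of_mem hx, ← ofReal_norm]
        exact ENNReal.rpow_le_rpow (ENNReal.ofReal_le_ofReal (hfc k x)) hp.le
      · rw [indicator_of_notMem hx, hfK k x hx, enorm_zero, ENNReal.zero_rpow_of_pos hp]
    · rw [lintegral_indicator hK, setLIntegral_const]
      exact ENNReal.mul_ne_top (ENNReal.rpow_ne_top_of_nonneg hp.le ENNReal.ofReal_ne_top) hμK
    · filter_upwards [hlim] with x hx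
      have h2 : Tendsto (fun k => ‖f k x‖ₑ) atTop (𝓝 0) := by simpa using hx.enorm
      have := h2.ennrpow_const p
      rwa [ENNReal.zero_rpow_of_pos hp] at this
  rw [lintegral_zero] at h1
  have h2 := h1.ennrpow_const (1 / p)
  rw [ENNReal.zero_rpow_of_pos (by positivity)] at h2
  refine h2.congr fun k => ?_
  rw [eLpNorm_eq_lintegral_rpow_enorm_toReal hp0 ENNReal.ofReal_ne_top, ENNReal.toReal_ofReal hp.le]

theorem norm_gradient {H : Type*} [NormedAddCommGroup H] [InnerProductSpace ℝ H] [CompleteSpace H]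
    (f : H → ℝ) (x : H) : ‖gradient f x‖ = ‖fderiv ℝ f x‖ := by
  simp [gradient]

theorem gradient_sub_eq {H : Type*} [NormedAddCommGroup H] [InnerProductSpace ℝ H]
    [CompleteSpace H] (f g : H → ℝ) (x : H) :
    ‖gradient f x - gradient g x‖ = ‖fderiv ℝ f x - fderiv ℝ g x‖ := by
  simp only [gradient]
  rw [← map_sub, LinearIsometryEquiv.norm_map]

theorem measurable_gradient (f : EuclideanSpace ℝ (Fin N) → ℝ) : Measurable (gradient f) :=
  (InnerProductSpace.toDual ℝ (EuclideanSpace ℝ (Fin N))).symm.continuous.measurable.comp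
    (measurable_fderiv ℝ f)

theorem gradient_eq_zero_of_notMem_tsupport {x : EuclideanSpace ℝ (Fin N)} (hx : x ∉ tsupport u) :
    gradient u x = 0 := by
  have : fderiv ℝ u x = 0 := by
    by_contra h
    exact hx (support_fderiv_subset ℝ h)
  simp [gradient, this]

theorem norm_gradient_le (hu : LipschitzWith C u) (x : EuclideanSpace ℝ (Fin N)) :
    ‖gradient u x‖ ≤ C := by
  rw [norm_gradient]
  exact norm_fderiv_le_of_lipschitz ℝ hu

theorem memLp_of_bounded_of_tsupport {G : Type*} [NormedAddCommGroup G]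
    {f : EuclideanSpace ℝ (Fin N) → G} {μ : Measure (EuclideanSpace ℝ (Fin N))}
    [IsLocallyFiniteMeasure μ] {K : Set (EuclideanSpace ℝ (Fin N))} {c : ℝ} (hK : IsCompact K)
    (hf : AEStronglyMeasurable f μ) (hfK : ∀ x ∉ K, f x = 0) (hfc : ∀ x, ‖f x‖ ≤ c) (q : ℝ≥0∞) :
    MemLp f q μ := by
  refine (memLp_indicator_const q hK.measurableSet c
    (Or.inr hK.measure_lt_top.ne)).mono' hf (Eventually.of_forall fun x => ?_)
  by_cases hx : x ∈ K
  · rw [indicator_of_mem hx]; exact hfc x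
  · rw [indicator_of_notMem hx, hfK x hx, norm_zero]

theorem memLp_gradient (hu : LipschitzWith C u) (hc : HasCompactSupport u) (q : ℝ≥0∞) :
    MemLp (gradient u) q volume :=
  memLp_of_bounded_of_tsupport hc (measurable_gradient u).aestronglyMeasurable
    (fun _ hx => gradient_eq_zero_of_notMem_tsupport hx) (norm_gradient_le hu) q

/-- Integration by parts for Lipschitz functions, from the corresponding statement for directional
derivatives and Rademacher's theorem. -/
theorem integral_smul_gradient (hu : LipschitzWith C u) (hc : HasCompactSupport u)
    {φ : EuclideanSpace ℝ (Fin N) → ℝ} (hφ : ContDiff ℝ ∞ φ) (hφc : HasCompactSupport φ) :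
    ∫ x, u x • gradient φ x = - ∫ x, φ x • gradient u x := by
  obtain ⟨D, hD⟩ := hφ.lipschitzWith_of_hasCompactSupport hφc (by simp)
  have hgu : LocallyIntegrable (gradient u) volume :=
    ((memLp_one_iff_integrable.1 (memLp_gradient hu hc 1))).locallyIntegrable
  have hgφ : LocallyIntegrable (gradient φ) volume :=
    ((memLp_one_iff_integrable.1 (memLp_gradient hD hφc 1))).locallyIntegrable
  have hi1 : Integrable (fun x => u x • gradient φ x) volume :=
    hgφ.integrable_smul_left_of_hasCompactSupport hu.continuous hc
  have hi2 : Integrable (fun x => φ x • gradient u x) volume :=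
    hgu.integrable_smul_left_of_hasCompactSupport hφ.continuous hφc
  refine ext_inner_right ℝ fun v => ?_
  have key := hu.integral_lineDeriv_mul_eq (μ := volume) hD hφc v
  have hl : ∀ᵐ x ∂(volume : Measure (EuclideanSpace ℝ (Fin N))),
      lineDeriv ℝ u x v = inner ℝ (gradient u x) v := by
    filter_upwards [hu.ae_differentiableAt (μ := volume)] with x hx
    rw [hx.lineDeriv_eq_fderiv, inner_gradient_eq_fderiv]
  have hr : ∀ x, lineDeriv ℝ φ x (-v) = - inner ℝ (gradient φ x) v := fun x => by
    rw [(hφ.differentiable (by simp) x).lineDeriv_eq_fderiv, map_neg, inner_gradient_eq_fderiv]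
  rw [inner_neg_left, real_inner_comm v, real_inner_comm v, ← integral_inner hi1,
    ← integral_inner hi2]
  have e1 : ∫ x, inner ℝ v (u x • gradient φ x) = - ∫ x, lineDeriv ℝ φ x (-v) * u x := by
    rw [← integral_neg]
    refine integral_congr_ae (Eventually.of_forall fun x => ?_)
    simp only [hr, inner_smul_right, real_inner_comm v]
    ring
  have e2 : ∫ x, inner ℝ v (φ x • gradient u x) = ∫ x, lineDeriv ℝ u x v * φ x := by
    refine integral_congr_ae (hl.mono fun x hx => ?_)
    simp only [hx, inner_smul_right, real_inner_comm v]
    ring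
  rw [e1, e2, key]

theorem isSobolev_of_lipschitz {Ω : Set (EuclideanSpace ℝ (Fin N))} (hu : LipschitzWith C u)
    (hc : HasCompactSupport u) : IsSobolev Ω p u (gradient u) where
  memLp := (hu.continuous.memLp_of_hasCompactSupport hc).restrict Ω
  memLp_grad := (memLp_gradient hu hc _).restrict Ω
  weak φ hφ hφc hφΩ := by
    rw [setIntegral_eq_integral_of_forall_compl_eq_zero,
    setIntegral_eq_integral_of_forall_compl_eq_zero]
    · exact integral_smul_gradient hu hc hφ hφc
    · intro x hx
      rw [image_eq_zero_of_notMem_tsupport fun h => hx (hφΩ h), zero_smul]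
    · intro x hx
      rw [gradient_eq_zero_of_notMem_tsupport fun h => hx (hφΩ h), smul_zero]

/-- A sequence of bump functions shrinking to the origin. -/
def shrinkingBump (N k : ℕ) : ContDiffBump (0 : EuclideanSpace ℝ (Fin N)) where
  rIn := 1 / (k + 2)
  rOut := 2 / (k + 2)
  rIn_pos := by positivity
  rIn_lt_rOut := by gcongr; norm_num

/-- Mollification with the bump functions `shrinkingBump`. -/
def mollify (u : EuclideanSpace ℝ (Fin N) → ℝ) (k : ℕ) : EuclideanSpace ℝ (Fin N) → ℝ :=
  convolution ((shrinkingBump N k).normed volume) u (ContinuousLinearMap.lsmul ℝ ℝ) volume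

theorem tendsto_shrinkingBump_rOut (N : ℕ) :
    Tendsto (fun k => (shrinkingBump N k).rOut) atTop (𝓝 0) := by
  have h1 : Tendsto (fun k : ℕ => (k : ℝ) + 2) atTop atTop :=
    tendsto_atTop_add_const_right _ _ tendsto_natCast_atTop_atTop
  exact tendsto_const_nhds.div_atTop h1

theorem shrinkingBump_rOut_le (N k : ℕ) : (shrinkingBump N k).rOut ≤ 1 := by
  change (2 : ℝ) / (k + 2) ≤ 1
  rw [div_le_one (by positivity)]
  have : (0 : ℝ) ≤ k := Nat.cast_nonneg k
  linarith

theorem contDiff_mollify (hu : Continuous u) (k : ℕ) : ContDiff ℝ ∞ (mollify u k) :=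
  (shrinkingBump N k).hasCompactSupport_normed.contDiff_convolution_left _
    (shrinkingBump N k).contDiff_normed hu.locallyIntegrable

theorem hasCompactSupport_mollify (hc : HasCompactSupport u) (k : ℕ) :
    HasCompactSupport (mollify u k) :=
  (shrinkingBump N k).hasCompactSupport_normed.convolution _ hc

theorem support_mollify_subset (k : ℕ) :
    Function.support (mollify u k) ⊆ Metric.cthickening 1 (tsupport u) := by
  intro x hx
  obtain ⟨a, ha, b, hb, rfl⟩ := support_convolution_subset _ hx
  rw [ContDiffBump.support_normed_eq, Metric.mem_ball, dist_zero_right] at ha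
  refine Metric.mem_cthickening_of_dist_le _ b _ _ (subset_tsupport u hb) ?_
  rw [dist_eq_norm, add_sub_cancel_right]
  exact ha.le.trans (shrinkingBump_rOut_le N k)

theorem abs_mollify_sub_le (hu : LipschitzWith C u) (k : ℕ) (x : EuclideanSpace ℝ (Fin N)) :
    |mollify u k x - u x| ≤ C * (shrinkingBump N k).rOut := by
  rw [← Real.dist_eq]
  refine (shrinkingBump N k).dist_normed_convolution_le hu.continuous.aestronglyMeasurable
    fun y hy => (hu.dist_le_mul y x).trans ?_
  exact mul_le_mul_of_nonneg_left (Metric.mem_ball.1 hy).le C.2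

theorem lsmul_eq_smul {G : Type*} [NormedAddCommGroup G] [NormedSpace ℝ G]
    (f : EuclideanSpace ℝ (Fin N) → ℝ) (g : EuclideanSpace ℝ (Fin N) → G)
    (x : EuclideanSpace ℝ (Fin N)) :
    convolution f g (ContinuousLinearMap.lsmul ℝ ℝ) volume x = ∫ t, f t • g (x - t) := rfl

/-- The derivative of the mollification of a Lipschitz function is the mollification of its almost
everywhere defined derivative. -/
theorem hasFDerivAt_mollify (hu : LipschitzWith C u) (k : ℕ) (x : EuclideanSpace ℝ (Fin N)) :
    HasFDerivAt (mollify u k) (convolution ((shrinkingBump N k).normed volume) (fderiv ℝ u)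
      (ContinuousLinearMap.lsmul ℝ ℝ) volume x) x := by
  set b := (shrinkingBump N k).normed volume with hb
  have hbc : Continuous b := (shrinkingBump N k).continuous_normed
  have hbi : Integrable b volume := (shrinkingBump N k).integrable_normed
  have hb0 : ∀ t, 0 ≤ b t := fun t => (shrinkingBump N k).nonneg_normed t
  have hsub : MeasurePreserving (fun t : EuclideanSpace ℝ (Fin N) => x - t) volume volume :=
    Measure.measurePreserving_sub_left volume x
  rw [lsmul_eq_smul]
  have hm : mollify u k = fun x => ∫ t, b t • u (x - t) := funext fun x => rfl
  rw [hm]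
  have h := hasFDerivAt_integral_of_dominated_loc_of_lip (𝕜 := ℝ) (μ := volume)
    (F := fun x t => b t • u (x - t)) (F' := fun t => b t • fderiv ℝ u (x - t)) (x₀ := x)
    (s := univ) (bound := fun t => b t * C) Filter.univ_mem
    (Eventually.of_forall fun y =>
      (hbc.smul (hu.continuous.comp (continuous_const.sub continuous_id))).aestronglyMeasurable)
    ?_ ?_ ?_ (hbi.mul_const _) ?_
  · exact h.2
  · refine Continuous.integrable_of_hasCompactSupport
      (hbc.smul (hu.continuous.comp (continuous_const.sub continuous_id))) ?_
    exact (shrinkingBump N k).hasCompactSupport_normed.smul_right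
  · exact (hbc.measurable.smul ((measurable_fderiv ℝ u).comp
      (measurable_const.sub measurable_id))).aestronglyMeasurable
  · refine Eventually.of_forall fun t => LipschitzWith.lipschitzOnWith ?_
    refine LipschitzWith.of_dist_le_mul fun y z => ?_
    rw [dist_smul₀, Real.norm_of_nonneg (hb0 t), Real.coe_nnabs,
      abs_of_nonneg (mul_nonneg (hb0 t) (NNReal.coe_nonneg C)), mul_assoc]
    refine mul_le_mul_of_nonneg_left ?_ (hb0 t)
    have := hu.dist_le_mul (y - t) (z - t)
    rwa [dist_sub_right] at this
  · have hae := hsub.quasiMeasurePreserving.ae (hu.ae_differentiableAt (μ := volume))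
    filter_upwards [hae] with t ht
    have h1 : HasFDerivAt (fun y => u (y - t)) (fderiv ℝ u (x - t)) x :=
      (hasFDerivAt_comp_sub t).2 ht.hasFDerivAt
    exact h1.const_smul (b t)

theorem norm_fderiv_mollify_le (hu : LipschitzWith C u) (k : ℕ) (x : EuclideanSpace ℝ (Fin N)) :
    ‖fderiv ℝ (mollify u k) x‖ ≤ C := by
  rw [(hasFDerivAt_mollify hu k x).fderiv, lsmul_eq_smul]
  have hbi : Integrable ((shrinkingBump N k).normed volume) volume :=
    (shrinkingBump N k).integrable_normed
  refine (norm_integral_le_of_norm_le (hbi.mul_const (C : ℝ))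
    (Eventually.of_forall fun t => ?_)).trans ?_
  · rw [norm_smul, Real.norm_of_nonneg ((shrinkingBump N k).nonneg_normed t)]
    exact mul_le_mul_of_nonneg_left (norm_fderiv_le_of_lipschitz ℝ hu)
      ((shrinkingBump N k).nonneg_normed t)
  · rw [integral_mul_const, (shrinkingBump N k).integral_normed, one_mul]

/-- A compactly supported Lipschitz function is its own trace. -/
theorem isTrace_of_lipschitz {Ω : Set (EuclideanSpace ℝ (Fin N))} (hp : 1 < p)
    [IsLocallyFiniteMeasure (surfaceMeasure Ω)] (hu : LipschitzWith C u)
    (hc : HasCompactSupport u) : IsTrace Ω p u (gradient u) u := by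
  have hp0 : 0 < p := by linarith
  set K := Metric.cthickening 1 (tsupport u) with hK
  have hKc : IsCompact K := IsCompact.cthickening hc
  have huK : tsupport u ⊆ K := Metric.self_subset_cthickening _
  have hm0 : ∀ k, ∀ x ∉ K, mollify u k x = 0 := fun k x hx => by
    by_contra h
    exact hx (support_mollify_subset k h)
  have hmt : ∀ k, tsupport (mollify u k) ⊆ K := fun k =>
    closure_minimal (support_mollify_subset k) Metric.isClosed_cthickening
  have hdiff : ∀ (μ : Measure (EuclideanSpace ℝ (Fin N))) [IsLocallyFiniteMeasure μ],
      Tendsto (fun k => eLpNorm (fun x => mollify u k x - u x) (ENNReal.ofReal p) μ) atTop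
        (𝓝 0) := by
    intro μ _
    refine tendsto_eLpNorm_zero_of_bounded (K := K) (c := C) hp0 (fun k => ?_) hKc.measurableSet
      hKc.measure_lt_top.ne (fun k x hx => ?_) (fun k x => ?_) (Eventually.of_forall fun x => ?_)
    · exact ((contDiff_mollify hu.continuous k).continuous.sub hu.continuous).aestronglyMeasurable
    · rw [hm0 k x hx, image_eq_zero_of_notMem_tsupport fun h => hx (huK h), sub_zero]
    · refine (abs_mollify_sub_le hu k x).trans ?_
      exact mul_le_of_le_one_right C.2 (shrinkingBump_rOut_le N k)
    · refine squeeze_zero_norm (abs_mollify_sub_le hu · x) ?_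
      simpa using (tendsto_shrinkingBump_rOut N).const_mul (C : ℝ)
  refine ⟨?_, mollify u, fun k => contDiff_mollify hu.continuous k,
    fun k => hasCompactSupport_mollify hc k, hdiff _, ?_, hdiff _⟩
  · exact hu.continuous.memLp_of_hasCompactSupport hc
  · refine tendsto_eLpNorm_zero_of_bounded (K := K) (c := C + C) hp0 (fun k => ?_) hKc.measurableSet
      hKc.measure_lt_top.ne (fun k x hx => ?_) (fun k x => ?_) (ae_restrict_of_ae ?_)
    · exact ((measurable_gradient _).sub (measurable_gradient _)).aestronglyMeasurable
    · rw [gradient_eq_zero_of_notMem_tsupport fun h => hx (hmt k h),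
        gradient_eq_zero_of_notMem_tsupport fun h => hx (huK h), sub_zero]
    · refine (norm_sub_le _ _).trans (add_le_add ?_ (norm_gradient_le hu x))
      rw [norm_gradient]; exact norm_fderiv_mollify_le hu k x
    · have hli : LocallyIntegrable (fderiv ℝ u) volume := by
        refine (memLp_one_iff_integrable.1 (memLp_of_bounded_of_tsupport (c := C) hc
          (measurable_fderiv ℝ u).aestronglyMeasurable (fun x hx => ?_)
          (fun x => norm_fderiv_le_of_lipschitz ℝ hu) 1)).locallyIntegrable
        by_contra h
        exact hx (support_fderiv_subset ℝ h)
      have hae := ContDiffBump.ae_convolution_tendsto_right_of_locallyIntegrable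
        (φ := shrinkingBump N) (K := 2) (tendsto_shrinkingBump_rOut N)
        (Eventually.of_forall fun k => le_of_eq (by simp [shrinkingBump]; ring)) hli
      filter_upwards [hae] with x hx
      rw [tendsto_zero_iff_norm_tendsto_zero]
      rw [tendsto_iff_norm_sub_tendsto_zero] at hx
      refine hx.congr fun k => ?_
      rw [gradient_sub_eq, (hasFDerivAt_mollify hu k x).fderiv]

/-- Every compactly supported Lipschitz function gives an upper bound for the eigenvalue. -/
theorem robinEigenvalue_le_of_lipschitz {F : EuclideanSpace ℝ (Fin N) → ℝ} {β : ℝ}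
    {Ω : Set (EuclideanSpace ℝ (Fin N))} (hp : 1 < p)
    [IsLocallyFiniteMeasure (surfaceMeasure Ω)] (hu : LipschitzWith C u)
    (hc : HasCompactSupport u) (hne : ¬ (u =ᵐ[volume.restrict Ω] 0)) :
    robinEigenvalue p F β Ω ≤ (rayleigh p F β Ω u (gradient u) u : ℝ) :=
  sInf_le ⟨u, gradient u, u, isSobolev_of_lipschitz hu hc, isTrace_of_lipschitz hp hu hc, hne, rfl⟩

end Sobolev

/-! ### The upper bound for bounded mean convex domains -/

section Bounded

theorem hasDerivAt_coshP_zero {p : ℝ} (hp : 1 < p) : HasDerivAt (coshP p) 0 0 := by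
  rw [hasDerivAt_iff_tendsto]
  have h1 : Tendsto (fun t : ℝ => sinhP p |t|) (𝓝 0) (𝓝 0) := by
    have := ((continuous_sinhP hp).comp continuous_abs).tendsto 0
    simp only [Function.comp_def, abs_zero, sinhP_zero hp] at this
    exact this
  refine squeeze_zero (fun t => by positivity) (fun t => ?_) h1
  have h2 := abs_coshP_sub_le hp le_rfl (abs_nonneg t) (abs_nonneg t) le_rfl
  rw [sub_zero, abs_abs, coshP_abs] at h2
  rw [smul_zero, sub_zero, sub_zero, Real.norm_eq_abs, Real.norm_eq_abs]
  rcases eq_or_ne t 0 with rfl | ht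
  · simpa using sinhP_nonneg hp 0
  · rw [inv_mul_le_iff₀ (abs_pos.2 ht), mul_comm]
    exact h2

theorem hasDerivAt_coshP_of_nonneg {p : ℝ} (hp : 1 < p) {t : ℝ} (ht : 0 ≤ t) :
    HasDerivAt (coshP p) (sinhP p t) t := by
  rcases ht.eq_or_lt with rfl | ht
  · rw [sinhP_zero hp]; exact hasDerivAt_coshP_zero hp
  · exact hasDerivAt_coshP hp ht

variable {N n : ℕ} {p : ℝ}

theorem continuousOn_outerNormal {Ω : Set (EuclideanSpace ℝ (Fin N))}
    (hΩ : ∀ y ∈ frontier Ω, ∃ U ρ, IsC2DefiningFunction Ω y U ρ) :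
    ContinuousOn (outerNormal Ω) (frontier Ω) := by
  intro y hy
  obtain ⟨U, ρ, h⟩ := hΩ y hy
  have h2 := (h.hasFDerivAt_gradient h.mem).continuousAt
  have h1 : ContinuousAt (fun x => ‖gradient ρ x‖⁻¹ • gradient ρ x) y :=
    (h2.norm.inv₀ (norm_ne_zero_iff.2 (h.gradient_ne_zero y h.mem))).smul h2
  refine h1.continuousWithinAt.congr_of_eventuallyEq ?_ (h.outerNormal_eq hy)
  filter_upwards [self_mem_nhdsWithin, mem_nhdsWithin_of_mem_nhds (h.isOpen.mem_nhds h.mem)]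
    with x hx hxU
  exact (h.of_mem hxU).outerNormal_eq hx

/-- The gradient of the anisotropic distance to the boundary has norm at most one. -/
theorem norm_gradient_distBoundary_le {F : EuclideanSpace ℝ (Fin N) → ℝ}
    {Ω : Set (EuclideanSpace ℝ (Fin N))} (hF : IsFinslerNorm p F) (hne : (frontier Ω).Nonempty)
    {x : EuclideanSpace ℝ (Fin N)} (hx : DifferentiableAt ℝ (distBoundary F Ω) x) :
    F (gradient (distBoundary F Ω) x) ≤ 1 := by
  refine hF.le_of_forall_inner_le_polar zero_le_one fun v => ?_
  rw [inner_gradient_eq_fderiv, one_mul]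
  have h1 : HasDerivAt (fun t : ℝ => distBoundary F Ω (x + t • v))
      (fderiv ℝ (distBoundary F Ω) x v) 0 := by
    have h3 : HasFDerivAt (distBoundary F Ω) (fderiv ℝ (distBoundary F Ω) x) (x + (0 : ℝ) • v) := by
      simpa using hx.hasFDerivAt
    exact h3.comp_hasDerivAt 0 (IsC2DefiningFunction.hasDerivAt_line x v 0)
  refine le_of_tendsto h1.tendsto_slope_zero_right ?_
  filter_upwards [self_mem_nhdsWithin] with t ht
  have ht : 0 < t := ht
  have h2 := hF.distBoundary_le_add hne (x + t • v) x
  rw [add_sub_cancel_left, IsFinslerNorm.polar_smul F ht.le] at h2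
  simp only [zero_add, zero_smul, add_zero, smul_eq_mul]
  rw [inv_mul_le_iff₀ ht]
  linarith

theorem frontier_nonempty_of_isBounded {Ω : Set (EuclideanSpace ℝ (Fin (n + 1)))}
    (hne : Ω.Nonempty) (hb : Bornology.IsBounded Ω) : (frontier Ω).Nonempty := by
  refine nonempty_frontier_iff.2 ⟨hne, fun h => ?_⟩
  rw [h] at hb
  exact NormedSpace.unbounded_univ ℝ _ hb

theorem distBoundary_le_inradius {F : EuclideanSpace ℝ (Fin N) → ℝ}
    {Ω : Set (EuclideanSpace ℝ (Fin N))} (hF : IsFinslerNorm p F) (hne : (frontier Ω).Nonempty)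
    (hb : Bornology.IsBounded Ω) {x : EuclideanSpace ℝ (Fin N)} (hx : x ∈ closure Ω) :
    distBoundary F Ω x ≤ inradius F Ω := by
  have hc : IsCompact (closure Ω) := Metric.isCompact_of_isClosed_isBounded isClosed_closure
    hb.closure
  exact le_csSup (hc.image (hF.continuous_distBoundary hne)).bddAbove (mem_image_of_mem _ hx)

theorem distBoundary_pos {F : EuclideanSpace ℝ (Fin N) → ℝ}
    {Ω : Set (EuclideanSpace ℝ (Fin N))} (hF : IsFinslerNorm p F) (hΩ : IsOpen Ω)
    (hc : IsCompact (frontier Ω)) (hne : (frontier Ω).Nonempty)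
    {x : EuclideanSpace ℝ (Fin N)} (hx : x ∈ Ω) : 0 < distBoundary F Ω x := by
  obtain ⟨y, hy, h⟩ := hF.exists_foot hc hne x
  rw [h]
  refine hF.polar_pos (sub_ne_zero.2 ?_)
  rintro rfl
  rw [hΩ.frontier_eq] at hy
  exact hy.2 hx

/-- The test function `cosh_p (κ (R - d))` near `Ω`, cut off to have compact support. -/
def webFunction (p κ R c : ℝ) (F : EuclideanSpace ℝ (Fin N) → ℝ)
    (Ω : Set (EuclideanSpace ℝ (Fin N))) (x : EuclideanSpace ℝ (Fin N)) : ℝ :=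
  min (coshP p (κ * max (R - distBoundary F Ω x) 0)) (max (c - ‖x‖) 0)

theorem exists_lipschitzWith_webFunction {F : EuclideanSpace ℝ (Fin N) → ℝ}
    {Ω : Set (EuclideanSpace ℝ (Fin N))} (hF : IsFinslerNorm p F) (hp : 1 < p)
    (hne : (frontier Ω).Nonempty) {κ R : ℝ} (hκ : 0 < κ) (hR : 0 < R) (c : ℝ) :
    ∃ L, LipschitzWith L (webFunction p κ R c F Ω) := by
  obtain ⟨C, hC⟩ := hF.exists_lipschitzWith_distBoundary hne
  have h1 : LipschitzWith C fun x => max (R - distBoundary F Ω x) 0 := by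
    refine LipschitzWith.max_const ?_ 0
    refine LipschitzWith.of_dist_le_mul fun x y => ?_
    rw [dist_sub_left]
    exact hC.dist_le_mul x y
  have h2 : LipschitzWith ((sinhP p (κ * R) * κ).toNNReal * C)
      fun x => coshP p (κ * max (R - distBoundary F Ω x) 0) := by
    refine LipschitzWith.of_dist_le_mul fun x y => ?_
    have h0 : 0 ≤ sinhP p (κ * R) := sinhP_nonneg hp _
    have hm : ∀ x, max (R - distBoundary F Ω x) 0 ≤ R := fun x =>
      max_le (by linarith [hF.distBoundary_nonneg (Ω := Ω) x]) hR.le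
    rw [Real.dist_eq]
    refine (abs_coshP_sub_le hp (mul_nonneg hκ.le (le_max_right _ _))
      (mul_nonneg hκ.le (le_max_right _ _)) (mul_le_mul_of_nonneg_left (hm y) hκ.le)
      (mul_le_mul_of_nonneg_left (hm x) hκ.le)).trans ?_
    rw [← mul_sub, abs_mul, abs_of_pos hκ, NNReal.coe_mul,
      Real.coe_toNNReal _ (mul_nonneg h0 hκ.le), ← Real.dist_eq, ← mul_assoc, mul_assoc _ (C : ℝ)]
    exact mul_le_mul_of_nonneg_left (h1.dist_le_mul x y) (mul_nonneg h0 hκ.le)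
  have h3 : LipschitzWith 1 fun x : EuclideanSpace ℝ (Fin N) => max (c - ‖x‖) 0 := by
    refine LipschitzWith.max_const ?_ 0
    refine LipschitzWith.of_dist_le_mul fun x y => ?_
    rw [dist_sub_left]
    exact lipschitzWith_one_norm.dist_le_mul x y
  exact ⟨_, h2.min h3⟩

theorem hasCompactSupport_webFunction {F : EuclideanSpace ℝ (Fin N) → ℝ}
    {Ω : Set (EuclideanSpace ℝ (Fin N))} (hp : 1 < p) (κ R c : ℝ) :
    HasCompactSupport (webFunction p κ R c F Ω) := by
  refine HasCompactSupport.intro (isCompact_closedBall (0 : EuclideanSpace ℝ (Fin N)) c)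
    fun x hx => ?_
  rw [mem_closedBall_zero_iff, not_le] at hx
  rw [webFunction, max_eq_right (by linarith : c - ‖x‖ ≤ 0), min_eq_right (coshP_pos hp _).le]

theorem webFunction_eq {F : EuclideanSpace ℝ (Fin N) → ℝ} {Ω : Set (EuclideanSpace ℝ (Fin N))}
    (hF : IsFinslerNorm p F) (hp : 1 < p) {κ R r : ℝ} (hκ : 0 < κ) (hR : 0 < R)
    {x : EuclideanSpace ℝ (Fin N)} (hx : distBoundary F Ω x ≤ R) (hxr : ‖x‖ ≤ r) :
    webFunction p κ R (coshP p (κ * R) + r) F Ω x = coshP p (κ * (R - distBoundary F Ω x)) := by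
  rw [webFunction, max_eq_left (sub_nonneg.2 hx)]
  have h1 : coshP p (κ * (R - distBoundary F Ω x)) ≤ coshP p (κ * R) :=
    monotoneOn_coshP hp (mul_nonneg hκ.le (sub_nonneg.2 hx)) (mul_pos hκ hR).le
      (mul_le_mul_of_nonneg_left (by linarith [hF.distBoundary_nonneg (Ω := Ω) x]) hκ.le)
  exact min_eq_left ((le_max_left _ _).trans' (by linarith))

/-- The upper bound by the web function `cosh_p (κ (R - d))`. The volume part of the numerator minus
the root times the denominator is at most the integral of `κ ^ p (p cosh_p ^ p - 1)`, which the
volume comparison bounds by the boundary part. -/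
theorem robinEigenvalue_le_of_meanConvex {F : EuclideanSpace ℝ (Fin (n + 1)) → ℝ}
    {Ω : Set (EuclideanSpace ℝ (Fin (n + 1)))} (hp : 1 < p) (hF : IsFinslerNorm p F) {β : ℝ}
    (hβ : β < 0) (hΩ : IsC2Domain Ω) (hb : Bornology.IsBounded Ω)
    (hcurv : ∀ y ∈ frontier Ω, 0 ≤ anisotropicMeanCurvature F Ω y) :
    0 < inradius F Ω ∧ ∀ κ : ℝ, 0 < κ → κ ^ (p - 1) * riccatiP p (κ * inradius F Ω) = |β| →
      robinEigenvalue p F β Ω ≤ ((-((p - 1) * κ ^ p) : ℝ) : EReal) := by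
  have hp0 : 0 < p := by linarith
  have hne := frontier_nonempty_of_isBounded hΩ.isConnected.nonempty hb
  have hcomp : IsCompact (frontier Ω) :=
    Metric.isCompact_of_isClosed_isBounded isClosed_frontier
      (hb.closure.subset frontier_subset_closure)
  obtain ⟨x₀, hx₀⟩ := hΩ.isConnected.nonempty
  have hRpos : 0 < inradius F Ω := (distBoundary_pos hF hΩ.isOpen hcomp hne hx₀).trans_le
    (distBoundary_le_inradius hF hne hb (subset_closure hx₀))
  refine ⟨hRpos, fun κ hκ hκβ => ?_⟩
  have hdR : ∀ x ∈ closure Ω, distBoundary F Ω x ≤ inradius F Ω := fun x hx =>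
    distBoundary_le_inradius hF hne hb hx
  set R := inradius F Ω with hR
  set d := distBoundary F Ω with hd
  have hdc : Continuous d := hF.continuous_distBoundary hne
  have hfin := isLocallyFiniteMeasure_surfaceMeasure hΩ.boundary
  have hSfin : IsFiniteMeasure (surfaceMeasure Ω) := by
    refine ⟨?_⟩
    have h1 : surfaceMeasure Ω univ = surfaceMeasure Ω (frontier Ω) := by
      rw [surfaceMeasure, Measure.restrict_apply_univ, Measure.restrict_apply_self]
    rw [h1]
    exact hcomp.measure_lt_top
  obtain ⟨r, hr⟩ := hb.closure.exists_norm_le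
  set u := webFunction p κ R (coshP p (κ * R) + (r + 1)) F Ω with hu
  obtain ⟨L, hL⟩ := exists_lipschitzWith_webFunction (Ω := Ω) hF hp hne hκ hRpos
    (coshP p (κ * R) + (r + 1))
  have hucs : HasCompactSupport u := hasCompactSupport_webFunction hp _ _ _
  have hucl : ∀ x ∈ closure Ω, u x = coshP p (κ * (R - d x)) := fun x hx =>
    webFunction_eq hF hp hκ hRpos (hdR x hx) (by linarith [hr x hx])
  have hΩfin : volume Ω < ⊤ := hb.measure_lt_top
  have hΩpos : 0 < volume Ω := hΩ.isOpen.measure_pos volume ⟨x₀, hx₀⟩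
  have hΩm : MeasurableSet Ω := hΩ.isOpen.measurableSet
  have hune : ¬ (u =ᵐ[volume.restrict Ω] 0) := by
    intro h0
    rw [EventuallyEq, ae_restrict_iff' hΩm] at h0
    have h1 : ∀ᵐ x ∂(volume : Measure (EuclideanSpace ℝ (Fin (n + 1)))), x ∉ Ω := by
      filter_upwards [h0] with x hx hxΩ
      have h2 := hx hxΩ
      rw [hucl x (subset_closure hxΩ), Pi.zero_apply] at h2
      exact (coshP_pos hp _).ne' h2
    have h2 : volume Ω = 0 := by
      have := h1
      rw [ae_iff] at this
      simpa using this
    exact hΩpos.ne' h2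
  refine (robinEigenvalue_le_of_lipschitz hp hL hucs hune).trans ?_
  rw [EReal.coe_le_coe_iff]
  -- The three integrals of the Rayleigh quotient.
  set c : EuclideanSpace ℝ (Fin (n + 1)) → ℝ := fun x => coshP p (κ * (R - d x)) ^ p with hc
  have hcc : Continuous c := ((continuous_coshP hp).comp
    (continuous_const.mul (continuous_const.sub hdc))).rpow_const fun _ => Or.inr hp0.le
  have hcint : IntegrableOn c Ω volume :=
    (hcc.continuousOn.integrableOn_compact (Metric.isCompact_of_isClosed_isBounded isClosed_closure
      hb.closure)).mono_set subset_closure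
  have hc1 : ∀ x, 1 ≤ c x := fun x => Real.one_le_rpow (one_le_coshP hp _) hp0.le
  have hden : ∫ x in Ω, |u x| ^ p = ∫ x in Ω, c x := by
    refine setIntegral_congr_fun hΩm fun x hx => ?_
    simp only [hucl x (subset_closure hx), abs_of_pos (coshP_pos hp _), hc]
  have hone : IntegrableOn (fun _ => (1 : ℝ)) Ω volume :=
    integrableOn_const hΩfin.ne
  have hgrad : ∀ᵐ x ∂(volume.restrict Ω), F (gradient u x) ^ p ≤ κ ^ p * (c x - 1) := by
    obtain ⟨C, hC⟩ := hF.exists_lipschitzWith_distBoundary hne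
    rw [ae_restrict_iff' hΩm]
    filter_upwards [hC.ae_differentiableAt (μ := volume)] with x hxd hx
    have hdx := hdR x (subset_closure hx)
    have h1 : HasFDerivAt u ((sinhP p (κ * (R - d x)) * (κ * -1)) • fderiv ℝ d x) x := by
      have h2 : HasDerivAt (fun s => coshP p (κ * (R - s)))
          (sinhP p (κ * (R - d x)) * (κ * -1)) (d x) := by
        have h0 : HasDerivAt (fun s => κ * (R - s)) (κ * -1) (d x) :=
          ((hasDerivAt_id (d x)).const_sub R).const_mul κ
        exact HasDerivAt.comp (h₂ := coshP p) (h := fun s => κ * (R - s)) (d x)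
          (hasDerivAt_coshP_of_nonneg hp (mul_nonneg hκ.le (sub_nonneg.2 hdx))) h0
      refine (h2.comp_hasFDerivAt x hxd.hasFDerivAt).congr_of_eventuallyEq ?_
      filter_upwards [hΩ.isOpen.mem_nhds hx] with z hz
      exact hucl z (subset_closure hz)
    have h2 : gradient u x = (sinhP p (κ * (R - d x)) * (κ * -1)) • gradient d x := by
      simp only [gradient, h1.fderiv, map_smul]
    have hs0 := sinhP_nonneg hp (κ * (R - d x))
    rw [h2, hF.homogeneous, mul_neg_one, mul_neg, abs_neg, abs_of_nonneg (mul_nonneg hs0 hκ.le)]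
    calc (sinhP p (κ * (R - d x)) * κ * F (gradient d x)) ^ p
        ≤ (sinhP p (κ * (R - d x)) * κ) ^ p := by
          refine Real.rpow_le_rpow (mul_nonneg (mul_nonneg hs0 hκ.le) (hF.nonneg _)) ?_ hp0.le
          exact mul_le_of_le_one_right (mul_nonneg hs0 hκ.le)
            (norm_gradient_distBoundary_le hF hne hxd)
      _ = κ ^ p * (c x - 1) := by
          rw [Real.mul_rpow hs0 hκ.le, sinhP_rpow hp]; ring
  have hnum : ∫ x in Ω, F (gradient u x) ^ p ≤ ∫ x in Ω, κ ^ p * (c x - 1) := by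
    refine integral_mono_of_nonneg (Eventually.of_forall fun x => Real.rpow_nonneg (hF.nonneg _) _)
      ((hcint.sub hone).const_mul _) hgrad
  have hsurf : ∫ y, |u y| ^ p * F (outerNormal Ω y) ∂(surfaceMeasure Ω) =
      coshP p (κ * R) ^ p * ∫ y, F (outerNormal Ω y) ∂(surfaceMeasure Ω) := by
    rw [← integral_const_mul]
    refine integral_congr_ae ?_
    rw [surfaceMeasure]
    filter_upwards [ae_restrict_mem isClosed_frontier.measurableSet] with y hy
    rw [hucl y (frontier_subset_closure hy), hd, hF.distBoundary_eq_zero hy, sub_zero,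
      abs_of_pos (coshP_pos hp _)]
  have hFint : Integrable (fun y => F (outerNormal Ω y)) (surfaceMeasure Ω) := by
    obtain ⟨CF, -, hCF⟩ := hF.exists_le_norm
    have hm : AEStronglyMeasurable (fun y => F (outerNormal Ω y)) (surfaceMeasure Ω) :=
      (hF.continuous.comp_continuousOn (continuousOn_outerNormal hΩ.boundary)).aestronglyMeasurable
        isClosed_frontier.measurableSet
    refine Integrable.of_bound hm CF ?_
    rw [surfaceMeasure]
    filter_upwards [ae_restrict_mem isClosed_frontier.measurableSet] with y hy
    obtain ⟨U, ρ, h⟩ := hΩ.boundary y hy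
    rw [Real.norm_of_nonneg (hF.nonneg _)]
    simpa [h.norm_outerNormal hy] using hCF (outerNormal Ω y)
  set PF := ∫ y, F (outerNormal Ω y) ∂(surfaceMeasure Ω) with hPF
  -- The volume comparison for the density `p cosh_p ^ p - 1`.
  set g : ℝ → ℝ := fun s => p * coshP p (κ * (R - s)) ^ p - 1 with hg
  have hgc : Continuous g := (continuous_const.mul (((continuous_coshP hp).comp
    (continuous_const.mul (continuous_const.sub continuous_id))).rpow_const
      fun _ => Or.inr hp0.le)).sub continuous_const
  have hg0 : ∀ s, 0 ≤ g s := fun s => by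
    have := Real.one_le_rpow (one_le_coshP hp (κ * (R - s))) hp0.le
    simp only [hg]; nlinarith
  have hgint : IntegrableOn g (Icc 0 R) volume := hgc.continuousOn.integrableOn_Icc
  have hgval : ∫ s in Icc 0 R, g s = κ⁻¹ * fluxP p (κ * R) := by
    rw [integral_Icc_eq_integral_Ioc, ← intervalIntegral.integral_of_le hRpos.le]
    simp only [hg]
    rw [intervalIntegral.integral_comp_sub_left (fun s => p * coshP p (κ * s) ^ p - 1) R,
      sub_self, sub_zero,
      intervalIntegral.integral_comp_mul_left (fun s => p * coshP p s ^ p - 1) hκ.ne',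
      mul_zero, integral_fluxP hp (mul_pos hκ hRpos).le, smul_eq_mul]
  have hlg : ∫⁻ s in Icc 0 R, ENNReal.ofReal (g s) = ENNReal.ofReal (κ⁻¹ * fluxP p (κ * R)) := by
    rw [← hgval, ofReal_integral_eq_lintegral_ofReal hgint (Eventually.of_forall hg0)]
  have htube := lintegral_distBoundary_le hF hΩ hb hcurv
    (fun x hx => hdR x (subset_closure hx)) (f := fun s => ENNReal.ofReal (g s))
    (ENNReal.measurable_ofReal.comp hgc.measurable) (by rw [hlg]; exact ENNReal.ofReal_ne_top) hne
  have hgd : IntegrableOn (fun x => g (d x)) Ω volume := (hcint.const_mul p).sub hone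
  rw [hlg, ← ofReal_integral_eq_lintegral_ofReal hgd (Eventually.of_forall fun x => hg0 _),
    ← ofReal_integral_eq_lintegral_ofReal hFint (Eventually.of_forall fun y => hF.nonneg _),
    ← ENNReal.ofReal_mul (by
      rw [← hgval]; exact integral_nonneg fun s => hg0 s)] at htube
  have hflux0 : 0 ≤ κ⁻¹ * fluxP p (κ * R) := by
    rw [← hgval]; exact integral_nonneg fun s => hg0 s
  have hPF0 : 0 ≤ PF := integral_nonneg fun y => hF.nonneg _
  rw [ENNReal.ofReal_le_ofReal_iff (mul_nonneg hflux0 hPF0)] at htube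
  have hgd' : ∫ x in Ω, g (d x) = p * (∫ x in Ω, c x) - ∫ _ in Ω, (1 : ℝ) := by
    rw [← integral_const_mul, ← integral_sub (hcint.const_mul p) hone]
  rw [hgd'] at htube
  have hDpos : 0 < ∫ x in Ω, c x := by
    have h1 : ∫ _ in Ω, (1 : ℝ) ≤ ∫ x in Ω, c x :=
      integral_mono hone hcint fun x => hc1 x
    have h2 : 0 < ∫ _ in Ω, (1 : ℝ) := by
      rw [setIntegral_const, smul_eq_mul, mul_one]
      exact ENNReal.toReal_pos hΩpos.ne' hΩfin.ne
    linarith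
  rw [rayleigh, hden, hsurf, div_le_iff₀ hDpos]
  have hnum' : ∫ x in Ω, κ ^ p * (c x - 1) = κ ^ p * ((∫ x in Ω, c x) - ∫ _ in Ω, (1 : ℝ)) := by
    rw [integral_const_mul, integral_sub hcint hone]
  rw [hnum'] at hnum
  -- The boundary condition `κ ^ (p - 1) sinh_p ^ (p - 1) = |β| cosh_p ^ (p - 1)` at distance `R`.
  have hbc : κ ^ p * (κ⁻¹ * fluxP p (κ * R)) = |β| * coshP p (κ * R) ^ p := by
    have hch := coshP_pos hp (κ * R)
    rw [← hκβ, riccatiP, Real.div_rpow (sinhP_nonneg hp _) hch.le, fluxP, Real.rpow_sub_one hκ.ne',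
      Real.rpow_sub_one hch.ne']
    field_simp
  have h5 := mul_le_mul_of_nonneg_left htube (Real.rpow_nonneg hκ.le p)
  rw [← mul_assoc, hbc] at h5
  rw [abs_of_neg hβ] at h5
  nlinarith
end Bounded

/-! ### Geometry of the slab -/

section SlabGeometry

variable {n N : ℕ} {p a : ℝ} {F : EuclideanSpace ℝ (Fin N) → ℝ} {e : EuclideanSpace ℝ (Fin N)}

theorem slab_eq_preimage (e : EuclideanSpace ℝ (Fin N)) (a : ℝ) :
    slab e a = innerSL ℝ e ⁻¹' Metric.ball 0 (a / 2) := by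
  ext x
  simp [slab, real_inner_comm]

theorem isOpen_slab (e : EuclideanSpace ℝ (Fin N)) (a : ℝ) : IsOpen (slab e a) := by
  rw [slab_eq_preimage]
  exact Metric.isOpen_ball.preimage (innerSL ℝ e).continuous

theorem isOpenMap_innerSL (he : ‖e‖ = 1) : IsOpenMap (innerSL ℝ e) := by
  refine (innerSL ℝ e).isOpenMap fun t => ⟨t • e, ?_⟩
  simp [he]

theorem mem_frontier_slab (he : ‖e‖ = 1) (ha : 0 < a) {x : EuclideanSpace ℝ (Fin N)} :
    x ∈ frontier (slab e a) ↔ |inner ℝ x e| = a / 2 := by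
  rw [slab_eq_preimage, ← (isOpenMap_innerSL he).preimage_frontier_eq_frontier_preimage
    (innerSL ℝ e).continuous, frontier_ball _ (half_pos ha).ne']
  simp [real_inner_comm]

theorem mem_closure_slab (he : ‖e‖ = 1) (ha : 0 < a) {x : EuclideanSpace ℝ (Fin N)} :
    x ∈ closure (slab e a) ↔ |inner ℝ x e| ≤ a / 2 := by
  rw [slab_eq_preimage, ← (isOpenMap_innerSL he).preimage_closure_eq_closure_preimage
    (innerSL ℝ e).continuous, closure_ball _ (half_pos ha).ne']
  simp [real_inner_comm]

theorem slab_neg (e : EuclideanSpace ℝ (Fin N)) (a : ℝ) : slab (-e) a = slab e a := by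
  ext x
  simp [slab]

theorem gradient_inner_sub (e x : EuclideanSpace ℝ (Fin N)) (c : ℝ) :
    gradient (fun x => inner ℝ x e - c) x = e := by
  refine ext_inner_right ℝ fun w => ?_
  have h : HasFDerivAt (fun x => inner ℝ x e - c) (innerSL ℝ e) x := by
    simp_rw [real_inner_comm e]
    exact ((innerSL ℝ e).hasFDerivAt).sub_const c
  rw [inner_gradient_eq_fderiv, h.fderiv, innerSL_apply_apply]

/-- Near the face where the inner product with `e` is positive, the slab is a half space. -/
theorem isC2DefiningFunction_slab (he : ‖e‖ = 1) (ha : 0 < a) {y : EuclideanSpace ℝ (Fin N)}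
    (hy : inner ℝ y e = a / 2) :
    IsC2DefiningFunction (slab e a) y {x | 0 < inner ℝ x e} (fun x => inner ℝ x e - a / 2) where
  isOpen := isOpen_lt continuous_const (by fun_prop)
  mem := by
    change 0 < inner ℝ y e
    rw [hy]; exact half_pos ha
  contDiffOn := ((contDiff_id.inner ℝ contDiff_const).sub contDiff_const).contDiffOn
  gradient_ne_zero x _ := by
    rw [gradient_inner_sub]
    intro h
    simp [h] at he
  mem_iff x hx := by
    change |inner ℝ x e| < a / 2 ↔ _
    rw [abs_of_pos (show 0 < inner ℝ x e from hx), sub_neg]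
  mem_frontier_iff x hx := by
    rw [mem_frontier_slab he ha, abs_of_pos (show 0 < inner ℝ x e from hx), sub_eq_zero]

theorem exists_isC2DefiningFunction_slab (he : ‖e‖ = 1) (ha : 0 < a) :
    ∀ y ∈ frontier (slab e a), ∃ U ρ, IsC2DefiningFunction (slab e a) y U ρ := by
  intro y hy
  rw [mem_frontier_slab he ha] at hy
  rcases eq_or_eq_neg_of_abs_eq hy with h | h
  · exact ⟨_, _, isC2DefiningFunction_slab he ha h⟩
  · rw [← slab_neg]
    exact ⟨_, _, isC2DefiningFunction_slab (by rwa [norm_neg]) ha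
      (by rw [inner_neg_right, h, neg_neg])⟩

theorem map_outerNormal_slab (hF : IsFinslerNorm p F) (he : ‖e‖ = 1) (ha : 0 < a)
    {y : EuclideanSpace ℝ (Fin N)} (hy : y ∈ frontier (slab e a)) :
    F (outerNormal (slab e a) y) = F e := by
  have hy' := hy
  rw [mem_frontier_slab he ha] at hy
  rcases eq_or_eq_neg_of_abs_eq hy with h | h
  · rw [(isC2DefiningFunction_slab he ha h).outerNormal_eq hy', gradient_inner_sub, he, inv_one,
      one_smul]
  · have h1 := (isC2DefiningFunction_slab (e := -e) (by rwa [norm_neg]) ha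
      (by rw [inner_neg_right, h, neg_neg]))
    rw [slab_neg] at h1
    rw [h1.outerNormal_eq hy', gradient_inner_sub, norm_neg, he, inv_one, one_smul, hF.map_neg]

/-- The anisotropic inradius is attained on the hyperplane in the middle of the slab. -/
theorem inradius_slab (hF : IsFinslerNorm p F) (he : ‖e‖ = 1) (ha : 0 < a) :
    inradius F (slab e a) = a / (2 * F e) := by
  have he0 : e ≠ 0 := by intro h; simp [h] at he
  have hFe := hF.pos he0
  have hv : inner ℝ (gradient F e) e = F e := hF.inner_gradient_self he0
  have hpv := hF.polar_gradient he0
  -- The point of the face `⟨y, e⟩ = σ a / 2` reached from `x` along the anisotropic normal.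
  have hup : ∀ x t : _, |inner ℝ x e + t * F e| = a / 2 →
      distBoundary F (slab e a) x ≤ |t| := by
    intro x t h
    have h1 : x + t • gradient F e ∈ frontier (slab e a) := by
      rw [mem_frontier_slab he ha, inner_add_left, real_inner_smul_left, hv, h]
    refine (hF.distBoundary_le h1 x).trans (le_of_eq ?_)
    rw [sub_add_cancel_left, hF.polar_neg]
    rcases le_total 0 t with ht | ht
    · rw [IsFinslerNorm.polar_smul F ht, hpv, abs_of_nonneg ht, mul_one]
    · rw [← hF.polar_neg, ← neg_smul, IsFinslerNorm.polar_smul F (neg_nonneg.2 ht), hpv,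
        abs_of_nonpos ht, mul_one]
  have hne : (frontier (slab e a)).Nonempty := by
    refine ⟨(a / 2) • e, ?_⟩
    rw [mem_frontier_slab he ha, real_inner_smul_left, real_inner_self_eq_norm_sq, he]
    simp [(half_pos ha).le]
  refine IsGreatest.csSup_eq ⟨⟨0, ?_, ?_⟩, ?_⟩
  · rw [mem_closure_slab he ha]
    simp [(half_pos ha).le]
  · refine le_antisymm ?_ (IsFinslerNorm.le_distBoundary hne fun y hy => ?_)
    · have h := hup 0 (a / (2 * F e)) (by
        rw [inner_zero_left, zero_add, abs_of_pos (by positivity)]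
        field_simp)
      rwa [abs_of_pos (by positivity)] at h
    · rw [mem_frontier_slab he ha] at hy
      rw [zero_sub, hF.polar_neg, div_le_iff₀ (by positivity)]
      have h1 := hF.inner_le_mul_polar e y
      have h2 := hF.inner_le_mul_polar e (-y)
      rw [hF.polar_neg, inner_neg_right] at h2
      rw [real_inner_comm] at h1 h2
      have : |inner ℝ y e| ≤ F e * polar F y := abs_le'.2 ⟨h1, h2⟩
      linarith
  · rintro _ ⟨x, hx, rfl⟩
    rw [mem_closure_slab he ha, abs_le] at hx
    have hR : a / (2 * F e) = (a / 2) / F e := by rw [div_div]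
    rw [hR]
    rcases le_total 0 (inner ℝ x e : ℝ) with h | h
    · refine (hup x ((a / 2 - inner ℝ x e) / F e) ?_).trans ?_
      · rw [div_mul_cancel₀ _ hFe.ne', add_sub_cancel, abs_of_pos (half_pos ha)]
      · rw [abs_of_nonneg (div_nonneg (by linarith) hFe.le)]
        gcongr; linarith
    · refine (hup x ((-(a / 2) - inner ℝ x e) / F e) ?_).trans ?_
      · rw [div_mul_cancel₀ _ hFe.ne', add_sub_cancel, abs_neg, abs_of_pos (half_pos ha)]
      · rw [abs_of_nonpos (div_nonpos_of_nonpos_of_nonneg (by linarith) hFe.le), ← neg_div]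
        gcongr; linarith

end SlabGeometry

/-! ### The one-dimensional Robin inequality -/

section OneDimensional

variable {p : ℝ}

/-- Robin inequality on a half interval. The function `s ↦ κ ^ (p - 1) riccatiP (κ s)` solves a
Riccati equation, and vanishes at `0`, so that by Young's inequality it is a calibration. -/
theorem riccatiP_mul_abs_rpow_le (hp : 1 < p) {κ R : ℝ} (hκ : 0 < κ) (hR : 0 < R) {f f' : ℝ → ℝ}
    (hf : ∀ s, HasDerivAt f (f' s) s) (hf' : Continuous f') :
    κ ^ (p - 1) * riccatiP p (κ * R) * |f R| ^ p ≤
      ∫ s in (0 : ℝ)..R, (|f' s| ^ p + (p - 1) * κ ^ p * |f s| ^ p) := by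
  have hp0 : 0 < p := by linarith
  have hp1 : 0 < p - 1 := by linarith
  have hfc : Continuous f := continuous_iff_continuousAt.2 fun s => (hf s).continuousAt
  set T : ℝ → ℝ := fun s => κ ^ (p - 1) * riccatiP p (κ * s) with hT
  have hTc : Continuous T := continuous_const.mul ((continuous_riccatiP hp).comp
    (continuous_const.mul continuous_id))
  have hφc : Continuous fun s => |f' s| ^ p + (p - 1) * κ ^ p * |f s| ^ p :=
    (hf'.abs.rpow_const fun _ => Or.inr hp0.le).add
      (continuous_const.mul (hfc.abs.rpow_const fun _ => Or.inr hp0.le))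
  have hg : Continuous fun s => T s * |f s| ^ p :=
    hTc.mul (hfc.abs.rpow_const fun _ => Or.inr hp0.le)
  have key := intervalIntegral.sub_le_integral_of_hasDeriv_right_of_le
    (g := fun s => T s * |f s| ^ p)
    (g' := fun s => (κ ^ (p - 1) * ((p - 1) * (1 - riccatiP p (κ * s) ^ (p / (p - 1))) * (κ * 1))) *
      |f s| ^ p + T s * (p * |f s| ^ (p - 2) * f s * f' s))
    (φ := fun s => |f' s| ^ p + (p - 1) * κ ^ p * |f s| ^ p) hR.le hg.continuousOn ?_
    hφc.continuousOn.integrableOn_Icc ?_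
  · have hT0 : T 0 = 0 := by simp [hT, riccatiP_zero hp]
    simpa only [hT0, zero_mul, sub_zero] using key
  · intro s hs
    have h1 : HasDerivAt (fun s => κ * s) (κ * 1) s := (hasDerivAt_id s).const_mul κ
    have h2 := (HasDerivAt.comp (h₂ := riccatiP p) (h := fun s => κ * s) s
      (hasDerivAt_riccatiP hp (mul_pos hκ hs.1)) h1).const_mul (κ ^ (p - 1))
    have h3 := HasDerivAt.comp (h₂ := fun x : ℝ => |x| ^ p) (h := f) s
      (hasDerivAt_abs_rpow (f s) hp) (hf s)
    exact (h2.mul h3).hasDerivWithinAt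
  · intro s _
    have hr0 := riccatiP_nonneg hp (κ * s)
    set r := riccatiP p (κ * s) with hr
    have hT' : T s = κ ^ (p - 1) * r := rfl
    have hfs : |f s| ^ (p - 2) * |f s| = |f s| ^ (p - 1) := by
      rcases eq_or_ne (f s) 0 with h | h
      · rw [h, abs_zero, mul_zero, Real.zero_rpow hp1.ne']
      · rw [← Real.rpow_add_one (abs_ne_zero.2 h)]; congr 1; ring
    have hb0 : 0 ≤ T s * |f s| ^ (p - 1) := by
      rw [hT']; positivity
    have hy := Real.young_inequality_of_nonneg (abs_nonneg (f' s)) hb0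
      (Real.HolderConjugate.conjExponent hp)
    have hq : Real.conjExponent p = p / (p - 1) := rfl
    have e1 : (T s * |f s| ^ (p - 1)) ^ (p / (p - 1)) = κ ^ p * r ^ (p / (p - 1)) * |f s| ^ p := by
      rw [hT', Real.mul_rpow (by positivity) (by positivity),
        Real.mul_rpow (by positivity) hr0, ← Real.rpow_mul hκ.le, ← Real.rpow_mul (abs_nonneg _),
        mul_div_cancel₀ _ hp1.ne']
    rw [hq, e1] at hy
    have e2 : κ ^ (p - 1) * κ = κ ^ p := by
      rw [← Real.rpow_add_one hκ.ne', sub_add_cancel]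
    have e3 : f s * f' s ≤ |f s| * |f' s| := by rw [← abs_mul]; exact le_abs_self _
    have e4 : T s * (p * |f s| ^ (p - 2) * f s * f' s) ≤
        p * (|f' s| * (T s * |f s| ^ (p - 1))) := by
      rw [← hfs]
      have : 0 ≤ T s * p * |f s| ^ (p - 2) := by rw [hT']; positivity
      nlinarith [mul_le_mul_of_nonneg_left e3 this]
    have e5 : p * (|f' s| ^ p / p + κ ^ p * r ^ (p / (p - 1)) * |f s| ^ p / (p / (p - 1))) =
        |f' s| ^ p + (p - 1) * (κ ^ p * r ^ (p / (p - 1)) * |f s| ^ p) := by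
      field_simp
    have e6 := mul_le_mul_of_nonneg_left hy hp0.le
    rw [e5] at e6
    have e7 : (κ ^ (p - 1) * ((p - 1) * (1 - r ^ (p / (p - 1))) * (κ * 1))) * |f s| ^ p =
        (p - 1) * κ ^ p * |f s| ^ p - (p - 1) * (κ ^ p * r ^ (p / (p - 1)) * |f s| ^ p) := by
      rw [← e2]; ring
    rw [e7]
    linarith

/-- Robin inequality on a symmetric interval. -/
theorem robin_interval_le (hp : 1 < p) {κ R : ℝ} (hκ : 0 < κ) (hR : 0 < R) {f f' : ℝ → ℝ}
    (hf : ∀ s, HasDerivAt f (f' s) s) (hf' : Continuous f') :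
    κ ^ (p - 1) * riccatiP p (κ * R) * (|f R| ^ p + |f (-R)| ^ p) ≤
      ∫ s in (-R)..R, (|f' s| ^ p + (p - 1) * κ ^ p * |f s| ^ p) := by
  have hp0 : 0 < p := by linarith
  have hfc : Continuous f := continuous_iff_continuousAt.2 fun s => (hf s).continuousAt
  have hφc : Continuous fun s => |f' s| ^ p + (p - 1) * κ ^ p * |f s| ^ p :=
    (hf'.abs.rpow_const fun _ => Or.inr hp0.le).add
      (continuous_const.mul (hfc.abs.rpow_const fun _ => Or.inr hp0.le))
  have h1 := riccatiP_mul_abs_rpow_le hp hκ hR hf hf'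
  have h2 := riccatiP_mul_abs_rpow_le hp hκ hR (f := fun s => f (-s)) (f' := fun s => -f' (-s))
    (fun s => by
      have := HasDerivAt.comp (h₂ := f) (h := fun s : ℝ => -s) s (hf (-s)) (hasDerivAt_neg s)
      exact this.congr_deriv (by ring)) (hf'.comp continuous_neg).neg
  simp only [abs_neg] at h2
  rw [intervalIntegral.integral_comp_neg (fun s => |f' s| ^ p + (p - 1) * κ ^ p * |f s| ^ p),
    neg_zero] at h2
  rw [← intervalIntegral.integral_add_adjacent_intervals (b := 0)
    (hφc.intervalIntegrable _ _) (hφc.intervalIntegrable _ _)]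
  linarith

end OneDimensional

/-! ### Coordinates along the anisotropic normal of a slab -/

section SlabMeasure

variable {n : ℕ} {p a : ℝ} {F : EuclideanSpace ℝ (Fin (n + 1)) → ℝ}
  {e : EuclideanSpace ℝ (Fin (n + 1))}

/-- Coordinates `(s, z) ↦ ι z + s v` on a slab orthogonal to `e`, where `v = ∇F(e)` is its
anisotropic normal: `ι` parametrizes the hyperplane `e^⊥` isometrically, and the Jacobian is
`⟨v, e⟩ = F(e)`. -/
theorem exists_slab_coordinates (hF : IsFinslerNorm p F) (he : ‖e‖ = 1) (ha : 0 < a) :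
    ∃ ι : EuclideanSpace ℝ (Fin n) →ₗᵢ[ℝ] EuclideanSpace ℝ (Fin (n + 1)),
      (∀ z, inner ℝ (ι z) e = 0) ∧
      MeasurePreserving (fun q : ℝ × EuclideanSpace ℝ (Fin n) => ι q.2 + q.1 • gradient F e)
        (ENNReal.ofReal (F e) • ((volume.restrict
          (Ioo (-inradius F (slab e a)) (inradius F (slab e a)))).prod volume))
        (volume.restrict (slab e a)) ∧
      surfaceMeasure (slab e a) =
        Measure.map (fun z => ι z + inradius F (slab e a) • gradient F e) volume +
        Measure.map (fun z => ι z + (-inradius F (slab e a)) • gradient F e) volume := by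
  have he0 : e ≠ 0 := by intro h; simp [h] at he
  have hFe := hF.pos he0
  have hv : inner ℝ (gradient F e) e = F e := hF.inner_gradient_self he0
  rw [inradius_slab hF he ha]
  set R := a / (2 * F e) with hR
  have hRF : R * F e = a / 2 := by rw [hR]; field_simp
  have hRpos : 0 < R := by positivity
  obtain ⟨ι, hι, hιs, hmp⟩ := exists_frame he
  have hι' : ∀ z, inner ℝ (ι z) e = 0 := fun z => by rw [real_inner_comm]; exact hι z
  obtain ⟨w, hw⟩ := hιs (gradient F e - F e • e) (by
    rw [inner_sub_right, real_inner_comm, hv, inner_smul_right, real_inner_self_eq_norm_sq, he]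
    ring)
  have hS : MeasurableSet (slab e a) := (isOpen_slab e a).measurableSet
  refine ⟨ι, hι', ?_, ?_⟩
  · have h1 : MeasurePreserving (fun s : ℝ => F e * s) (ENNReal.ofReal (F e) • volume) volume := by
      refine ⟨measurable_const_mul _, ?_⟩
      rw [Measure.map_smul]
      simpa [abs_of_pos hFe] using Real.smul_map_volume_mul_left hFe.ne'
    have h2 : MeasurePreserving
        (fun q : ℝ × EuclideanSpace ℝ (Fin n) => (F e * q.1, q.2 + q.1 • w))
        ((ENNReal.ofReal (F e) • volume).prod volume) (volume.prod volume) := by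
      refine h1.skew_product (g := fun s z => z + s • w) ?_ (Eventually.of_forall fun s => ?_)
      · simp only [Function.uncurry_def]; fun_prop
      · exact map_add_right_eq_self _ _
    have h3 := (hmp.comp Measure.measurePreserving_swap).comp h2
    have h4 : (((fun q : EuclideanSpace ℝ (Fin n) × ℝ => ι q.1 + q.2 • e) ∘ Prod.swap) ∘
        fun q : ℝ × EuclideanSpace ℝ (Fin n) => (F e * q.1, q.2 + q.1 • w)) =
        fun q : ℝ × EuclideanSpace ℝ (Fin n) => ι q.2 + q.1 • gradient F e := by
      ext1 q
      simp only [Function.comp_apply, Prod.swap, map_add, map_smul, hw]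
      module
    rw [h4] at h3
    have h5 := h3.restrict_preimage hS
    have h6 : (fun q : ℝ × EuclideanSpace ℝ (Fin n) => ι q.2 + q.1 • gradient F e) ⁻¹' slab e a =
        Ioo (-R) R ×ˢ univ := by
      ext q
      change |inner ℝ (ι q.2 + q.1 • gradient F e) e| < a / 2 ↔ _
      rw [inner_add_left, real_inner_smul_left, hv, hι', zero_add, abs_mul, abs_of_pos hFe, ← hRF,
        mul_lt_mul_iff_left₀ hFe, abs_lt]
      simp
    rw [h6, Measure.prod_smul_left, Measure.restrict_smul, ← Measure.prod_restrict,
      Measure.restrict_univ] at h5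
    exact h5
  · have hiso : ∀ c : EuclideanSpace ℝ (Fin (n + 1)), Isometry fun z => ι z + c := fun c =>
      (isometry_add_right c).comp ι.isometry
    have hrange : ∀ σ : ℝ, range (fun z => ι z + σ • gradient F e) =
        {x | inner ℝ x e = σ * F e} := by
      intro σ
      ext x
      constructor
      · rintro ⟨z, rfl⟩
        change inner ℝ (ι z + σ • gradient F e) e = _
        rw [inner_add_left, real_inner_smul_left, hv, hι', zero_add]
      · intro hx
        obtain ⟨z, hz⟩ := hιs (x - σ • gradient F e) (by
          rw [real_inner_comm, inner_sub_left, real_inner_smul_left, hv,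
            show inner ℝ x e = σ * F e from hx, sub_self])
        exact ⟨z, by change ι z + _ = x; rw [hz, sub_add_cancel]⟩
    have hfr : frontier (slab e a) =
        {x | inner ℝ x e = R * F e} ∪ {x | inner ℝ x e = (-R) * F e} := by
      ext x
      rw [mem_frontier_slab he ha, neg_mul, hRF, abs_eq (half_pos ha).le]
      rfl
    rw [surfaceMeasure, hfr, Measure.restrict_union ?_ ?_, ← hrange, ← hrange, Nat.add_sub_cancel,
      ← (hiso _).map_euclideanHausdorffMeasure, ← (hiso _).map_euclideanHausdorffMeasure,
      EuclideanSpace.euclideanHausdorffMeasure_eq_volume]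
    · rw [Set.disjoint_left]
      intro x hx hx'
      have hx : inner ℝ x e = R * F e := hx
      have hx' : inner ℝ x e = -R * F e := hx'
      nlinarith
    · exact (isClosed_eq (by fun_prop) continuous_const).measurableSet

end SlabMeasure

/-! ### The lower bound on the slab -/

section SlabLower

/-- Convergence in `L^p` implies convergence of the `p`-th powers of the norms. -/
theorem tendsto_integral_norm_rpow {α G : Type*} [MeasurableSpace α] {μ : Measure α}
    [NormedAddCommGroup G] {p : ℝ} (hp : 1 < p) {f : ℕ → α → G} {g : α → G}
    (hf : ∀ k, MemLp (f k) (ENNReal.ofReal p) μ) (hg : MemLp g (ENNReal.ofReal p) μ)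
    (h : Tendsto (fun k => eLpNorm (fun x => f k x - g x) (ENNReal.ofReal p) μ) atTop (𝓝 0)) :
    Tendsto (fun k => ∫ x, ‖f k x‖ ^ p ∂μ) atTop (𝓝 (∫ x, ‖g x‖ ^ p ∂μ)) := by
  have hp0 : 0 < p := by linarith
  have : Fact (1 ≤ ENNReal.ofReal p) := ⟨by
    rw [ENNReal.one_le_ofReal]; exact hp.le⟩
  have key : ∀ {v : α → G} (hv : MemLp v (ENNReal.ofReal p) μ),
      ‖hv.toLp v‖ ^ p = ∫ x, ‖v x‖ ^ p ∂μ := by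
    intro v hv
    have h0 : 0 ≤ ∫ x, ‖v x‖ ^ p ∂μ := integral_nonneg fun x => by positivity
    rw [Lp.norm_toLp, hv.eLpNorm_eq_integral_rpow_norm
      (by simpa using hp0) ENNReal.ofReal_ne_top, ENNReal.toReal_ofReal hp0.le,
      ENNReal.toReal_ofReal (by positivity), Real.rpow_inv_rpow h0 hp0.ne']
  have h1 := (Lp.tendsto_Lp_iff_tendsto_eLpNorm'' f hf g hg).2 h
  have h2 := (h1.norm).rpow_const (p := p) (Or.inr hp0.le)
  simpa only [key] using h2

variable {n : ℕ} {p a β : ℝ} {F : EuclideanSpace ℝ (Fin (n + 1)) → ℝ}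
  {e : EuclideanSpace ℝ (Fin (n + 1))}

theorem hasCompactSupport_comp_isometry {G : Type*} [Zero G]
    {g : EuclideanSpace ℝ (Fin (n + 1)) → G} (hg : HasCompactSupport g)
    (ι : EuclideanSpace ℝ (Fin n) →ₗᵢ[ℝ] EuclideanSpace ℝ (Fin (n + 1)))
    (c : EuclideanSpace ℝ (Fin (n + 1))) : HasCompactSupport fun z => g (ι z + c) :=
  hg.comp_isClosedEmbedding ((isometry_add_right c).comp ι.isometry).isClosedEmbedding

/-- The weighted surface integral over the two faces of a slab. -/
theorem integral_surfaceMeasure_slab (hF : IsFinslerNorm p F) (he : ‖e‖ = 1) (ha : 0 < a)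
    {R : ℝ} {ι : EuclideanSpace ℝ (Fin n) →ₗᵢ[ℝ] EuclideanSpace ℝ (Fin (n + 1))}
    (hι : surfaceMeasure (slab e a) =
      Measure.map (fun z => ι z + R • gradient F e) volume +
      Measure.map (fun z => ι z + (-R) • gradient F e) volume)
    {g : EuclideanSpace ℝ (Fin (n + 1)) → ℝ} (hg : Continuous g) (hgc : HasCompactSupport g) :
    ∫ y, g y * F (outerNormal (slab e a) y) ∂(surfaceMeasure (slab e a)) =
      F e * ((∫ z, g (ι z + R • gradient F e)) +
        ∫ z, g (ι z + (-R) • gradient F e)) := by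
  have h1 : ∫ y, g y * F (outerNormal (slab e a) y) ∂(surfaceMeasure (slab e a)) =
      ∫ y, g y * F e ∂(surfaceMeasure (slab e a)) := by
    refine integral_congr_ae ?_
    rw [surfaceMeasure]
    filter_upwards [ae_restrict_mem isClosed_frontier.measurableSet] with y hy
    rw [map_outerNormal_slab hF he ha hy]
  have hm : ∀ c, AEMeasurable (fun z => ι z + c) volume := fun c =>
    (ι.continuous.add continuous_const).aemeasurable
  have hint : ∀ c, Integrable g (Measure.map (fun z => ι z + c) volume) := fun c => by
    rw [integrable_map_measure hg.aestronglyMeasurable (hm c)]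
    exact Continuous.integrable_of_hasCompactSupport
      (hg.comp (ι.continuous.add continuous_const)) (hasCompactSupport_comp_isometry hgc ι c)
  rw [h1, integral_mul_const, hι, integral_add_measure (hint _) (hint _),
    integral_map (hm _) hg.aestronglyMeasurable, integral_map (hm _) hg.aestronglyMeasurable,
    mul_comm]

/-- The anisotropic norm of a gradient bounds the derivative in the direction `∇F(ξ)`, whose polar
norm is one. -/
theorem abs_fderiv_gradient_le (hF : IsFinslerNorm p F) {ξ : EuclideanSpace ℝ (Fin (n + 1))}
    (hξ : ξ ≠ 0) (ψ : EuclideanSpace ℝ (Fin (n + 1)) → ℝ) (x : EuclideanSpace ℝ (Fin (n + 1))) :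
    |fderiv ℝ ψ x (gradient F ξ)| ≤ F (gradient ψ x) := by
  have hpv := hF.polar_gradient hξ
  have h1 := hF.inner_le_mul_polar (gradient ψ x) (gradient F ξ)
  have h2 := hF.inner_le_mul_polar (gradient ψ x) (-gradient F ξ)
  rw [hF.polar_neg, inner_neg_right] at h2
  rw [hpv, mul_one, inner_gradient_eq_fderiv] at h1 h2
  exact abs_le'.2 ⟨h1, h2⟩

theorem continuous_gradient {ψ : EuclideanSpace ℝ (Fin (n + 1)) → ℝ} (hψ : ContDiff ℝ ∞ ψ) :
    Continuous (gradient ψ) :=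
  (InnerProductSpace.toDual ℝ (EuclideanSpace ℝ (Fin (n + 1)))).symm.continuous.comp
    (hψ.continuous_fderiv (by simp))

theorem hasCompactSupport_gradient {ψ : EuclideanSpace ℝ (Fin (n + 1)) → ℝ}
    (hψ : HasCompactSupport ψ) : HasCompactSupport (gradient ψ) :=
  HasCompactSupport.intro hψ fun _ hx => gradient_eq_zero_of_notMem_tsupport hx

section Coordinates

variable {ι : EuclideanSpace ℝ (Fin n) →ₗᵢ[ℝ] EuclideanSpace ℝ (Fin (n + 1))} {R c : ℝ}
  {v : EuclideanSpace ℝ (Fin (n + 1))} {S : Set (EuclideanSpace ℝ (Fin (n + 1)))}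
  {g : EuclideanSpace ℝ (Fin (n + 1)) → ℝ}

theorem integrable_slab_coordinates (hc : 0 < c)
    (hmp : MeasurePreserving (fun q : ℝ × EuclideanSpace ℝ (Fin n) => ι q.2 + q.1 • v)
      (ENNReal.ofReal c • ((volume.restrict (Ioo (-R) R)).prod volume)) (volume.restrict S))
    (hg : IntegrableOn g S volume) :
    Integrable (fun q : ℝ × EuclideanSpace ℝ (Fin n) => g (ι q.2 + q.1 • v))
      ((volume.restrict (Ioo (-R) R)).prod volume) :=
  (integrable_smul_measure (ENNReal.ofReal_pos.2 hc).ne' ENNReal.ofReal_ne_top).1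
    ((hmp.integrable_comp hg.aestronglyMeasurable).2 hg)

theorem integral_slab (hc : 0 < c)
    (hmp : MeasurePreserving (fun q : ℝ × EuclideanSpace ℝ (Fin n) => ι q.2 + q.1 • v)
      (ENNReal.ofReal c • ((volume.restrict (Ioo (-R) R)).prod volume)) (volume.restrict S))
    (hg : IntegrableOn g S volume) :
    ∫ x in S, g x = c * ∫ z, ∫ s in Ioo (-R) R, g (ι z + s • v) := by
  rw [← hmp.map_eq, integral_map hmp.measurable.aemeasurable
    (by rw [hmp.map_eq]; exact hg.aestronglyMeasurable), integral_smul_measure,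
    ENNReal.toReal_ofReal hc.le, integral_prod_symm _ (integrable_slab_coordinates hc hmp hg),
    smul_eq_mul]

end Coordinates

/-- The Robin inequality on the slab for test functions, by integration of the one-dimensional one
along the lines in the direction `∇F(e)`. -/
theorem robin_slab_le_of_contDiff (hp : 1 < p) (hF : IsFinslerNorm p F) (he : ‖e‖ = 1) (ha : 0 < a)
    {κ : ℝ} (hκ : 0 < κ) (hκβ : κ ^ (p - 1) * riccatiP p (κ * inradius F (slab e a)) = |β|)
    {ψ : EuclideanSpace ℝ (Fin (n + 1)) → ℝ} (hψ : ContDiff ℝ ∞ ψ) (hψc : HasCompactSupport ψ) :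
    |β| * ∫ y, |ψ y| ^ p * F (outerNormal (slab e a) y) ∂(surfaceMeasure (slab e a)) ≤
      (∫ x in slab e a, F (gradient ψ x) ^ p) +
        (p - 1) * κ ^ p * ∫ x in slab e a, |ψ x| ^ p := by
  have hp0 : 0 < p := by linarith
  have he0 : e ≠ 0 := by intro h; simp [h] at he
  have hFe := hF.pos he0
  obtain ⟨ι, -, hmp, hsm⟩ := exists_slab_coordinates hF he ha
  have hR : 0 < inradius F (slab e a) := by rw [inradius_slab hF he ha]; positivity
  set R := inradius F (slab e a) with hRdef
  set v := gradient F e with hv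
  have hψd : ∀ x, HasFDerivAt ψ (fderiv ℝ ψ x) x := fun x =>
    (hψ.differentiable (by simp) x).hasFDerivAt
  have hdc : Continuous (fderiv ℝ ψ) := hψ.continuous_fderiv (by simp)
  have hgc := continuous_gradient hψ
  have hpow : HasCompactSupport fun x => |ψ x| ^ p :=
    hψc.comp_left (g := fun t : ℝ => |t| ^ p) (by simp [Real.zero_rpow hp0.ne'])
  have hpowc : Continuous fun x => |ψ x| ^ p := hψ.continuous.abs.rpow_const fun _ => Or.inr hp0.le
  have hdv : Continuous fun x => |fderiv ℝ ψ x v| ^ p :=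
    ((hdc.clm_apply continuous_const).abs).rpow_const fun _ => Or.inr hp0.le
  have hdvs : HasCompactSupport fun x => |fderiv ℝ ψ x v| ^ p :=
    HasCompactSupport.intro (hψc.fderiv ℝ) fun x hx => by
      rw [image_eq_zero_of_notMem_tsupport hx, zero_apply, abs_zero, Real.zero_rpow hp0.ne']
  have hFc : Continuous fun x => F (gradient ψ x) ^ p :=
    (hF.continuous.comp hgc).rpow_const fun _ => Or.inr hp0.le
  have hFs : HasCompactSupport fun x => F (gradient ψ x) ^ p :=
    HasCompactSupport.intro hψc fun x hx => by
      rw [gradient_eq_zero_of_notMem_tsupport hx, hF.map_zero, Real.zero_rpow hp0.ne']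
  set g : EuclideanSpace ℝ (Fin (n + 1)) → ℝ :=
    fun x => |fderiv ℝ ψ x v| ^ p + (p - 1) * κ ^ p * |ψ x| ^ p with hg
  have hgcont : Continuous g := hdv.add (continuous_const.mul hpowc)
  have hgs : HasCompactSupport g := hdvs.add (hpow.mul_left)
  have hup : ∫ x in slab e a, g x ≤ (∫ x in slab e a, F (gradient ψ x) ^ p) +
      (p - 1) * κ ^ p * ∫ x in slab e a, |ψ x| ^ p := by
    have i1 := (hFc.integrable_of_hasCompactSupport hFs (μ := volume)).integrableOn (s := slab e a)
    have i2 := ((hpowc.integrable_of_hasCompactSupport hpow (μ := volume)).integrableOn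
      (s := slab e a)).const_mul ((p - 1) * κ ^ p)
    rw [← integral_const_mul, ← integral_add i1 i2]
    refine integral_mono (hgcont.integrable_of_hasCompactSupport hgs).integrableOn (i1.add i2)
      fun x => ?_
    exact add_le_add_left (Real.rpow_le_rpow (abs_nonneg _)
      (abs_fderiv_gradient_le hF he0 ψ x) hp0.le) _
  refine le_trans ?_ hup
  have hgS : Integrable g (volume.restrict (slab e a)) :=
    (hgcont.integrable_of_hasCompactSupport hgs).integrableOn
  rw [integral_surfaceMeasure_slab hF he ha hsm hpowc hpow, integral_slab hFe hmp hgS]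
  have hzint : ∀ c, Integrable (fun z => |ψ (ι z + c)| ^ p) volume := fun c =>
    Continuous.integrable_of_hasCompactSupport (hpowc.comp (ι.continuous.add continuous_const))
      (hasCompactSupport_comp_isometry hpow ι c)
  rw [mul_left_comm]
  refine mul_le_mul_of_nonneg_left ?_ hFe.le
  rw [← integral_add (hzint _) (hzint _), ← integral_const_mul]
  refine integral_mono (((hzint _).add (hzint _)).const_mul _) ?_ fun z => ?_
  · exact (integrable_slab_coordinates hFe hmp hgS).swap.integral_prod_left
  · beta_reduce
    rw [← hκβ, ← integral_Ioc_eq_integral_Ioo, ← intervalIntegral.integral_of_le (by linarith)]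
    refine robin_interval_le hp hκ hR (f := fun s => ψ (ι z + s • v))
      (f' := fun s => fderiv ℝ ψ (ι z + s • v) v) (fun s => ?_) ?_
    · exact (hψd _).comp_hasDerivAt s (IsC2DefiningFunction.hasDerivAt_line (ι z) v s)
    · exact (hdc.comp (by fun_prop)).clm_apply continuous_const

/-- The Robin inequality on the slab, for all Sobolev functions. -/
theorem le_rayleigh_slab (hp : 1 < p) (hF : IsFinslerNorm p F) (hβ : β < 0) (he : ‖e‖ = 1)
    (ha : 0 < a) {κ : ℝ} (hκ : 0 < κ)
    (hκβ : κ ^ (p - 1) * riccatiP p (κ * inradius F (slab e a)) = |β|)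
    {u : EuclideanSpace ℝ (Fin (n + 1)) → ℝ}
    {G : EuclideanSpace ℝ (Fin (n + 1)) → EuclideanSpace ℝ (Fin (n + 1))}
    {g : EuclideanSpace ℝ (Fin (n + 1)) → ℝ} (hu : IsSobolev (slab e a) p u G)
    (ht : IsTrace (slab e a) p u G g) (hne : ¬ (u =ᵐ[volume.restrict (slab e a)] 0)) :
    -((p - 1) * κ ^ p) ≤ rayleigh p F β (slab e a) u G g := by
  have hp0 : 0 < p := by linarith
  have hP : ENNReal.ofReal p ≠ 0 := by simpa using hp0
  obtain ⟨hg, φ, hφ, hφc, h1, h2, h3⟩ := ht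
  have := isLocallyFiniteMeasure_surfaceMeasure (exists_isC2DefiningFunction_slab he ha)
  have hFmem : ∀ {μ : Measure (EuclideanSpace ℝ (Fin (n + 1)))}
      {H : EuclideanSpace ℝ (Fin (n + 1)) → EuclideanSpace ℝ (Fin (n + 1))},
      MemLp H (ENNReal.ofReal p) μ → MemLp (fun x => F (H x)) (ENNReal.ofReal p) μ := by
    intro μ H hH
    obtain ⟨C, hC0, hC⟩ := hF.exists_le_norm
    refine MemLp.of_le_mul (c := C) hH (hF.continuous.comp_aestronglyMeasurable hH.1)
      (Eventually.of_forall fun x => ?_)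
    rw [Real.norm_of_nonneg (hF.nonneg _)]
    exact hC _
  have hgm : ∀ k, MemLp (gradient (φ k)) (ENNReal.ofReal p) (volume.restrict (slab e a)) := by
    intro k
    exact (continuous_gradient (hφ k)).memLp_of_hasCompactSupport
      (hasCompactSupport_gradient (hφc k))
  have l1 := tendsto_integral_norm_rpow hp
    (fun k => (hφ k).continuous.memLp_of_hasCompactSupport (hφc k)) hu.memLp h1
  have l3 := tendsto_integral_norm_rpow hp
    (fun k => (hφ k).continuous.memLp_of_hasCompactSupport (hφc k)) hg h3
  have l2 := tendsto_integral_norm_rpow hp (f := fun k x => F (gradient (φ k) x))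
    (g := fun x => F (G x)) (fun k => hFmem (hgm k)) (hFmem hu.memLp_grad) ?_
  swap
  · obtain ⟨C, hC0, hC⟩ := hF.exists_le_norm
    have hb : ∀ x y, |F x - F y| ≤ C * ‖x - y‖ := by
      intro x y
      have a1 := hF.add_le (x - y) y
      have a2 := hF.add_le (y - x) x
      rw [sub_add_cancel] at a1 a2
      have a3 := hC (x - y)
      have a4 := hC (y - x)
      rw [norm_sub_rev] at a4
      exact abs_le.2 ⟨by linarith, by linarith⟩
    have hlim : Tendsto (fun k => ENNReal.ofReal C * eLpNorm (fun x => gradient (φ k) x - G x)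
        (ENNReal.ofReal p) (volume.restrict (slab e a))) atTop (𝓝 0) := by
      simpa using ENNReal.Tendsto.const_mul h2 (Or.inr ENNReal.ofReal_ne_top)
        (a := ENNReal.ofReal C)
    refine tendsto_of_tendsto_of_tendsto_of_le_of_le tendsto_const_nhds hlim (fun _ => zero_le)
      fun k => ?_
    exact eLpNorm_le_mul_eLpNorm_of_ae_le_mul (Eventually.of_forall fun x => hb _ _) _
  simp only [Real.norm_eq_abs, abs_of_nonneg (hF.nonneg _)] at l1 l2 l3
  have hsurf : ∀ w : EuclideanSpace ℝ (Fin (n + 1)) → ℝ,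
      ∫ y, |w y| ^ p * F (outerNormal (slab e a) y) ∂(surfaceMeasure (slab e a)) =
        (∫ y, |w y| ^ p ∂(surfaceMeasure (slab e a))) * F e := by
    intro w
    rw [← integral_mul_const]
    refine integral_congr_ae ?_
    rw [surfaceMeasure]
    filter_upwards [ae_restrict_mem isClosed_frontier.measurableSet] with y hy
    rw [map_outerNormal_slab hF he ha hy]
  have hlim := le_of_tendsto_of_tendsto' ((l3.mul_const (F e)).const_mul |β|)
    (l2.add (l1.const_mul ((p - 1) * κ ^ p))) fun k => by
      rw [← hsurf]
      exact robin_slab_le_of_contDiff hp hF he ha hκ hκβ (hφ k) (hφc k)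
  have hint : Integrable (fun x => |u x| ^ p) (volume.restrict (slab e a)) := by
    simpa [ENNReal.toReal_ofReal hp0.le] using
      hu.memLp.integrable_norm_rpow hP ENNReal.ofReal_ne_top
  have hpos : 0 < ∫ x in slab e a, |u x| ^ p := by
    refine lt_of_le_of_ne (integral_nonneg fun x => by positivity) fun h => hne ?_
    have h0 := (integral_eq_zero_iff_of_nonneg (fun x => by positivity) hint).1 h.symm
    filter_upwards [h0] with x hx
    simpa [Real.rpow_eq_zero (abs_nonneg (u x)) hp0.ne'] using hx
  rw [rayleigh, le_div_iff₀ hpos, hsurf]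
  rw [abs_of_neg hβ] at hlim
  linarith

end SlabLower

/-! ### The upper bound on the slab -/

section SlabUpper

variable {n N : ℕ} {p a β : ℝ}

theorem exists_hasDerivAt_coshP (hp : 1 < p) (t : ℝ) :
    ∃ d, HasDerivAt (coshP p) d t ∧ |d| = sinhP p |t| := by
  rcases le_total 0 t with ht | ht
  · exact ⟨_, hasDerivAt_coshP_of_nonneg hp ht,
      by rw [abs_of_nonneg (sinhP_nonneg hp _), abs_of_nonneg ht]⟩
  · have h := HasDerivAt.comp (h₂ := coshP p) (h := fun s : ℝ => -s) t
      (hasDerivAt_coshP_of_nonneg hp (neg_nonneg.2 ht)) (hasDerivAt_neg t)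
    have e : coshP p ∘ (fun s : ℝ => -s) = coshP p := funext fun s => coshP_neg p s
    rw [e] at h
    exact ⟨_, h, by rw [mul_neg_one, abs_neg, abs_of_nonneg (sinhP_nonneg hp _), abs_of_nonpos ht]⟩

/-- Convexity of `t ↦ t ^ p`, applied to `(1 - ε) (x / (1 - ε)) + ε y`. -/
theorem add_mul_rpow_le (hp : 1 < p) {ε x y : ℝ} (hε : 0 < ε) (hε1 : ε < 1) (hx : 0 ≤ x)
    (hy : 0 ≤ y) : (x + ε * y) ^ p ≤ (1 - ε) ^ (1 - p) * x ^ p + ε * y ^ p := by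
  have h1 : 0 < 1 - ε := by linarith
  have h := (convexOn_rpow hp.le).2 (x := x / (1 - ε)) (div_nonneg hx h1.le) (y := y) hy h1.le hε.le
    (by ring)
  simp only [smul_eq_mul] at h
  rw [mul_div_cancel₀ _ h1.ne', Real.div_rpow hx h1.le] at h
  refine h.trans (le_of_eq ?_)
  rw [Real.rpow_sub h1, Real.rpow_one]
  ring

/-- The test functions of the upper bound: the one-dimensional ground state in the variable `σ`,
with a slow cut-off in the transverse variable `L`. -/
theorem exists_slab_testFunction {F : EuclideanSpace ℝ (Fin N) → ℝ} (hp : 1 < p)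
    (hF : IsFinslerNorm p F) {σ : EuclideanSpace ℝ (Fin N) →L[ℝ] ℝ}
    {L : EuclideanSpace ℝ (Fin N) →L[ℝ] EuclideanSpace ℝ (Fin N)} {v : EuclideanSpace ℝ (Fin N)}
    (hσ : F ((InnerProductSpace.toDual ℝ (EuclideanSpace ℝ (Fin N))).symm σ) = 1)
    (hL : ∀ x, L x + σ x • v = x) {κ R : ℝ} (hκ : 0 < κ) (hR : 0 < R) :
    ∃ D : ℝ, 0 ≤ D ∧ ∀ ε : ℝ, 0 < ε → ∃ (u : EuclideanSpace ℝ (Fin N) → ℝ) (C : ℝ≥0),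
      LipschitzWith C u ∧ HasCompactSupport u ∧
      (∀ x, |σ x| ≤ R → u x = coshP p (κ * σ x) * max 0 (1 - ε * ‖L x‖)) ∧
      ∀ᵐ x, |σ x| < R → F (gradient u x) ≤
        κ * sinhP p |κ * σ x| * max 0 (1 - ε * ‖L x‖) +
          ε * (D * coshP p (κ * σ x) * max 0 (2 - ε * ‖L x‖)) := by
  obtain ⟨CF, hCF0, hCF⟩ := hF.exists_le_norm
  refine ⟨CF * ‖L‖, by positivity, fun ε hε => ?_⟩
  set P : EuclideanSpace ℝ (Fin N) → ℝ := fun x => coshP p (κ * min |σ x| R) with hP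
  set Q : EuclideanSpace ℝ (Fin N) → ℝ :=
    fun x => max 0 (1 - ε * ‖L x‖ - max 0 (|σ x| - R)) with hQ
  set q : EuclideanSpace ℝ (Fin N) → ℝ := fun x => max 0 (1 - ε * ‖L x‖) with hq
  have hmin0 : ∀ x, 0 ≤ min |σ x| R := fun x => le_min (abs_nonneg _) hR.le
  have hPb : ∀ x, |P x| ≤ coshP p (κ * R) := fun x => by
    rw [abs_of_pos (coshP_pos hp _)]
    exact monotoneOn_coshP hp (mul_nonneg hκ.le (hmin0 x)) (mul_nonneg hκ.le hR.le)
      (mul_le_mul_of_nonneg_left (min_le_right _ _) hκ.le)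
  have hQ0 : ∀ x, 0 ≤ Q x := fun x => le_max_left _ _
  have hQb : ∀ x, |Q x| ≤ 1 := fun x => by
    rw [abs_of_nonneg (hQ0 x)]
    refine max_le zero_le_one ?_
    have : 0 ≤ ε * ‖L x‖ := by positivity
    have := le_max_left 0 (|σ x| - R)
    linarith
  have hσb : ∀ x y, |(|σ x| - |σ y|)| ≤ ‖σ‖ * ‖x - y‖ := fun x y => by
    refine (abs_abs_sub_abs_le_abs_sub _ _).trans ?_
    rw [← map_sub]
    exact σ.le_opNorm _
  have hLb : ∀ x y, |(‖L x‖ - ‖L y‖)| ≤ ‖L‖ * ‖x - y‖ := fun x y => by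
    refine (abs_norm_sub_norm_le _ _).trans ?_
    rw [← map_sub]
    exact L.le_opNorm _
  have hPl : ∀ x y, |P x - P y| ≤ sinhP p (κ * R) * (κ * (‖σ‖ * ‖x - y‖)) := fun x y => by
    refine (abs_coshP_sub_le hp (M := κ * R) (mul_nonneg hκ.le (hmin0 y))
      (mul_nonneg hκ.le (hmin0 x)) (mul_le_mul_of_nonneg_left (min_le_right _ _) hκ.le)
      (mul_le_mul_of_nonneg_left (min_le_right _ _) hκ.le)).trans ?_
    refine mul_le_mul_of_nonneg_left ?_ (sinhP_nonneg hp _)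
    rw [← mul_sub, abs_mul, abs_of_pos hκ]
    refine mul_le_mul_of_nonneg_left ((abs_min_sub_min_le_max _ _ _ _).trans ?_) hκ.le
    rw [sub_self, abs_zero]
    exact max_le (hσb x y) (by positivity)
  have hql : ∀ x y, |q x - q y| ≤ ε * (‖L‖ * ‖x - y‖) := fun x y => by
    refine (abs_max_sub_max_le_max _ _ _ _).trans ?_
    rw [sub_self, abs_zero, sub_sub_sub_cancel_left, ← mul_sub, abs_mul, abs_of_pos hε,
      abs_sub_comm]
    exact max_le (by positivity) (mul_le_mul_of_nonneg_left (hLb x y) hε.le)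
  have hQl : ∀ x y, |Q x - Q y| ≤ ε * (‖L‖ * ‖x - y‖) + ‖σ‖ * ‖x - y‖ := fun x y => by
    refine (abs_max_sub_max_le_max _ _ _ _).trans ?_
    rw [sub_self, abs_zero]
    refine max_le (by positivity) ?_
    have h1 : |ε * ‖L x‖ - ε * ‖L y‖| ≤ ε * (‖L‖ * ‖x - y‖) := by
      rw [← mul_sub, abs_mul, abs_of_pos hε]
      exact mul_le_mul_of_nonneg_left (hLb x y) hε.le
    have h2 : |max 0 (|σ x| - R) - max 0 (|σ y| - R)| ≤ ‖σ‖ * ‖x - y‖ := by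
      refine (abs_max_sub_max_le_max _ _ _ _).trans ?_
      rw [sub_self, abs_zero, sub_sub_sub_cancel_right]
      exact max_le (by positivity) (hσb x y)
    rw [abs_le] at h1 h2 ⊢
    constructor <;> linarith
  have hqL : LipschitzWith ⟨ε * ‖L‖, by positivity⟩ q := LipschitzWith.of_dist_le_mul fun x y => by
    rw [Real.dist_eq, dist_eq_norm]
    refine (hql x y).trans (le_of_eq ?_)
    rw [← mul_assoc]; rfl
  have hQq : ∀ x, |σ x| ≤ R → Q x = q x := fun x hx => by
    simp only [hQ, hq]
    rw [max_eq_left (sub_nonpos.2 hx), sub_zero]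
  have hPc : ∀ x, |σ x| ≤ R → P x = coshP p (κ * σ x) := fun x hx => by
    simp only [hP]
    rw [min_eq_left hx, ← coshP_abs p (κ * σ x), abs_mul, abs_of_pos hκ]
  have hB0 := sinhP_nonneg hp (κ * R)
  have hc0 := coshP_pos hp (κ * R)
  refine ⟨fun x => P x * Q x, ⟨coshP p (κ * R) * (ε * ‖L‖ + ‖σ‖) + sinhP p (κ * R) * (κ * ‖σ‖),
    by positivity⟩, LipschitzWith.of_dist_le_mul fun x y => ?_, ?_, fun x hx => ?_, ?_⟩
  · rw [Real.dist_eq, dist_eq_norm]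
    have e1 : P x * Q x - P y * Q y = P x * (Q x - Q y) + Q y * (P x - P y) := by ring
    have e2 : |P x * (Q x - Q y)| ≤ coshP p (κ * R) * (ε * (‖L‖ * ‖x - y‖) + ‖σ‖ * ‖x - y‖) := by
      rw [abs_mul]
      exact mul_le_mul (hPb x) (hQl x y) (abs_nonneg _) hc0.le
    have e3 : |Q y * (P x - P y)| ≤ 1 * (sinhP p (κ * R) * (κ * (‖σ‖ * ‖x - y‖))) := by
      rw [abs_mul]
      exact mul_le_mul (hQb y) (hPl x y) (abs_nonneg _) zero_le_one
    rw [e1]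
    refine (abs_add_le _ _).trans ((add_le_add e2 e3).trans (le_of_eq ?_))
    change _ = (coshP p (κ * R) * (ε * ‖L‖ + ‖σ‖) + sinhP p (κ * R) * (κ * ‖σ‖)) * ‖x - y‖
    ring
  · refine HasCompactSupport.intro
      (isCompact_closedBall (0 : EuclideanSpace ℝ (Fin N)) (ε⁻¹ + (R + 1) * ‖v‖)) fun x hx => ?_
    rw [mem_closedBall_zero_iff] at hx
    have hQx : Q x = 0 := by
      refine max_eq_left (not_lt.1 fun h => hx ?_)
      have h1 := le_max_left 0 (|σ x| - R)
      have h2 := le_max_right 0 (|σ x| - R)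
      have h3 : 0 ≤ ε * ‖L x‖ := by positivity
      have h4 : ‖L x‖ ≤ ε⁻¹ := by
        rw [← one_div, le_div_iff₀ hε]; linarith
      have h5 : |σ x| ≤ R + 1 := by linarith
      have h6 : ‖σ x • v‖ ≤ (R + 1) * ‖v‖ := by
        rw [norm_smul, Real.norm_eq_abs]
        exact mul_le_mul_of_nonneg_right h5 (norm_nonneg _)
      calc ‖x‖ = ‖L x + σ x • v‖ := by rw [hL]
        _ ≤ _ := (norm_add_le _ _).trans (add_le_add h4 h6)
    rw [hQx, mul_zero]
  · beta_reduce
    rw [hPc x hx, hQq x hx]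
  · filter_upwards [hqL.ae_differentiableAt (μ := volume)] with x hqx hx
    obtain ⟨d, hd, hdabs⟩ := exists_hasDerivAt_coshP hp (κ * σ x)
    have h1 : HasFDerivAt (fun x => coshP p (κ * σ x)) (d • (κ • σ)) x :=
      hd.comp_hasFDerivAt x (f := fun x => κ * σ x) (σ.hasFDerivAt.const_mul κ)
    have h2 : HasFDerivAt (fun x => P x * Q x)
        (coshP p (κ * σ x) • fderiv ℝ q x + q x • (d • (κ • σ))) x := by
      refine (h1.mul hqx.hasFDerivAt).congr_of_eventuallyEq ?_
      have : ∀ᶠ z in 𝓝 x, |σ z| < R :=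
        (σ.continuous.abs).continuousAt.eventually_lt continuousAt_const hx
      filter_upwards [this] with z hz
      rw [hPc z hz.le, hQq z hz.le]
      rfl
    have h3 : gradient (fun x => P x * Q x) x = coshP p (κ * σ x) • gradient q x +
        (q x * d * κ) • (InnerProductSpace.toDual ℝ (EuclideanSpace ℝ (Fin N))).symm σ := by
      simp only [gradient, h2.fderiv, map_add, map_smul, smul_smul, mul_assoc]
    have hq0 : 0 ≤ q x := le_max_left _ _
    have hch := coshP_pos hp (κ * σ x)
    have h4 : F ((q x * d * κ) • (InnerProductSpace.toDual ℝ (EuclideanSpace ℝ (Fin N))).symm σ) =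
        κ * sinhP p |κ * σ x| * q x := by
      rw [hF.homogeneous, hσ, mul_one, abs_mul, abs_mul, hdabs, abs_of_nonneg hq0, abs_of_pos hκ]
      ring
    have h5 : F (gradient q x) ≤ ε * (CF * ‖L‖ * max 0 (2 - ε * ‖L x‖)) := by
      -- The factor `2 - ε ‖L x‖` is at least one on the support of the cut-off; unlike the
      -- indicator function of the support it is continuous.
      rcases le_or_gt (ε * ‖L x‖) 1 with h | h
      · have h6 : 1 ≤ max 0 (2 - ε * ‖L x‖) := le_max_of_le_right (by linarith)
        have h7 : ‖gradient q x‖ ≤ ε * ‖L‖ := norm_gradient_le hqL x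
        calc F (gradient q x) ≤ CF * (ε * ‖L‖) :=
              (hCF _).trans (mul_le_mul_of_nonneg_left h7 hCF0.le)
          _ = ε * (CF * ‖L‖ * 1) := by ring
          _ ≤ _ := by gcongr
      · rw [gradient_eq_zero_of_notMem_tsupport, hF.map_zero]
        · have := le_max_left 0 (2 - ε * ‖L x‖)
          positivity
        · intro hx'
          have hcl : IsClosed {z | ε * ‖L z‖ ≤ 1} :=
            isClosed_le (continuous_const.mul L.continuous.norm) continuous_const
          have : tsupport q ⊆ {z | ε * ‖L z‖ ≤ 1} := closure_minimal (fun z hz => by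
            by_contra h'
            have h' : 1 < ε * ‖L z‖ := not_le.1 h'
            exact hz (max_eq_left (by linarith))) hcl
          exact absurd (this hx') (not_le.2 h)
    rw [h3]
    refine (hF.add_le _ _).trans ?_
    rw [h4, hF.map_smul_of_nonneg hch.le, add_comm]
    refine add_le_add le_rfl ?_
    calc coshP p (κ * σ x) * F (gradient q x)
        ≤ coshP p (κ * σ x) * (ε * (CF * ‖L‖ * max 0 (2 - ε * ‖L x‖))) :=
          mul_le_mul_of_nonneg_left h5 hch.le
      _ = _ := by ring

theorem continuous_cutoff_rpow (hp : 1 < p) (c ε : ℝ) :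
    Continuous fun r : ℝ => max 0 (c - ε * r) ^ p :=
  (continuous_const.max (continuous_const.sub (continuous_const.mul continuous_id))).rpow_const
    fun _ => Or.inr (by linarith)

theorem integrable_cutoff_rpow (hp : 1 < p) (c : ℝ) {ε : ℝ} (hε : 0 < ε) :
    Integrable (fun z : EuclideanSpace ℝ (Fin n) => max 0 (c - ε * ‖z‖) ^ p) volume := by
  refine Continuous.integrable_of_hasCompactSupport ((continuous_cutoff_rpow hp c ε).comp
    continuous_norm) ?_
  refine HasCompactSupport.intro (isCompact_closedBall (0 : EuclideanSpace ℝ (Fin n)) (c / ε))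
    fun z hz => ?_
  rw [mem_closedBall_zero_iff, not_le, div_lt_iff₀ hε] at hz
  rw [max_eq_left (by linarith), Real.zero_rpow (by linarith)]

theorem integral_cutoff_rpow (c : ℝ) {ε : ℝ} (hε : 0 < ε) :
    ∫ z : EuclideanSpace ℝ (Fin n), max 0 (c - ε * ‖z‖) ^ p =
      (ε ^ n)⁻¹ * ∫ z : EuclideanSpace ℝ (Fin n), max 0 (c - ‖z‖) ^ p := by
  have h := Measure.integral_comp_smul (volume : Measure (EuclideanSpace ℝ (Fin n)))
    (fun z => max 0 (c - ‖z‖) ^ p) ε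
  simpa [norm_smul, abs_of_pos hε] using h

theorem integral_cutoff_rpow_pos (hp : 1 < p) :
    0 < ∫ z : EuclideanSpace ℝ (Fin n), max 0 (1 - ‖z‖) ^ p := by
  have hp0 : 0 < p := by linarith
  have hi : Integrable (fun z : EuclideanSpace ℝ (Fin n) => max 0 (1 - ‖z‖) ^ p) volume := by
    simpa using integrable_cutoff_rpow hp 1 one_pos
  have hc : Continuous fun z : EuclideanSpace ℝ (Fin n) => max 0 (1 - ‖z‖) ^ p := by
    exact ((continuous_const.max (continuous_const.sub continuous_norm))).rpow_const
      fun _ => Or.inr hp0.le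
  refine hc.integral_pos_of_hasCompactSupport_nonneg_nonzero ?_ (fun z => by positivity) (x := 0) ?_
  · refine HasCompactSupport.intro (isCompact_closedBall (0 : EuclideanSpace ℝ (Fin n)) 1)
      fun z hz => ?_
    rw [mem_closedBall_zero_iff, not_le] at hz
    rw [max_eq_left (by linarith), Real.zero_rpow hp0.ne']
  · simp

/-- The two integrals of the one-dimensional ground state are linked by its flux at the end points,
which the Robin condition prescribes. -/
theorem integral_groundState (hp : 1 < p) {κ R b : ℝ} (hκ : 0 < κ) (hR : 0 < R)
    (hκb : κ ^ (p - 1) * riccatiP p (κ * R) = b) :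
    (∫ s in Ioo (-R) R, (κ * sinhP p |κ * s|) ^ p) - 2 * b * coshP p (κ * R) ^ p =
      -((p - 1) * κ ^ p) * ∫ s in Ioo (-R) R, coshP p (κ * s) ^ p := by
  have hp0 : 0 < p := by linarith
  have hcc : Continuous fun s => coshP p (κ * s) ^ p := ((continuous_coshP hp).comp
    (continuous_const.mul continuous_id)).rpow_const fun _ => Or.inr hp0.le
  have hgc : Continuous fun s => p * coshP p (κ * s) ^ p - 1 :=
    (continuous_const.mul hcc).sub continuous_const
  have hval : ∫ s in (0 : ℝ)..R, (p * coshP p (κ * s) ^ p - 1) = κ⁻¹ * fluxP p (κ * R) := by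
    rw [intervalIntegral.integral_comp_mul_left (fun s => p * coshP p s ^ p - 1) hκ.ne',
      mul_zero, integral_fluxP hp (mul_pos hκ hR).le, smul_eq_mul]
  have hneg : ∫ s in (-R)..0, (p * coshP p (κ * s) ^ p - 1) = κ⁻¹ * fluxP p (κ * R) := by
    have h := intervalIntegral.integral_comp_neg (a := 0) (b := R)
      (fun s => p * coshP p (κ * s) ^ p - 1)
    simp only [mul_neg, coshP_neg, neg_zero] at h
    rw [← h, hval]
  have hIoo : ∀ f : ℝ → ℝ, ∫ s in Ioo (-R) R, f s = ∫ s in (-R)..R, f s := fun f => by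
    rw [intervalIntegral.integral_of_le (by linarith), integral_Ioc_eq_integral_Ioo]
  have htot : p * (∫ s in (-R)..R, coshP p (κ * s) ^ p) - 2 * R =
      2 * (κ⁻¹ * fluxP p (κ * R)) := by
    have h := intervalIntegral.integral_add_adjacent_intervals
      (hgc.intervalIntegrable (μ := volume) (-R) 0) (hgc.intervalIntegrable (μ := volume) 0 R)
    rw [hval, hneg, intervalIntegral.integral_sub
      ((hcc.intervalIntegrable _ _).const_mul p)
      (continuous_const.intervalIntegrable _ _), intervalIntegral.integral_const_mul,
      intervalIntegral.integral_const, smul_eq_mul] at h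
    linarith
  have hsinh : ∫ s in (-R)..R, (κ * sinhP p |κ * s|) ^ p =
      κ ^ p * ((∫ s in (-R)..R, coshP p (κ * s) ^ p) - 2 * R) := by
    have e : ∀ s, (κ * sinhP p |κ * s|) ^ p = κ ^ p * (coshP p (κ * s) ^ p - 1) := fun s => by
      rw [Real.mul_rpow hκ.le (sinhP_nonneg hp _), sinhP_rpow hp, coshP_abs]
    simp only [e]
    rw [intervalIntegral.integral_const_mul, intervalIntegral.integral_sub
      (hcc.intervalIntegrable _ _) (continuous_const.intervalIntegrable _ _),
      intervalIntegral.integral_const, smul_eq_mul]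
    ring
  have hbc : κ ^ p * (κ⁻¹ * fluxP p (κ * R)) = b * coshP p (κ * R) ^ p := by
    have hch := coshP_pos hp (κ * R)
    rw [← hκb, riccatiP, Real.div_rpow (sinhP_nonneg hp _) hch.le, fluxP, Real.rpow_sub_one hκ.ne',
      Real.rpow_sub_one hch.ne']
    field_simp
  rw [hIoo, hIoo, hsinh]
  linear_combination (κ ^ p) * htot + 2 * hbc

end SlabUpper

section SlabEigenvalue

variable {n : ℕ} {p a β : ℝ}

/-- Fubini's theorem in slab coordinates, for a product of a function of `s` and a radial function
of `z`. -/
theorem integral_slab_mul {ι : EuclideanSpace ℝ (Fin n) →ₗᵢ[ℝ] EuclideanSpace ℝ (Fin (n + 1))}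
    {R c : ℝ} {v : EuclideanSpace ℝ (Fin (n + 1))} {S : Set (EuclideanSpace ℝ (Fin (n + 1)))}
    {σ : EuclideanSpace ℝ (Fin (n + 1)) →L[ℝ] ℝ}
    {L : EuclideanSpace ℝ (Fin (n + 1)) →L[ℝ] EuclideanSpace ℝ (Fin (n + 1))} (hc : 0 < c)
    (hmp : MeasurePreserving (fun q : ℝ × EuclideanSpace ℝ (Fin n) => ι q.2 + q.1 • v)
      (ENNReal.ofReal c • ((volume.restrict (Ioo (-R) R)).prod volume)) (volume.restrict S))
    (hσ : ∀ z (s : ℝ), σ (ι z + s • v) = s)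
    (hL : ∀ z (s : ℝ), L (ι z + s • v) = ι z) {f h : ℝ → ℝ}
    (hf : Continuous f) (hh : Continuous h)
    (hhi : Integrable (fun z : EuclideanSpace ℝ (Fin n) => h ‖z‖) volume) :
    IntegrableOn (fun x => f (σ x) * h ‖L x‖) S volume ∧
      ∫ x in S, f (σ x) * h ‖L x‖ =
        c * ((∫ s in Ioo (-R) R, f s) * ∫ z : EuclideanSpace ℝ (Fin n), h ‖z‖) := by
  have hcont : Continuous fun x => f (σ x) * h ‖L x‖ :=
    (hf.comp σ.continuous).mul (hh.comp L.continuous.norm)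
  have hfi : Integrable f (volume.restrict (Ioo (-R) R)) :=
    (hf.continuousOn.integrableOn_Icc (a := -R) (b := R)).mono_set Ioo_subset_Icc_self
  have e : (fun x => f (σ x) * h ‖L x‖) ∘
      (fun q : ℝ × EuclideanSpace ℝ (Fin n) => ι q.2 + q.1 • v) =
      fun q : ℝ × EuclideanSpace ℝ (Fin n) => f q.1 * h ‖q.2‖ := by
    ext1 q
    simp only [Function.comp_apply, hσ, hL, ι.norm_map]
  constructor
  · refine (hmp.integrable_comp hcont.aestronglyMeasurable).1 ?_
    rw [e]
    exact (hfi.mul_prod hhi).smul_measure ENNReal.ofReal_ne_top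
  · rw [← hmp.map_eq, integral_map hmp.measurable.aemeasurable hcont.aestronglyMeasurable]
    change ∫ q, ((fun x => f (σ x) * h ‖L x‖) ∘
      (fun q : ℝ × EuclideanSpace ℝ (Fin n) => ι q.2 + q.1 • v)) q ∂_ = _
    rw [e, integral_smul_measure, ENNReal.toReal_ofReal hc.le, smul_eq_mul,
      ← integral_prod_mul f (fun z : EuclideanSpace ℝ (Fin n) => h ‖z‖)]

variable {F : EuclideanSpace ℝ (Fin (n + 1)) → ℝ} {e : EuclideanSpace ℝ (Fin (n + 1))}

/-- The linear coordinates of a slab: `σ` vanishes on `e^⊥` and `L` is the projection onto `e^⊥`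
along the anisotropic normal `∇F(e)`. -/
theorem exists_slab_projections (hF : IsFinslerNorm p F) (he : ‖e‖ = 1) :
    ∃ (σ : EuclideanSpace ℝ (Fin (n + 1)) →L[ℝ] ℝ)
      (L : EuclideanSpace ℝ (Fin (n + 1)) →L[ℝ] EuclideanSpace ℝ (Fin (n + 1))),
      F ((InnerProductSpace.toDual ℝ (EuclideanSpace ℝ (Fin (n + 1)))).symm σ) = 1 ∧
      (∀ x, σ x = inner ℝ x e / F e) ∧ (∀ x, L x + σ x • gradient F e = x) ∧
      ∀ z (s : ℝ), inner ℝ z e = 0 →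
        σ (z + s • gradient F e) = s ∧ L (z + s • gradient F e) = z := by
  have he0 : e ≠ 0 := by intro h; simp [h] at he
  have hFe := hF.pos he0
  have hv : inner ℝ (gradient F e) e = F e := hF.inner_gradient_self he0
  set σ : EuclideanSpace ℝ (Fin (n + 1)) →L[ℝ] ℝ :=
    InnerProductSpace.toDual ℝ (EuclideanSpace ℝ (Fin (n + 1))) ((F e)⁻¹ • e) with hσ
  have hσa : ∀ x, σ x = inner ℝ x e / F e := fun x => by
    rw [hσ, InnerProductSpace.toDual_apply_apply, real_inner_smul_left, real_inner_comm,
      div_eq_inv_mul]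
  have hσz : ∀ z s, inner ℝ z e = 0 → σ (z + s • gradient F e) = s := fun z s hz => by
    rw [hσa, inner_add_left, hz, real_inner_smul_left, hv, zero_add,
      mul_div_cancel_right₀ _ hFe.ne']
  refine ⟨σ, ContinuousLinearMap.id ℝ _ - σ.smulRight (gradient F e), ?_, hσa, fun x => ?_,
    fun z s hz => ⟨hσz z s hz, ?_⟩⟩
  · rw [hσ, LinearIsometryEquiv.symm_apply_apply, hF.map_smul_of_nonneg (inv_nonneg.2 hFe.le),
      inv_mul_cancel₀ hFe.ne']
  · simp
  · simp only [sub_apply, ContinuousLinearMap.id_apply, ContinuousLinearMap.smulRight_apply,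
      hσz z s hz, add_sub_cancel_right]

theorem integral_coshP_rpow_pos (hp : 1 < p) (κ : ℝ) {R : ℝ} (hR : 0 < R) :
    0 < ∫ s in Ioo (-R) R, coshP p (κ * s) ^ p := by
  have hcc : Continuous fun s => coshP p (κ * s) ^ p := ((continuous_coshP hp).comp
    (continuous_const.mul continuous_id)).rpow_const fun _ => Or.inr (by linarith)
  have hi : IntegrableOn (fun s => coshP p (κ * s) ^ p) (Ioo (-R) R) volume :=
    (hcc.continuousOn.integrableOn_Icc).mono_set Ioo_subset_Icc_self
  have h1 : ∫ _ in Ioo (-R) R, (1 : ℝ) ≤ ∫ s in Ioo (-R) R, coshP p (κ * s) ^ p :=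
    integral_mono (integrableOn_const (by simp)) hi
      fun s => Real.one_le_rpow (one_le_coshP hp _) (by linarith)
  have h2 : ∫ _ in Ioo (-R) R, (1 : ℝ) = 2 * R := by
    rw [setIntegral_const, Real.volume_real_Ioo_of_le (by linarith), smul_eq_mul]; ring
  linarith

/-- Upper bound on the slab, with an error term that comes from the transverse cut-off at scale
`1 / ε`. -/
theorem exists_robinEigenvalue_slab_le (hp : 1 < p) (hF : IsFinslerNorm p F)
    (he : ‖e‖ = 1) (ha : 0 < a) {κ : ℝ} (hκ : 0 < κ) :
    ∃ D : ℝ, ∀ ε : ℝ, 0 < ε → ε < 1 → robinEigenvalue p F β (slab e a) ≤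
      ((((1 - ε) ^ (1 - p) *
          (∫ s in Ioo (-inradius F (slab e a)) (inradius F (slab e a)),
            (κ * sinhP p |κ * s|) ^ p) + ε * D +
          2 * β * coshP p (κ * inradius F (slab e a)) ^ p) /
        ∫ s in Ioo (-inradius F (slab e a)) (inradius F (slab e a)), coshP p (κ * s) ^ p : ℝ) :
          EReal) := by
  have hp0 : 0 < p := by linarith
  have he0 : e ≠ 0 := by intro h; simp [h] at he
  have hFe := hF.pos he0
  obtain ⟨ι, hιe, hmp, hsm⟩ := exists_slab_coordinates hF he ha
  obtain ⟨σ, L, hσF, hσ, hL, hσL⟩ := exists_slab_projections hF he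
  have hRa : inradius F (slab e a) * F e = a / 2 := by
    rw [inradius_slab hF he ha]; field_simp
  have hR : 0 < inradius F (slab e a) := by rw [inradius_slab hF he ha]; positivity
  have := isLocallyFiniteMeasure_surfaceMeasure (exists_isC2DefiningFunction_slab he ha)
  generalize inradius F (slab e a) = R at *
  have hS : ∀ x ∈ slab e a, |σ x| < R := fun x hx => by
    rw [hσ, abs_div, abs_of_pos hFe, div_lt_iff₀ hFe, hRa]
    exact hx
  have hSm : MeasurableSet (slab e a) := (isOpen_slab e a).measurableSet
  obtain ⟨D, hD, htest⟩ := exists_slab_testFunction hp hF hσF hL hκ hR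
  set H₁ := ∫ z : EuclideanSpace ℝ (Fin n), max 0 (1 - ‖z‖) ^ p with hH₁
  set H₂ := ∫ z : EuclideanSpace ℝ (Fin n), max 0 (2 - ‖z‖) ^ p with hH₂
  have hH₁pos : 0 < H₁ := integral_cutoff_rpow_pos hp
  set A := ∫ s in Ioo (-R) R, (κ * sinhP p |κ * s|) ^ p with hA
  set B := ∫ s in Ioo (-R) R, coshP p (κ * s) ^ p with hB
  have hcc : Continuous fun s => coshP p (κ * s) ^ p := ((continuous_coshP hp).comp
    (continuous_const.mul continuous_id)).rpow_const fun _ => Or.inr hp0.le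
  have hsc : Continuous fun s => (κ * sinhP p |κ * s|) ^ p :=
    (continuous_const.mul ((continuous_sinhP hp).comp
      (continuous_const.mul continuous_id).abs)).rpow_const fun _ => Or.inr hp0.le
  have hBpos : 0 < B := integral_coshP_rpow_pos hp κ hR
  refine ⟨D ^ p * B * H₂ / H₁, fun ε hε hε1 => ?_⟩
  obtain ⟨u, C, huL, huc, hu, hgrad⟩ := htest ε hε
  set m := (ε ^ n)⁻¹ with hm
  have hmpos : 0 < m := by positivity
  have hprod := fun (f : ℝ → ℝ) (c : ℝ) (hf : Continuous f) =>
    integral_slab_mul hFe hmp (fun z s => (hσL (ι z) s (hιe z)).1)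
      (fun z s => (hσL (ι z) s (hιe z)).2) hf (continuous_cutoff_rpow hp c ε)
      (integrable_cutoff_rpow hp c hε)
  obtain ⟨iB, vB⟩ := hprod _ 1 hcc
  obtain ⟨iA, vA⟩ := hprod _ 1 hsc
  obtain ⟨iB₂, vB₂⟩ := hprod _ 2 hcc
  rw [integral_cutoff_rpow (p := p) (n := n) _ hε] at vA vB vB₂
  have hden : ∫ x in slab e a, |u x| ^ p = F e * (B * (m * H₁)) := by
    rw [← vB]
    refine setIntegral_congr_fun hSm fun x hx => ?_
    beta_reduce
    rw [hu x (hS x hx).le, abs_of_nonneg (mul_nonneg (coshP_pos hp _).le (le_max_left _ _)),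
      Real.mul_rpow (coshP_pos hp _).le (le_max_left _ _)]
  have hdenpos : 0 < ∫ x in slab e a, |u x| ^ p := by rw [hden]; positivity
  have hne : ¬ (u =ᵐ[volume.restrict (slab e a)] 0) := by
    intro h
    refine hdenpos.ne' (integral_eq_zero_of_ae ?_)
    filter_upwards [h] with x hx
    rw [hx, Pi.zero_apply, abs_zero, Real.zero_rpow hp0.ne']
  have hnum : ∫ x in slab e a, F (gradient u x) ^ p ≤
      (1 - ε) ^ (1 - p) * (F e * (A * (m * H₁))) + ε * D ^ p * (F e * (B * (m * H₂))) := by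
    rw [← vA, ← vB₂, ← integral_const_mul, ← integral_const_mul,
      ← integral_add (iA.const_mul _) (iB₂.const_mul _)]
    refine integral_mono_of_nonneg (Eventually.of_forall fun x => Real.rpow_nonneg (hF.nonneg _) _)
      ((iA.const_mul _).add (iB₂.const_mul _)) ?_
    filter_upwards [ae_restrict_mem hSm, ae_restrict_of_ae hgrad] with x hx hgx
    have hq1 : 0 ≤ max 0 (1 - ε * ‖L x‖) := le_max_left _ _
    have hq2 : 0 ≤ max 0 (2 - ε * ‖L x‖) := le_max_left _ _
    have hs0 := sinhP_nonneg hp |κ * σ x|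
    have hc0 := (coshP_pos hp (κ * σ x)).le
    refine (Real.rpow_le_rpow (hF.nonneg _) (hgx (hS x hx)) hp0.le).trans
      ((add_mul_rpow_le hp hε hε1 (by positivity) (by positivity)).trans (le_of_eq ?_))
    rw [Real.mul_rpow (by positivity) hq1, Real.mul_rpow (by positivity) hq2, Real.mul_rpow hD hc0]
    ring
  have hpow : HasCompactSupport fun x => |u x| ^ p :=
    HasCompactSupport.intro huc fun x hx => by
      rw [image_eq_zero_of_notMem_tsupport hx, abs_zero, Real.zero_rpow hp0.ne']
  have hface : ∀ s : ℝ, |s| = R → ∫ z, |u (ι z + s • gradient F e)| ^ p =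
      coshP p (κ * R) ^ p * (m * H₁) := by
    intro s hs
    rw [hH₁, hm, ← integral_cutoff_rpow (p := p) (n := n) 1 hε, ← integral_const_mul]
    refine integral_congr_ae (Eventually.of_forall fun z => ?_)
    beta_reduce
    have h1 := hσL (ι z) s (hιe z)
    rw [hu _ (by rw [h1.1, hs]), h1.1, h1.2, ι.norm_map,
      abs_of_nonneg (mul_nonneg (coshP_pos hp _).le (le_max_left _ _)),
      Real.mul_rpow (coshP_pos hp _).le (le_max_left _ _), ← coshP_abs p (κ * s), abs_mul, hs,
      abs_of_pos hκ]
  have hsurf : ∫ y, |u y| ^ p * F (outerNormal (slab e a) y) ∂(surfaceMeasure (slab e a)) =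
      F e * (coshP p (κ * R) ^ p * (m * H₁) + coshP p (κ * R) ^ p * (m * H₁)) := by
    rw [integral_surfaceMeasure_slab hF he ha hsm
      (huL.continuous.abs.rpow_const fun _ => Or.inr hp0.le) hpow, hface R (abs_of_pos hR),
      hface (-R) (by rw [abs_neg, abs_of_pos hR])]
  refine (robinEigenvalue_le_of_lipschitz hp huL huc hne).trans (EReal.coe_le_coe_iff.2 ?_)
  rw [rayleigh, hsurf, hden, div_le_div_iff₀ (by positivity) hBpos]
  have hmul := mul_le_mul_of_nonneg_right hnum hBpos.le
  refine (le_of_eq (add_mul _ _ _)).trans ((add_le_add hmul le_rfl).trans (le_of_eq ?_))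
  field_simp
  ring

/-- The upper bound on the slab, in the limit of a slow transverse cut-off. -/
theorem robinEigenvalue_slab_le (hp : 1 < p) (hF : IsFinslerNorm p F) (hβ : β < 0)
    (he : ‖e‖ = 1) (ha : 0 < a) {κ : ℝ} (hκ : 0 < κ)
    (hκβ : κ ^ (p - 1) * riccatiP p (κ * inradius F (slab e a)) = |β|) :
    robinEigenvalue p F β (slab e a) ≤ ((-((p - 1) * κ ^ p) : ℝ) : EReal) := by
  have hp0 : 0 < p := by linarith
  have he0 : e ≠ 0 := by intro h; simp [h] at he
  have hFe := hF.pos he0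
  have hR : 0 < inradius F (slab e a) := by rw [inradius_slab hF he ha]; positivity
  obtain ⟨D, hD⟩ := exists_robinEigenvalue_slab_le (β := β) hp hF he ha hκ
  have hgs := integral_groundState hp hκ hR hκβ
  have hBpos : 0 < ∫ s in Ioo (-inradius F (slab e a)) (inradius F (slab e a)),
      coshP p (κ * s) ^ p := integral_coshP_rpow_pos hp κ hR
  generalize inradius F (slab e a) = R at *
  set A := ∫ s in Ioo (-R) R, (κ * sinhP p |κ * s|) ^ p with hA
  set B := ∫ s in Ioo (-R) R, coshP p (κ * s) ^ p with hB
  have hlim : Tendsto (fun ε : ℝ => ((1 - ε) ^ (1 - p) * A + ε * D +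
      2 * β * coshP p (κ * R) ^ p) / B) (𝓝[>] 0) (𝓝 (-((p - 1) * κ ^ p))) := by
    have h1 : ContinuousAt (fun ε : ℝ => ((1 - ε) ^ (1 - p) * A + ε * D +
        2 * β * coshP p (κ * R) ^ p) / B) 0 := by
      have h2 : ContinuousAt (fun ε : ℝ => (1 - ε) ^ (1 - p)) 0 :=
        (continuousAt_const.sub continuousAt_id).rpow_const (Or.inl (by simp))
      exact (((h2.mul continuousAt_const).add (continuousAt_id.mul continuousAt_const)).add
        continuousAt_const).div_const B
    have h3 : ((1 - (0 : ℝ)) ^ (1 - p) * A + 0 * D + 2 * β * coshP p (κ * R) ^ p) / B =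
        -((p - 1) * κ ^ p) := by
      rw [sub_zero, Real.one_rpow, div_eq_iff hBpos.ne', ← hgs, abs_of_neg hβ]
      ring
    rw [← h3]
    exact h1.tendsto.mono_left nhdsWithin_le_nhds
  refine ge_of_tendsto ((continuous_coe_real_ereal.tendsto _).comp hlim) ?_
  filter_upwards [Ioo_mem_nhdsGT (zero_lt_one' ℝ)] with ε hε
  exact hD ε hε.1 hε.2

end SlabEigenvalue

end RobinFinsler

end

/-- For every bounded anisotropic mean convex `C²` domain, the root of the one-dimensional equation
exists, is unique, and bounds the first Robin eigenvalue from above; on every infinite slab the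
first Robin eigenvalue is equal to this root. -/
theorem theorem1p4 (N : ℕ) (hN : 2 ≤ N) (p : ℝ) (hp : 1 < p)
    (F : EuclideanSpace ℝ (Fin N) → ℝ) (hF : RobinFinsler.IsFinslerNorm p F)
    (β : ℝ) (hβ : β < 0) :
    (∀ Ω : Set (EuclideanSpace ℝ (Fin N)), RobinFinsler.IsC2Domain Ω → Bornology.IsBounded Ω →
      (∀ y ∈ frontier Ω, 0 ≤ RobinFinsler.anisotropicMeanCurvature F Ω y) →
      ∃ μ : ℝ, RobinFinsler.IsNegativeRoot p β (RobinFinsler.inradius F Ω) μ ∧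
        (∀ μ' : ℝ, RobinFinsler.IsNegativeRoot p β (RobinFinsler.inradius F Ω) μ' → μ' = μ) ∧
        RobinFinsler.robinEigenvalue p F β Ω ≤ (μ : EReal)) ∧
    (∀ (e : EuclideanSpace ℝ (Fin N)) (a : ℝ), ‖e‖ = 1 → 0 < a →
      ∃ μ : ℝ, RobinFinsler.IsNegativeRoot p β
          (RobinFinsler.inradius F (RobinFinsler.slab e a)) μ ∧
        (∀ μ' : ℝ, RobinFinsler.IsNegativeRoot p β
          (RobinFinsler.inradius F (RobinFinsler.slab e a)) μ' → μ' = μ) ∧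
        RobinFinsler.robinEigenvalue p F β (RobinFinsler.slab e a) = (μ : EReal)) := by
  obtain ⟨n, rfl⟩ : ∃ n, N = n + 1 := ⟨N - 1, by omega⟩
  refine ⟨fun Ω hΩ hb hcurv => ?_, fun e a he ha => ?_⟩
  · obtain ⟨hR, hle⟩ := RobinFinsler.robinEigenvalue_le_of_meanConvex hp hF hβ hΩ hb hcurv
    obtain ⟨κ, hκ, hκβ, hroot, huniq⟩ := RobinFinsler.exists_isNegativeRoot hp hβ hR
    exact ⟨_, hroot, huniq, hle κ hκ hκβ⟩
  · have he0 : e ≠ 0 := by intro h; simp [h] at he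
    have hFe := hF.pos he0
    have hR : 0 < RobinFinsler.inradius F (RobinFinsler.slab e a) := by
      rw [RobinFinsler.inradius_slab hF he ha]; positivity
    obtain ⟨κ, hκ, hκβ, hroot, huniq⟩ := RobinFinsler.exists_isNegativeRoot hp hβ hR
    refine ⟨_, hroot, huniq, le_antisymm
      (RobinFinsler.robinEigenvalue_slab_le hp hF hβ he ha hκ hκβ) (le_sInf ?_)⟩
    rintro _ ⟨u, G, g, hu, ht, hne, rfl⟩
    exact EReal.coe_le_coe_iff.2 (RobinFinsler.le_rayleigh_slab hp hF hβ he ha hκ hκβ hu ht hne)
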